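/- Let $ACVF$ be the theory of algebraically closed fields with a nontrivial valuation $v$, in the language of rings together with a binary predicate for divisibility ($x\mid y$ if and only if $v(x)\le v(y)$). For models $M\prec N$ of a theory and $n\ge 1$, let $T_n(M,N)$ say that for every $a\in N^n$ the type $tp(a/M)$ is definable, i.e. for every formula $\varphi(x,y)$, with $x$ an $n$-tuple and $y$ a finite tuple of variables, there is a formula $\delta(y)$ with parameters in $M$ such that for all tuples $b$ from $M$, $N\models\varphi(a,b)$ if and only if $M\models\delta(b)$. **Proposition 1.8.** For every $n\ge 1$ there is an elementary extension $K\prec L$ of models of $ACVF$ such that $T_n(K,L)$ holds but $T_{n+1}(K,L)$ fails. Moreover, the complete theory of $K$ is $C$-minimal with respect to the $C$-relation $C(x,y,z)\Leftrightarrow v(x-y)<v(y-z)$: this relation satisfies, for all $x,y,z,w\in K$, - $C(x,y,z)\rightarrow C(x,z,y)$, - $C(x,y,z)\rightarrow\neg C(y,x,z)$, - $C(x,y,z)\rightarrow (C(w,y,z)\vee C(x,w,z))$, - $x\neq y\rightarrow C(x,y,y)$, and in every structure elementarily equivalent to $K$, every subset of the universe that is definable with parameters is definable by a quantifier-free formula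 with parameters using only $C$ and equality. In particular (case $n=1$), the Marker–Steinhorn theorem (for models $M\prec N$ of an o-minimal theory, $T_1(M,N)$ implies $T_m(M,N)$ for all $m\ge 1$) extends neither to $ACVF$ nor to $C$-minimal theories. -/

import Mathlib

open FirstOrder

namespace ModelPairs

/-! ### Definable types and the property `T_n` for an elementary pair -/

section Types

universe u v w

variable {L : FirstOrder.Language.{u, v}} {N : Type w} [L.Structure N]

/-- The type `tp(c/M)` of a finite tuple `c` from `N` over the elementary substructure `M ≺ N` is
definable: for every formula `φ(x, y)` there is a formula `δ(y)` with parameters in `M` such that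
for all `a` in `M`, the formula `φ(x, a)` belongs to `tp(c/M)`, that is `N ⊨ φ(c, a)`, if and only
if `M ⊨ δ(a)`. In other words, the set of those `a` is definable in `M` with parameters in `M`. -/
def TypeIsDefinable (M : L.ElementarySubstructure N) {n : ℕ} (c : Fin n → N) : Prop :=
  ∀ (m : ℕ) (φ : L.Formula (Fin n ⊕ Fin m)),
    (Set.univ : Set M).Definable L
      {a : Fin m → M | φ.Realize (Sum.elim c fun i => (a i : N))}

/-- `T_n(M, N)`: for every `c ∈ N^n`, the type `tp(c/M)` is definable. -/
def TypesDefinable (n : ℕ) (M : L.ElementarySubstructure N) : Prop :=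
  ∀ c : Fin n → N, TypeIsDefinable M c

end Types

/-! ### `C`-minimality -/

section CMinimal

/-- The single symbol of the language of `C`-relations. -/
inductive CRel : ℕ → Type
  | rel : CRel 3

/-- The language with one ternary relation symbol `C`. -/
def langC : FirstOrder.Language.{0, 0} := ⟨fun _ => Empty, CRel⟩

/-- The axioms (C1)-(C4) of a `C`-set for a ternary relation. -/
structure IsCSet {M : Type*} (C : M → M → M → Prop) : Prop where
  c1 : ∀ x y z, C x y z → C x z y
  c2 : ∀ x y z, C x y z → ¬ C y x z
  c3 : ∀ x y z w, C x y z → C w y z ∨ C x w z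
  c4 : ∀ x y, x ≠ y → C x y y

/-- The ternary relation defined on `M` by a parameter-free formula in three variables. -/
def relOf {L : FirstOrder.Language.{0, 0}} (γ : L.Formula (Fin 3)) (M : Type) [L.Structure M]
    (x y z : M) : Prop :=
  γ.Realize ![x, y, z]

/-- A ternary relation as a structure for the language with the one symbol `C`. -/
abbrev structureC {M : Type} (C : M → M → M → Prop) : langC.Structure M where
  funMap f := f.elim
  RelMap {_} r := match r with
    | CRel.rel => fun x => C (x 0) (x 1) (x 2)

/-- `D` is definable by a quantifier-free formula, with parameters, in the language whose only
relation symbol (beside equality) is `C`. -/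
def IsQFDefinableC {M : Type} (C : M → M → M → Prop) (D : Set M) : Prop :=
  letI : langC.Structure M := structureC C
  ∃ φ : langC.Formula (M ⊕ Unit), φ.IsQF ∧ ∀ x : M, x ∈ D ↔ φ.Realize (Sum.elim id fun _ => x)

/-- The structure `M`, regarded as a `C`-structure through the `C`-relation that `γ` defines in it,
is `C`-minimal: in every structure elementarily equivalent to `M`, every definable (with
parameters) subset of the universe is quantifier-free definable from `C`. -/
def IsCMinimal {L : FirstOrder.Language.{0, 0}} (γ : L.Formula (Fin 3)) (M : Type) [L.Structure M] : Prop :=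
  IsCSet (relOf γ M) ∧
    ∀ (N : Type) [L.Structure N], L.ElementarilyEquivalent M N →
      ∀ D : Set N, (Set.univ : Set N).Definable₁ L D → IsQFDefinableC (relOf γ N) D

/-- A complete theory is `C`-minimal (for the `C`-relation defined by `γ`) if it has a `C`-minimal
model. -/
def IsCMinimalTheory {L : FirstOrder.Language.{0, 0}} (γ : L.Formula (Fin 3)) (T : L.Theory) : Prop :=
  T.IsComplete ∧ ∃ (M : Type) (_ : Nonempty M) (_ : L.Structure M), T.Model M ∧ IsCMinimal γ M

end CMinimal

/-! ### Algebraically closed valued fields -/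

section ACVF

/-- The symbol for the divisibility relation of a valued field. -/
inductive DivRel : ℕ → Type
  | dvd : DivRel 2

/-- The language with one binary relation symbol. -/
def langDiv : FirstOrder.Language.{0, 0} := ⟨fun _ => Empty, DivRel⟩

/-- The language of valued fields: the language of rings together with a binary predicate for the
divisibility relation `x | y`. -/
abbrev langVF : FirstOrder.Language.{0, 0} := FirstOrder.Language.ring.sum langDiv

/-- A valued field as a structure for the language of valued fields. The divisibility relation
`x | y` says that the additively written valuation of `x` is at most that of `y`; Mathlib's
valuations are multiplicative, with the order reversed, so this is `v y ≤ v x`. -/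
@[reducible]
def valuedFieldStructure {F Γ : Type} [Field F] [LinearOrderedCommGroupWithZero Γ]
    (v : Valuation F Γ) : langVF.Structure F :=
  letI : FirstOrder.Language.ring.Structure F := (Ring.compatibleRingOfRing F).toStructure
  letI : langDiv.Structure F :=
    { funMap := fun f => f.elim
      RelMap := fun {_} r => match r with
        | DivRel.dvd => fun x => v (x 1) ≤ v (x 0) }
  FirstOrder.Language.sumStructure FirstOrder.Language.ring langDiv F

/-- `M` is a model of ACVF: its structure is that of an algebraically closed field with a
nontrivial valuation. -/
def IsACVF (M : Type) [S : langVF.Structure M] : Prop :=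
  ∃ (_ : Field M) (Γ : Type) (_ : LinearOrderedCommGroupWithZero Γ) (v : Valuation M Γ),
    IsAlgClosed M ∧ v.IsNontrivial ∧ S = valuedFieldStructure v

/-- The formula `¬ (x₁ - x₂ | x₀ - x₁)`, which defines in a valued field the `C`-relation
`C(x, y, z) ↔ v(x - y) < v(y - z)` (`v` written additively). -/
def cFormula : langVF.Formula (Fin 3) :=
  let sub (i j : Fin 3) : langVF.Term (Fin 3) :=
    FirstOrder.Language.LHom.sumInl.onTerm
      (FirstOrder.Language.Term.var i + -Language.Term.var j : FirstOrder.Language.ring.Term (Fin 3))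
  let dvd : langVF.Relations 2 := Sum.inr DivRel.dvd
  (dvd.formula₂ (sub 1 2) (sub 0 1)).not

/-- The relation defined by `cFormula` in a valued field; as `v` is multiplicative here, the
inequality is reversed. -/
theorem relOf_cFormula {F Γ : Type} [Field F] [LinearOrderedCommGroupWithZero Γ]
    (v : Valuation F Γ) (x y z : F) :
    letI := valuedFieldStructure v
    relOf cFormula F x y z ↔ v (y - z) < v (x - y) := by
  have h : ∀ a b : F, v (a + -b) = v (a - b) := fun a b => by rw [sub_eq_add_neg]
  rw [← not_le, ← h, ← h]
  exact Iff.rfl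

end ACVF

end ModelPairs

/-! The pair sits inside two fields of Hahn series with rational exponents. Let `H` be the one over
an algebraically closed `k` of characteristic zero, and `Ω` the one over an algebraically closed
`k'` containing τ₁,…,τₙ algebraically independent over `k`; let tᵢ be the constant series τᵢ. By
`exists_dense_subfield_hahn`, `H` has a dense algebraically closed subfield `K` over which some
α₀,…,αₙ in `H` are algebraically independent. Put b = α₀ + ∑ αᵢtᵢ. The large model `M` is the
algebraic closure of K(b, t) in `Ω`, of transcendence degree n+1 over `K`. Valuations are
multiplicative, so v(x - y) is a distance.

An (n+1)-tuple whose type is not definable: the elements 1, t₁,…,tₙ are orthonormal over `H`, that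
is, a linear combination has the largest of the values of its coefficients. Hence v(b - y₀ - ∑ yᵢtᵢ)
≤ v(z) says that y lies in the polydisc of radius v(z) around α. If the type of (b, t) were
definable, quantifier elimination would let this condition on (z, y) depend only on comparisons
among finitely many values v(P(z, y)) with P over `K`. Since α is algebraically independent over
`K`, these values depend on z alone for (z, y) close to (0, α) (`exists_near_val_const`), so they
cannot tell a point of the polydisc from a nearby point outside it.

Types of n-tuples are definable: fix c in Mⁿ and f(x, y). The monomials in c that occur in f span a
finite-dimensional `K`-space. If this space has a basis orthonormal over `H`, then v(f(c, a)) is a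
maximum of finitely many v(Pⱼ(a)), which gives definability (`typeIsDefinable_of_max`). Orthonormal
bases exist over `H` because `H` is spherically complete, and they can be moved into the `K`-span
because `K` is dense in `H` (`exists_orthonormal_of_dense`). What remains is that `K`-independent
elements algebraic over K(c) stay independent over `H` (`GenericLine.linearIndependent`). This is
where the length n matters: up to n elements of `M` algebraically independent over `K` remain so
over `H` (`algebraicIndependent_of_encard_le`), because the equation of b has generic coefficients.
Derivations prove this, and also the linear disjointness that follows from it.

Model theory: quantifier elimination is used in the semantic form `exists_determining`, that a
formula depends only on the comparison of the values of finitely many integral polynomials. It comes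
from the conjugacy of valuations in algebraic extensions (`exists_conj`), the analysis of one new
element by its distances to finitely many centres (`det_val_le`, `ExtPoint.exists_equiv`), and
ultraproducts. It shows that `K` is an elementary substructure of `M`, and its one-variable case
gives `C`-minimality. -/

namespace ModelPairs

/-! ### One-variable analysis over an algebraically closed valued field -/

section OneVariable

/-- A point of a valued field extension of the valued field `(E, vE)`. -/
structure ExtPoint {E ΓE : Type} [Field E] [LinearOrderedCommGroupWithZero ΓE]
    (vE : Valuation E ΓE) where
  carrier : Type
  [field : Field carrier]
  Γ : Type
  [group : LinearOrderedCommGroupWithZero Γ]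
  v : Valuation carrier Γ
  i : E →+* carrier
  le_iff : ∀ a b, v (i a) ≤ v (i b) ↔ vE a ≤ vE b
  x : carrier

attribute [instance] ExtPoint.field ExtPoint.group

variable {E ΓE : Type} [Field E] [LinearOrderedCommGroupWithZero ΓE] {vE : Valuation E ΓE}

namespace ExtPoint

/-- The value of a polynomial at a point. -/
noncomputable def val (p : ExtPoint vE) (P : Polynomial E) : p.Γ := p.v (P.eval₂ p.i p.x)

theorem val_mul (p : ExtPoint vE) (P Q : Polynomial E) : p.val (P * Q) = p.val P * p.val Q := by
  simp [val, Polynomial.eval₂_mul]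

theorem val_C (p : ExtPoint vE) (a : E) : p.val (Polynomial.C a) = p.v (p.i a) := by
  simp [val]

/-- The distance of a point to an element of the base field. -/
noncomputable def dist (p : ExtPoint vE) (r : E) : p.Γ := p.v (p.x - p.i r)

theorem val_X_sub_C (p : ExtPoint vE) (r : E) :
    p.val (Polynomial.X - Polynomial.C r) = p.dist r := by
  simp [val, dist]

theorem lt_iff (p : ExtPoint vE) (a b : E) : p.v (p.i a) < p.v (p.i b) ↔ vE a < vE b := by
  rw [← not_le, ← not_le, p.le_iff]

theorem dist_eq_of_lt {p : ExtPoint vE} {r a : E} (h : p.dist r < p.v (p.i (r - a))) :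
    p.dist a = p.v (p.i (r - a)) := by
  have : p.x - p.i a = (p.x - p.i r) + p.i (r - a) := by simp
  rw [dist, this]
  exact Valuation.map_add_eq_of_lt_right _ h

theorem dist_eq_of_gt {p : ExtPoint vE} {r a : E} (h : p.v (p.i (r - a)) < p.dist r) :
    p.dist a = p.dist r := by
  have : p.x - p.i a = (p.x - p.i r) + p.i (r - a) := by simp
  rw [dist, this]
  exact Valuation.map_add_eq_of_lt_left _ h

theorem dist_le_max (p : ExtPoint vE) (r a : E) :
    p.dist a ≤ max (p.dist r) (p.v (p.i (r - a))) := by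
  have : p.x - p.i a = (p.x - p.i r) + p.i (r - a) := by simp
  rw [dist, this]
  exact Valuation.map_add _ _ _

/-- Two points have the same position relative to the finite set `R`. -/
def Equiv (R : Finset E) (p q : ExtPoint vE) : Prop :=
  ∀ r ∈ R, ∀ s ∈ R, (p.dist r ≤ p.dist s ↔ q.dist r ≤ q.dist s) ∧
    (p.dist r ≤ p.v (p.i (r - s)) ↔ q.dist r ≤ q.v (q.i (r - s))) ∧
    (p.v (p.i (r - s)) ≤ p.dist r ↔ q.v (q.i (r - s)) ≤ q.dist r)

theorem Equiv.mono {R S : Finset E} (h : R ⊆ S) {p q : ExtPoint vE} (hpq : Equiv S p q) :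
    Equiv R p q := fun r hr s hs => hpq r (h hr) s (h hs)

/-- A property of points which depends only on the position relative to a finite set. -/
def Det (A : ExtPoint vE → Prop) : Prop :=
  ∃ R : Finset E, ∀ p q, Equiv R p q → (A p ↔ A q)

theorem Det.of_iff {A B : ExtPoint vE → Prop} (hA : Det A) (h : ∀ p, A p ↔ B p) : Det B := by
  obtain ⟨R, hR⟩ := hA
  exact ⟨R, fun p q hpq => by rw [← h, ← h, hR p q hpq]⟩

theorem Det.not {A : ExtPoint vE → Prop} (hA : Det A) : Det fun p => ¬ A p := by
  obtain ⟨R, hR⟩ := hA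
  exact ⟨R, fun p q hpq => not_congr (hR p q hpq)⟩

theorem Det.and {A B : ExtPoint vE → Prop} (hA : Det A) (hB : Det B) :
    Det fun p => A p ∧ B p := by
  classical
  obtain ⟨R, hR⟩ := hA
  obtain ⟨S, hS⟩ := hB
  exact ⟨R ∪ S, fun p q hpq => and_congr
    (hR p q (hpq.mono Finset.subset_union_left)) (hS p q (hpq.mono Finset.subset_union_right))⟩

theorem Det.or {A B : ExtPoint vE → Prop} (hA : Det A) (hB : Det B) :
    Det fun p => A p ∨ B p :=
  (hA.not.and hB.not).not.of_iff fun p => by tauto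

theorem Det.of_base {A : ExtPoint vE → Prop} (P : Prop) (h : ∀ p, A p ↔ P) : Det A :=
  ⟨∅, fun p q _ => by rw [h, h]⟩

/-! ### Comparisons determined by finitely many centres -/

theorem det_dist_le_dist (r s : E) : Det fun p : ExtPoint vE => p.dist r ≤ p.dist s := by
  classical
  exact ⟨{r, s}, fun p q h => (h r (by simp) s (by simp)).1⟩

theorem det_dist_le (r a : E) : Det fun p : ExtPoint vE => p.dist r ≤ p.v (p.i a) := by
  classical
  exact ⟨{r, r - a}, fun p q h => by
    simpa using (h r (by simp) (r - a) (by simp)).2.1⟩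

theorem det_le_dist (r a : E) : Det fun p : ExtPoint vE => p.v (p.i a) ≤ p.dist r := by
  classical
  exact ⟨{r, r - a}, fun p q h => by
    simpa using (h r (by simp) (r - a) (by simp)).2.2⟩

theorem det_dist_eq_zero (r : E) : Det fun p : ExtPoint vE => p.dist r = 0 :=
  (det_dist_le r 0).of_iff fun p => by simp

/-- Dividing out the common power of the distance leaves a comparison of its m-th power with the
value of some base element e. As `E` is algebraically closed, e = f ^ m, so this is a comparison of
the distance itself with v(f). Distance zero is treated apart because there one cannot divide. -/
theorem det_monomial [IsAlgClosed E] (c d r : E) (k l : ℕ) :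
    Det fun p : ExtPoint vE =>
      p.v (p.i c) * p.dist r ^ k ≤ p.v (p.i d) * p.dist r ^ l := by
  by_cases hd : d = 0
  · subst hd
    by_cases hc : c = 0
    · subst hc
      exact Det.of_base True fun p => by simp
    · rcases Nat.eq_zero_or_pos k with rfl | hk
      · exact Det.of_base False fun p => by simp [hc]
      · exact (det_dist_eq_zero r).of_iff fun p => by simp [hc, hk.ne']
  by_cases hc : c = 0
  · subst hc
    exact Det.of_base True fun p => by simp
  have aux : ∀ m : ℕ, ∀ e : E, e ≠ 0 → 0 < m → ∃ f : E, f ^ m = e := fun m e _ hm =>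
    IsAlgClosed.exists_pow_nat_eq e hm
  have key : ∀ p : ExtPoint vE, p.dist r ≠ 0 →
      (∀ m, k = l + m → (p.v (p.i c) * p.dist r ^ k ≤ p.v (p.i d) * p.dist r ^ l ↔
        p.dist r ^ m ≤ p.v (p.i (d / c)))) ∧
      (∀ m, l = k + m → (p.v (p.i c) * p.dist r ^ k ≤ p.v (p.i d) * p.dist r ^ l ↔
        p.v (p.i (c / d)) ≤ p.dist r ^ m)) := by
    intro p hp
    have hc' : 0 < p.v (p.i c) := by simpa [zero_lt_iff] using hc
    have hd' : 0 < p.v (p.i d) := by simpa [zero_lt_iff] using hd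
    have hp' : 0 < p.dist r := by simpa [zero_lt_iff] using hp
    refine ⟨fun m hm => ?_, fun m hm => ?_⟩
    · rw [hm, pow_add, map_div₀, map_div₀, le_div_iff₀ hc', mul_left_comm, mul_comm (p.v (p.i d)),
        mul_le_mul_iff_right₀ (pow_pos hp' l), mul_comm]
    · rw [hm, pow_add, map_div₀, map_div₀, div_le_iff₀ hd', mul_comm (p.v (p.i c)),
        mul_left_comm, mul_le_mul_iff_right₀ (pow_pos hp' k), mul_comm (p.v (p.i d))]
  have hzero : Det fun p : ExtPoint vE => p.dist r = 0 ∧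
      (p.v (p.i c) * p.dist r ^ k ≤ p.v (p.i d) * p.dist r ^ l) := by
    rcases Nat.eq_zero_or_pos k with rfl | hk
    · rcases Nat.eq_zero_or_pos l with rfl | hl
      · exact ((det_dist_eq_zero r).and (Det.of_base (vE c ≤ vE d)
          (fun p => p.le_iff c d))).of_iff fun p => by simp
      · refine Det.of_base False fun p => ?_
        simp only [iff_false, not_and]
        intro h
        simp [h, hl.ne', hc]
    · exact (det_dist_eq_zero r).of_iff fun p => by
        refine ⟨fun h => ⟨h, ?_⟩, fun h => h.1⟩
        simp [h, hk.ne']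
  have hne : Det fun p : ExtPoint vE => ¬ p.dist r = 0 ∧
      (p.v (p.i c) * p.dist r ^ k ≤ p.v (p.i d) * p.dist r ^ l) := by
    rcases le_total l k with h | h
    · obtain ⟨m, rfl⟩ := Nat.exists_eq_add_of_le h
      rcases Nat.eq_zero_or_pos m with rfl | hm
      · refine ((det_dist_eq_zero r).not.and (Det.of_base (vE 1 ≤ vE (d / c))
          (fun p => p.le_iff 1 (d / c)))).of_iff fun p => and_congr_right fun hp => ?_
        rw [(key p hp).1 0 rfl]
        simp
      · obtain ⟨f, hf⟩ := aux m (d / c) (div_ne_zero hd hc) hm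
        refine ((det_dist_eq_zero r).not.and (det_dist_le r f)).of_iff
          fun p => and_congr_right fun hp => ?_
        rw [(key p hp).1 m rfl, ← hf, map_pow, map_pow, pow_le_pow_iff_left₀ zero_le zero_le hm.ne']
    · obtain ⟨m, rfl⟩ := Nat.exists_eq_add_of_le h
      rcases Nat.eq_zero_or_pos m with rfl | hm
      · refine ((det_dist_eq_zero r).not.and (Det.of_base (vE (c / d) ≤ vE 1)
          (fun p => p.le_iff (c / d) 1))).of_iff fun p => and_congr_right fun hp => ?_
        rw [(key p hp).2 0 rfl]
        simp
      · obtain ⟨f, hf⟩ := aux m (c / d) (div_ne_zero hc hd) hm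
        refine ((det_dist_eq_zero r).not.and (det_le_dist r f)).of_iff
          fun p => and_congr_right fun hp => ?_
        rw [(key p hp).2 m rfl, ← hf, map_pow, map_pow, pow_le_pow_iff_left₀ zero_le zero_le hm.ne']
  exact (hzero.or hne).of_iff fun p => by tauto

/-- Induction on the number of linear factors; each step removes one factor `dist a` at the price of
changing the coefficients, the exponents or the centre `r` of the monomials. -/
theorem det_prod [IsAlgClosed E] (N : ℕ) : ∀ (A B : Multiset E), A.card + B.card = N →
    ∀ (c d r : E) (k l : ℕ), Det fun p : ExtPoint vE =>
      p.v (p.i c) * p.dist r ^ k * (A.map p.dist).prod ≤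
        p.v (p.i d) * p.dist r ^ l * (B.map p.dist).prod := by
  -- The ultrametric trichotomy. If x is closer to r than a is, then `dist a` is the constant v(r -
  -- a). If `dist a = dist r`, the factor raises an exponent. Otherwise `dist r` is the constant v(r
  -- - a), and the monomials are recentred at a.
  have split : ∀ (P : ExtPoint vE → Prop) (r a : E),
      Det (fun p => p.dist r < p.v (p.i (r - a)) ∧ P p) →
      Det (fun p => p.dist a = p.dist r ∧ P p) →
      Det (fun p => p.dist a < p.dist r ∧ p.dist r = p.v (p.i (r - a)) ∧ P p) → Det P := by
    intro P r a h1 h2 h3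
    refine (h1.or (h2.or h3)).of_iff fun p => ?_
    rcases lt_trichotomy (p.dist r) (p.v (p.i (r - a))) with h | h | h
    · have := h.ne
      have h' : p.dist a ≠ p.dist r := by rw [dist_eq_of_lt h]; exact h.ne'
      tauto
    · have h' := p.dist_le_max r a
      rw [← h, max_self, le_iff_lt_or_eq] at h'
      have := h.not_lt
      tauto
    · have h' := dist_eq_of_gt h
      tauto
  have dlt : ∀ r a : E, Det fun p : ExtPoint vE => p.dist r < p.v (p.i a) := fun r a =>
    (det_le_dist r a).not.of_iff fun p => not_le
  have deq : ∀ r a : E, Det fun p : ExtPoint vE => p.dist r = p.v (p.i a) := fun r a =>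
    ((det_le_dist r a).and (det_dist_le r a)).of_iff fun p => by
      rw [le_antisymm_iff, and_comm]
  have ddeq : ∀ r a : E, Det fun p : ExtPoint vE => p.dist r = p.dist a := fun r a =>
    ((det_dist_le_dist r a).and (det_dist_le_dist a r)).of_iff fun p => by
      rw [le_antisymm_iff]
  have ddlt : ∀ r a : E, Det fun p : ExtPoint vE => p.dist r < p.dist a := fun r a =>
    (det_dist_le_dist a r).not.of_iff fun p => not_le
  induction N with
  | zero =>
    intro A B hAB c d r k l
    have hA : A = 0 := Multiset.card_eq_zero.1 (by omega)
    have hB : B = 0 := Multiset.card_eq_zero.1 (by omega)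
    subst hA hB
    simpa using det_monomial c d r k l
  | succ N ih =>
    intro A B hAB c d r k l
    rcases A.empty_or_exists_mem with rfl | ⟨a, ha⟩
    · rcases B.empty_or_exists_mem with rfl | ⟨a, ha⟩
      · simp at hAB
      obtain ⟨B, rfl⟩ := Multiset.exists_cons_of_mem ha
      rw [Multiset.card_cons] at hAB
      refine split _ r a ?_ ?_ ?_
      · refine ((dlt r (r - a)).and (ih 0 B (by omega) c (d * (r - a)) r k l)).of_iff
          fun p => and_congr_right fun h => ?_
        rw [Multiset.map_cons, Multiset.prod_cons, dist_eq_of_lt h, map_mul, map_mul]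
        simp only [mul_comm, mul_left_comm]
      · refine ((ddeq a r).and (ih 0 B (by omega) c d r k (l + 1))).of_iff
          fun p => and_congr_right fun h => ?_
        rw [Multiset.map_cons, Multiset.prod_cons, h]
        simp only [pow_succ, mul_assoc, mul_comm]
      · refine ((ddlt a r).and ((deq r (r - a)).and
          (ih 0 B (by omega) (c * (r - a) ^ k) (d * (r - a) ^ l) a 0 1))).of_iff
          fun p => and_congr_right fun _ => and_congr_right fun h => ?_
        rw [Multiset.map_cons, Multiset.prod_cons, h]
        simp only [map_mul, map_pow, pow_zero, pow_one, mul_one, mul_assoc]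
    · obtain ⟨A, rfl⟩ := Multiset.exists_cons_of_mem ha
      rw [Multiset.card_cons] at hAB
      refine split _ r a ?_ ?_ ?_
      · refine ((dlt r (r - a)).and (ih A B (by omega) (c * (r - a)) d r k l)).of_iff
          fun p => and_congr_right fun h => ?_
        rw [Multiset.map_cons, Multiset.prod_cons, dist_eq_of_lt h, map_mul, map_mul]
        simp only [mul_comm, mul_left_comm]
      · refine ((ddeq a r).and (ih A B (by omega) c d r (k + 1) l)).of_iff
          fun p => and_congr_right fun h => ?_
        rw [Multiset.map_cons, Multiset.prod_cons, h]
        simp only [pow_succ, mul_assoc, mul_comm]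
      · refine ((ddlt a r).and ((deq r (r - a)).and
          (ih A B (by omega) (c * (r - a) ^ k) (d * (r - a) ^ l) a 1 0))).of_iff
          fun p => and_congr_right fun _ => and_congr_right fun h => ?_
        rw [Multiset.map_cons, Multiset.prod_cons, h]
        simp only [map_mul, map_pow, pow_zero, pow_one, mul_one, mul_assoc]

theorem val_eq_prod [IsAlgClosed E] (p : ExtPoint vE) (P : Polynomial E) :
    p.val P = p.v (p.i P.leadingCoeff) * (P.roots.map p.dist).prod := by
  have hP : P = Polynomial.C P.leadingCoeff *
      (P.roots.map fun a => Polynomial.X - Polynomial.C a).prod :=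
    (IsAlgClosed.splits P).eq_prod_roots
  conv_lhs => rw [hP]
  rw [val_mul, val_C]
  congr 1
  generalize P.roots = s
  induction s using Multiset.induction_on with
  | empty => simp [val]
  | cons a s ih => simp only [Multiset.map_cons, Multiset.prod_cons, val_mul, ih, val_X_sub_C]

/-- The comparison of the values of two polynomials depends only on the position of the point
relative to a finite set. -/
theorem det_val_le [IsAlgClosed E] (P Q : Polynomial E) :
    Det fun p : ExtPoint vE => p.val P ≤ p.val Q :=
  (det_prod _ P.roots Q.roots rfl P.leadingCoeff Q.leadingCoeff 0 0 0).of_iff fun p => by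
    simp [val_eq_prod]

end ExtPoint

/-- In an algebraically closed valued field, finitely many residue classes can be avoided. -/
theorem exists_unit_avoiding {N Γ : Type*} [Field N] [IsAlgClosed N]
    [LinearOrderedCommGroupWithZero Γ] (w : Valuation N Γ) (U : Finset N)
    (hU : ∀ a ∈ U, w a ≤ 1) : ∃ u, w u = 1 ∧ ∀ a ∈ U, w (u - a) = 1 := by
  classical
  -- A root u satisfies u ∏ (u - a) = -1; once every factor is known to have value at most 1, every
  -- factor has value exactly 1.
  let f : Polynomial N := Polynomial.X * (∏ a ∈ U, (Polynomial.X - Polynomial.C a)) + Polynomial.C 1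
  have hdeg : f.degree ≠ 0 := by
    have h1 : (Polynomial.X * (∏ a ∈ U, (Polynomial.X - Polynomial.C a)) : Polynomial N).degree =
        1 + U.card := by
      rw [Polynomial.degree_mul, Polynomial.degree_X, Polynomial.degree_prod]
      simp
    have h2 : f.degree = 1 + U.card := by
      rw [← h1]
      refine Polynomial.degree_add_eq_left_of_degree_lt ?_
      rw [h1, Polynomial.degree_C one_ne_zero]
      exact_mod_cast (by omega : 0 < 1 + U.card)
    rw [h2]
    exact_mod_cast (by omega : 1 + U.card ≠ 0)
  obtain ⟨u, hu⟩ := IsAlgClosed.exists_root f hdeg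
  have hu' : u * ∏ a ∈ U, (u - a) = -1 := by
    have : u * ∏ a ∈ U, (u - a) + 1 = 0 := by
      simpa [f, Polynomial.IsRoot, Polynomial.eval_prod] using hu
    linear_combination this
  have hv : w u * ∏ a ∈ U, w (u - a) = 1 := by
    rw [← map_prod, ← map_mul, hu', Valuation.map_neg, map_one]
  have hle : w u ≤ 1 := by
    by_contra h
    push Not at h
    have : ∀ a ∈ U, w (u - a) = w u := fun a ha =>
      Valuation.map_sub_eq_of_lt_left _ ((hU a ha).trans_lt h)
    rw [Finset.prod_congr rfl this, Finset.prod_const, ← pow_succ'] at hv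
    exact (one_lt_pow₀ h (Nat.succ_ne_zero _)).ne' hv
  have hle' : ∀ a ∈ U, w (u - a) ≤ 1 := fun a ha =>
    (Valuation.map_sub _ _ _).trans (max_le hle (hU a ha))
  have hprod : ∏ a ∈ U, w (u - a) ≤ 1 := Finset.prod_le_one' hle'
  have hu1 : w u = 1 := by
    refine le_antisymm hle ?_
    calc 1 = w u * ∏ a ∈ U, w (u - a) := hv.symm
      _ ≤ w u * 1 := mul_le_mul_right hprod _
      _ = w u := mul_one _
  refine ⟨u, hu1, fun a ha => ?_⟩
  rw [hu1, one_mul] at hv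
  exact (Finset.prod_eq_one_iff_of_le_one' hle').1 hv a ha

/-- Points at a given distance from `r` that are in general position with respect to `S`. -/
theorem exists_generic {N Γ : Type*} [Field N] [IsAlgClosed N]
    [LinearOrderedCommGroupWithZero Γ] (w : Valuation N Γ) (S : Finset N) (r z : N) :
    ∃ y, ∀ s ∈ S, w (y - s) = max (w z) (w (r - s)) := by
  classical
  by_cases hz : z = 0
  · exact ⟨r, fun s _ => by simp [hz]⟩
  have hz' : 0 < w z := by simpa [zero_lt_iff] using hz
  -- After moving r to 0 and scaling by z, only the points of S within distance v(z) of r have a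
  -- residue that u must avoid; the others lie too far away to be affected.
  let U := (S.image fun s => (s - r) / z).filter fun a => w a ≤ 1
  obtain ⟨u, hu, hU⟩ := exists_unit_avoiding w U fun a ha => (Finset.mem_filter.1 ha).2
  refine ⟨r + z * u, fun s hs => ?_⟩
  have h1 : r + z * u - s = z * (u - (s - r) / z) := by field_simp; ring
  by_cases h : w (r - s) ≤ w z
  · have h2 : w ((s - r) / z) ≤ 1 := by
      rw [map_div₀, Valuation.map_sub_swap]
      exact div_le_one_of_le₀ h zero_le
    rw [h1, map_mul, hU _ (by simp only [U, Finset.mem_filter, Finset.mem_image]; exact ⟨⟨s, hs, rfl⟩, h2⟩),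
      mul_one, max_eq_left h]
  · push Not at h
    have h3 : r + z * u - s = (r - s) + z * u := by ring
    rw [max_eq_right h.le, h3]
    refine Valuation.map_add_eq_of_lt_left _ ?_
    rwa [map_mul, hu, mul_one]

/-- A finite cut can be realised in an algebraically closed nontrivially valued extension. -/
theorem exists_same_cut (p : ExtPoint vE) {N Γ : Type} [Field N] [IsAlgClosed N]
    [LinearOrderedCommGroupWithZero Γ] (w : Valuation N Γ) (hw : w.IsNontrivial) (j : E →+* N)
    (hj : ∀ a b, w (j a) ≤ w (j b) ↔ vE a ≤ vE b) (Δ : Finset E) (h0 : (0 : E) ∈ Δ) (g : p.Γ) :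
    ∃ z : N, ∀ a ∈ Δ, (p.v (p.i a) ≤ g ↔ w (j a) ≤ w z) ∧ (g ≤ p.v (p.i a) ↔ w z ≤ w (j a)) := by
  classical
  have hlt : ∀ a b, w (j a) < w (j b) ↔ vE a < vE b := fun a b => by
    rw [← not_le, ← not_le, hj]
  by_cases hg : ∃ a ∈ Δ, p.v (p.i a) = g
  · obtain ⟨e, -, rfl⟩ := hg
    exact ⟨j e, fun a _ => by rw [p.le_iff, p.le_iff, hj, hj]; exact ⟨Iff.rfl, Iff.rfl⟩⟩
  push Not at hg
  have hne : (Δ.filter fun a => p.v (p.i a) < g).Nonempty :=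
    ⟨0, by simpa [h0, zero_lt_iff] using fun h => hg 0 h0 (by simp [h])⟩
  obtain ⟨lo, hlo, hlo'⟩ := Finset.exists_max_image _ vE hne
  simp only [Finset.mem_filter] at hlo hlo'
  suffices H : ∃ z : N, w (j lo) < w z ∧ ∀ a ∈ Δ, g < p.v (p.i a) → w z < w (j a) by
    obtain ⟨z, hz, hz'⟩ := H
    refine ⟨z, fun a ha => ?_⟩
    rcases lt_or_gt_of_ne (hg a ha) with h | h
    · have h1 : w (j a) < w z := ((hj _ _).2 (hlo' a ⟨ha, h⟩)).trans_lt hz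
      simp [h.le, h1.le, h.not_ge, h1.not_ge]
    · have h1 := hz' a ha h
      simp [h.le, h1.le, h.not_ge, h1.not_ge]
  by_cases hhi : (Δ.filter fun a => g < p.v (p.i a)).Nonempty
  · obtain ⟨hi, hhi, hhi'⟩ := Finset.exists_min_image _ vE hhi
    simp only [Finset.mem_filter] at hhi hhi'
    have hlh : w (j lo) < w (j hi) := by
      rw [hlt, ← p.lt_iff]; exact hlo.2.trans hhi.2
    suffices H : ∃ z, w (j lo) < w z ∧ w z < w (j hi) by
      obtain ⟨z, h1, h2⟩ := H
      exact ⟨z, h1, fun a ha h => h2.trans_le ((hj _ _).2 (hhi' a ⟨ha, h⟩))⟩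
    have hhi0 : 0 < w (j hi) := zero_le.trans_lt hlh
    by_cases hl0 : w (j lo) = 0
    · rw [hl0]
      obtain ⟨t, ht0, ht1⟩ := hw.exists_lt_one
      have ht0' : 0 < w t := by simpa [zero_lt_iff] using ht0
      refine ⟨t * j hi, ?_, ?_⟩
      · rw [map_mul]; exact mul_pos ht0' hhi0
      · rw [map_mul]; exact mul_lt_of_lt_one_left hhi0 ht1
    · have hl0' : 0 < w (j lo) := zero_lt_iff.2 hl0
      -- A square root of `lo * hi` has the geometric mean as its value, hence lies strictly
      -- between; this is the density of the value group.
      obtain ⟨z, hz⟩ := IsAlgClosed.exists_pow_nat_eq (j lo * j hi) (n := 2) (by norm_num)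
      have hz2 : w z ^ 2 = w (j lo) * w (j hi) := by rw [← map_pow, hz, map_mul]
      refine ⟨z, ?_, ?_⟩
      · refine lt_of_pow_lt_pow_left₀ 2 zero_le ?_
        rw [hz2, pow_two]
        exact mul_lt_mul_of_pos_left hlh hl0'
      · refine lt_of_pow_lt_pow_left₀ 2 zero_le ?_
        rw [hz2, pow_two]
        exact mul_lt_mul_of_pos_right hlh hhi0
  · rw [Finset.not_nonempty_iff_eq_empty, Finset.filter_eq_empty_iff] at hhi
    suffices H : ∃ z, w (j lo) < w z by
      obtain ⟨z, hz⟩ := H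
      exact ⟨z, hz, fun a ha h => absurd h (hhi ha)⟩
    by_cases hl0 : w (j lo) = 0
    · exact ⟨1, by rw [hl0]; simp⟩
    · obtain ⟨t, ht⟩ := hw.exists_one_lt
      refine ⟨t * j lo, ?_⟩
      rw [map_mul]
      exact lt_mul_of_one_lt_left (zero_lt_iff.2 hl0) ht

/-- The position of a point relative to a finite set is realised in every algebraically closed
nontrivially valued extension. -/
theorem ExtPoint.exists_equiv (p : ExtPoint vE) (R : Finset E) {N Γ : Type} [Field N]
    [IsAlgClosed N] [LinearOrderedCommGroupWithZero Γ] (w : Valuation N Γ)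
    (hw : w.IsNontrivial) (j : E →+* N) (hj : ∀ a b, w (j a) ≤ w (j b) ↔ vE a ≤ vE b) :
    ∃ y : N, ExtPoint.Equiv R p ⟨N, Γ, w, j, hj, y⟩ := by
  classical
  rcases R.eq_empty_or_nonempty with rfl | hR
  · exact ⟨0, fun r hr => by simp at hr⟩
  -- For a centre r at minimal distance, every other distance is max(`dist r`, v(r - s)). So the
  -- whole position is encoded in the cut of `dist r` among the values of differences: realise this
  -- cut by z, then take a generic point at distance v(z) from r.
  obtain ⟨r, hr, hmin⟩ := Finset.exists_min_image R p.dist hR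
  obtain ⟨z, hz⟩ := exists_same_cut p w hw j hj (insert 0 ((R ×ˢ R).image fun q => q.1 - q.2))
    (by simp) (p.dist r)
  obtain ⟨y, hy⟩ := exists_generic w (R.image j) (j r) z
  have hmem : ∀ s ∈ R, ∀ s' ∈ R, s - s' ∈ insert 0 ((R ×ˢ R).image fun q => q.1 - q.2) :=
    fun s hs s' hs' => Finset.mem_insert_of_mem (Finset.mem_image.2 ⟨(s, s'), by simp [hs, hs'], rfl⟩)
  have hy' : ∀ s ∈ R, w (y - j s) = max (w z) (w (j (r - s))) := fun s hs => by
    rw [hy _ (Finset.mem_image_of_mem _ hs), map_sub j]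
  have hp : ∀ s ∈ R, p.dist s = max (p.dist r) (p.v (p.i (r - s))) := fun s hs => by
    rcases lt_trichotomy (p.dist r) (p.v (p.i (r - s))) with h | h | h
    · rw [ExtPoint.dist_eq_of_lt h, max_eq_right h.le]
    · have := p.dist_le_max r s
      rw [← h, max_self] at this ⊢
      exact le_antisymm this (hmin s hs)
    · rw [ExtPoint.dist_eq_of_gt h, max_eq_left h.le]
  refine ⟨y, fun s hs s' hs' => ?_⟩
  have e1 := hz _ (hmem r hr s hs)
  have e2 := hz _ (hmem r hr s' hs')
  have e3 := hz _ (hmem s hs s' hs')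
  rw [hp s hs, hp s' hs']
  change _ ∧ (_ ↔ w (y - j s) ≤ w _) ∧ (_ ↔ w _ ≤ w (y - j s))
  rw [show ExtPoint.dist ⟨N, Γ, w, j, hj, y⟩ s = max (w z) (w (j (r - s))) from hy' s hs,
    show ExtPoint.dist ⟨N, Γ, w, j, hj, y⟩ s' = max (w z) (w (j (r - s'))) from hy' s' hs', hy' s hs]
  simp only [max_le_iff, le_max_iff, le_refl, true_and, e1.1, e2.2, e3.1, e3.2, p.le_iff, hj]

end OneVariable

/-! ### Conjugacy of valuations in algebraic extensions -/

section Conjugacy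

open Polynomial Pointwise

variable {F E : Type} [Field F] [Field E] [Algebra F E]

/-- The elements of the base field with value at most one, as a subring of the extension. -/
def baseIntegers (F : Type) {E Γ : Type} [Field F] [Field E] [Algebra F E]
    [LinearOrderedCommGroupWithZero Γ] (v : Valuation E Γ) : Subring E :=
  (v.comap (algebraMap F E)).integer.map (algebraMap F E)

variable {Γ Γ' : Type} [LinearOrderedCommGroupWithZero Γ] [LinearOrderedCommGroupWithZero Γ']

theorem mem_baseIntegers (v : Valuation E Γ) {x : E} :
    x ∈ baseIntegers F v ↔ ∃ f : F, v (algebraMap F E f) ≤ 1 ∧ algebraMap F E f = x := by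
  simp [baseIntegers, Subring.mem_map, Valuation.mem_integer_iff]

theorem map_le_one_of_isIntegral (v : Valuation E Γ) (A : Subring E) (hA : ∀ a ∈ A, v a ≤ 1)
    {x : E} (hx : IsIntegral A x) : v x ≤ 1 := by
  have h1 : IsIntegral v.integer x := by
    have hle : A ≤ v.integer := fun a ha => hA a ha
    obtain ⟨p, hp, hpx⟩ := hx
    refine ⟨p.map (Subring.inclusion hle), hp.map _, ?_⟩
    rw [Polynomial.eval₂_map]
    exact hpx
  exact Valuation.Integers.mem_of_integral (Valuation.integer.integers v) h1

/-- The integral closure of `A` is the intersection of the valuation rings V containing `A`. If x is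
in V, the Horner tail is a polynomial in x over V. If not, then x⁻¹ is in V, and each tail is x⁻¹
times the previous tail minus a coefficient; the recursion starts at f(x) = 0. -/
theorem isIntegral_iterate_divX (A : Subring E) (f : E[X]) (hf : ∀ n, f.coeff n ∈ A) {x : E}
    (hx : f.eval x = 0) (k : ℕ) : IsIntegral A ((divX^[k] f).eval x) := by
  have hmem : ∀ V : ValuationSubring E, A ≤ V.toSubring → (divX^[k] f).eval x ∈ V := by
    intro V hV
    have hc : ∀ n, f.coeff n ∈ V := fun n => hV (hf n)
    have hcoeff : ∀ k n, (divX^[k] f).coeff n = f.coeff (n + k) := by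
      intro k
      induction k with
      | zero => simp
      | succ k ih => intro n; rw [Function.iterate_succ_apply', coeff_divX, ih]; congr 1; ring
    by_cases hxV : x ∈ V
    · rw [eval_eq_sum]
      exact sum_mem fun n _ => mul_mem (by rw [hcoeff]; exact hc _) (pow_mem hxV n)
    · have hx' : x⁻¹ ∈ V := (V.mem_or_inv_mem x).resolve_left hxV
      have hx0 : x ≠ 0 := by rintro rfl; exact hxV V.zero_mem
      induction k with
      | zero => simp [hx]
      | succ k ih =>
        have h1 : (divX^[k] f).eval x = (divX^[k+1] f).eval x * x + f.coeff k := by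
          conv_lhs => rw [← divX_mul_X_add (divX^[k] f)]
          rw [eval_add, eval_mul, eval_X, eval_C, Function.iterate_succ_apply', hcoeff, zero_add]
        have h2 : (divX^[k+1] f).eval x = x⁻¹ * ((divX^[k] f).eval x - f.coeff k) := by
          rw [h1]; field_simp; ring
        rw [h2]
        exact mul_mem hx' (sub_mem ih (hc k))
  have h := iInf_valuationSubring_superset (K := E) (s := (A : Set E))
  rw [Subring.closure_eq] at h
  have h2 : (divX^[k] f).eval x ∈ (integralClosure A E).toSubring := by
    rw [← h, Subring.mem_iInf]
    exact fun V => hmem V.1 V.2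
  exact h2

/-- In an algebraic extension, a valuation ring is determined by the trace of its maximal ideal
on the integral closure of the base. -/
theorem map_le_one_of_trace [Algebra.IsAlgebraic F E] (v : Valuation E Γ) (w : Valuation E Γ')
    (hA : ∀ f : F, v (algebraMap F E f) ≤ 1 ↔ w (algebraMap F E f) ≤ 1)
    (h : ∀ b, IsIntegral (baseIntegers F v) b → w b < 1 → v b < 1) {x : E} (hx : v x ≤ 1) :
    w x ≤ 1 := by
  obtain ⟨f₀, hf₀, hfx₀⟩ := Algebra.IsAlgebraic.isAlgebraic (R := F) x
  -- Dividing by a coefficient of largest value makes all coefficients integral and the m-th one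
  -- equal to 1.
  obtain ⟨m, hm, hmax⟩ := Finset.exists_max_image f₀.support
    (fun n => v (algebraMap F E (f₀.coeff n))) (nonempty_support_iff.2 hf₀)
  have hm0 : f₀.coeff m ≠ 0 := mem_support_iff.1 hm
  have hvm : 0 < v (algebraMap F E (f₀.coeff m)) := by simpa [zero_lt_iff] using hm0
  let f : E[X] := (C (f₀.coeff m)⁻¹ * f₀).map (algebraMap F E)
  have hcoeff : ∀ n, f.coeff n = algebraMap F E ((f₀.coeff m)⁻¹ * f₀.coeff n) := fun n => by
    simp [f]
  have hle : ∀ n, v (f.coeff n) ≤ 1 := fun n => by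
    rw [hcoeff, map_mul, map_mul, map_inv₀, map_inv₀]
    by_cases hn : f₀.coeff n = 0
    · simp [hn]
    · exact inv_mul_le_one_of_le₀ (hmax n (mem_support_iff.2 hn)) (zero_le)
  have hAf : ∀ n, f.coeff n ∈ baseIntegers F v := fun n =>
    (mem_baseIntegers v).2 ⟨_, by rw [← hcoeff]; exact hle n, (hcoeff n).symm⟩
  have hfx : f.eval x = 0 := by
    simp only [f, Polynomial.map_mul, map_C, eval_mul, eval_C]
    rw [eval_map_algebraMap, hfx₀, mul_zero]
  have hint := isIntegral_iterate_divX (baseIntegers F v) f hAf hfx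
  have hdc : ∀ k n, (divX^[k] f).coeff n = f.coeff (n + k) := by
    intro k
    induction k with
    | zero => simp
    | succ k ih => intro n; rw [Function.iterate_succ_apply', coeff_divX, ih]; congr 1; ring
  have hstep : ∀ k, (divX^[k] f).eval x = (divX^[k+1] f).eval x * x + f.coeff k := by
    intro k
    conv_lhs => rw [← divX_mul_X_add (divX^[k] f)]
    rw [eval_add, eval_mul, eval_X, eval_C, Function.iterate_succ_apply', hdc, zero_add]
  have hw : ∀ b, IsIntegral (baseIntegers F v) b → w b ≤ 1 := fun b hb =>
    map_le_one_of_isIntegral w _ (fun a ha => by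
      obtain ⟨g, hg, rfl⟩ := (mem_baseIntegers v).1 ha
      exact (hA g).1 hg) hb
  have hwc : ∀ n, w (f.coeff n) ≤ 1 := fun n => by
    rw [hcoeff, ← hA, ← hcoeff]; exact hle n
  by_contra hx'
  push Not at hx'
  -- Let hₖ be the k-th Horner tail at x. Since hₖ₊₁ x = hₖ - fₖ has `w`-value at most 1 while `w x
  -- > 1`, each hₖ₊₁ has `w`-value below 1, hence `v`-value below 1. This makes 1 = fₘ = hₘ - hₘ₊₁ x
  -- of `v`-value below 1, which is absurd.
  have hall : ∀ k, v ((divX^[k] f).eval x) < 1 := by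
    intro k
    cases k with
    | zero => simp [hfx]
    | succ k =>
      refine h _ (hint _) ?_
      have h1 : (divX^[k+1] f).eval x * x = (divX^[k] f).eval x - f.coeff k := by
        rw [hstep k]; ring
      have h2 : w ((divX^[k+1] f).eval x) * w x ≤ 1 := by
        rw [← map_mul, h1]
        exact (Valuation.map_sub _ _ _).trans (max_le (hw _ (hint _)) (hwc _))
      by_contra h3
      push Not at h3
      have h4 : w ((divX^[k+1] f).eval x) = 1 := le_antisymm (hw _ (hint _)) h3
      rw [h4, one_mul] at h2
      exact absurd h2 hx'.not_ge
  have hone : f.coeff m = 1 := by rw [hcoeff, inv_mul_cancel₀ hm0, map_one]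
  have h5 := hstep m
  have h6 : v (1 : E) < 1 := by
    have : (1 : E) = (divX^[m] f).eval x - (divX^[m+1] f).eval x * x := by
      rw [h5, hone]; ring
    rw [this]
    refine (Valuation.map_sub _ _ _).trans_lt (max_lt (hall m) ?_)
    rw [map_mul]
    exact mul_lt_one_of_lt_of_le (hall _) hx
  simp at h6

theorem baseIntegers_eq (v : Valuation E Γ) (w : Valuation E Γ')
    (hA : ∀ f : F, v (algebraMap F E f) ≤ 1 ↔ w (algebraMap F E f) ≤ 1) :
    baseIntegers F v = baseIntegers F w := by
  ext x
  simp only [mem_baseIntegers, hA]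

/-- Two valuations of a Galois extension which agree on the base field are conjugate. -/
theorem exists_conj [IsGalois F E] (v : Valuation E Γ) (w : Valuation E Γ')
    (hA : ∀ f : F, v (algebraMap F E f) ≤ 1 ↔ w (algebraMap F E f) ≤ 1) :
    ∃ σ : E ≃ₐ[F] E, ∀ x, v x ≤ 1 ↔ w (σ x) ≤ 1 := by
  let A := baseIntegers F v
  let B := integralClosure A E
  have hfix : ∀ (g : E ≃ₐ[F] E) (a : A), g (a : E) = a := by
    intro g a
    obtain ⟨f, -, hf⟩ := (mem_baseIntegers v).1 a.2
    rw [← hf, AlgEquiv.commutes]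
  have hgint : ∀ (g : E ≃ₐ[F] E) (b : E), IsIntegral A b → IsIntegral A (g b) := by
    rintro g b ⟨p, hp, hpb⟩
    refine ⟨p, hp, ?_⟩
    have h1 : (g : E →+* E) (p.eval₂ (algebraMap A E) b) = 0 := by rw [hpb, map_zero]
    rw [Polynomial.hom_eval₂] at h1
    have h2 : (g : E →+* E).comp (algebraMap A E) = algebraMap A E := RingHom.ext fun a => hfix g a
    rwa [h2] at h1
  let act : MulSemiringAction (E ≃ₐ[F] E) B :=
    { smul := fun g b => ⟨g b, hgint g b b.2⟩
      one_smul := fun b => rfl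
      mul_smul := fun g g' b => rfl
      smul_zero := fun g => Subtype.ext (map_zero g)
      smul_add := fun g b b' => Subtype.ext (map_add g _ _)
      smul_one := fun g => Subtype.ext (map_one g)
      smul_mul := fun g b b' => Subtype.ext (map_mul g _ _) }
  have hsmul : ∀ (g : E ≃ₐ[F] E) (b : B), ((g • b : B) : E) = g b := fun g b => rfl
  have : SMulCommClass (E ≃ₐ[F] E) A B := ⟨fun g a b => Subtype.ext <| by
    rw [hsmul]
    change g ((a : E) * b) = (a : E) * g b
    rw [map_mul, hfix]⟩
  -- An invariant element comes from `F` by Galois theory, and it has value at most 1 because it is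
  -- integral over `A`.
  have : Algebra.IsInvariant A B (E ≃ₐ[F] E) := ⟨fun b hb => by
    obtain ⟨f, hf⟩ := (InfiniteGalois.mem_range_algebraMap_iff_fixed (k := F) (b : E)).2
      fun g => by rw [← hsmul, hb]
    have hvf : v (algebraMap F E f) ≤ 1 := by
      rw [hf]
      exact map_le_one_of_isIntegral v A (fun a ha => by
        obtain ⟨g, hg, rfl⟩ := (mem_baseIntegers v).1 ha
        exact hg) b.2
    exact ⟨⟨b, (mem_baseIntegers v).2 ⟨f, hvf, hf⟩⟩, rfl⟩⟩
  -- The Galois group may be infinite. Its action on the discrete ring `B` is continuous because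
  -- stabilizers of algebraic elements are open, so the profinite form of transitivity on primes
  -- applies.
  let : TopologicalSpace B := ⊥
  have : DiscreteTopology B := ⟨rfl⟩
  have : ContinuousSMul (E ≃ₐ[F] E) B := ⟨by
    refine continuous_prod_of_discrete_right.2 fun b => ?_
    refine ⟨fun s _ => isOpen_iff_mem_nhds.2 fun g hg => ?_⟩
    have hst := stabilizer_isOpen_of_isIntegral (K := F) (b : E)
    have h1 : (fun x => g * x) '' (MulAction.stabilizer (E ≃ₐ[F] E) (b : E) : Set (E ≃ₐ[F] E)) ∈
        nhds g := by
      have := (isOpenMap_mul_left g) _ hst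
      refine this.mem_nhds ⟨1, one_mem _, mul_one g⟩
    refine Filter.mem_of_superset h1 ?_
    rintro _ ⟨x, hx, rfl⟩
    have h2 : x (b : E) = b := hx
    have h3 : (g * x) • b = g • b := Subtype.ext (by rw [hsmul, hsmul, AlgEquiv.mul_apply, h2])
    change (g * x) • b ∈ s
    rw [h3]
    exact hg⟩
  have hvB : ∀ b : B, v (b : E) ≤ 1 := fun b =>
    map_le_one_of_isIntegral v A (fun a ha => by
        obtain ⟨g, hg, rfl⟩ := (mem_baseIntegers v).1 ha
        exact hg) b.2
  have hwB : ∀ b : B, w (b : E) ≤ 1 := fun b =>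
    map_le_one_of_isIntegral w A (fun a ha => by
        obtain ⟨g, hg, rfl⟩ := (mem_baseIntegers v).1 ha
        exact (hA g).1 hg) b.2
  let mk : ∀ {Γ : Type} [LinearOrderedCommGroupWithZero Γ] (u : Valuation E Γ)
      (_ : ∀ b : B, u (b : E) ≤ 1), Ideal B := fun u hu =>
    { carrier := {b | u (b : E) < 1}
      add_mem' := fun {a b} ha hb => (Valuation.map_add u _ _).trans_lt (max_lt ha hb)
      zero_mem' := by simp
      smul_mem' := fun c b hb => by
        change u ((c : E) * b) < 1
        rw [map_mul]
        exact mul_lt_one_of_nonneg_of_lt_one_right (hu c) zero_le hb }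
  have hprime : ∀ {Γ : Type} [LinearOrderedCommGroupWithZero Γ] (u : Valuation E Γ)
      (hu : ∀ b : B, u (b : E) ≤ 1), (mk u hu).IsPrime := fun u hu => by
    refine ⟨fun h => ?_, fun {a b} hab => ?_⟩
    · have : (1 : B) ∈ mk u hu := by rw [h]; trivial
      have h1 : u (1 : E) < 1 := this
      simp at h1
    · by_contra hcon
      push Not at hcon
      have h1 : ¬ u (a : E) < 1 := hcon.1
      have h2 : ¬ u (b : E) < 1 := hcon.2
      have h3 : u ((a : E) * b) < 1 := hab
      rw [map_mul, le_antisymm (hu a) (not_lt.1 h1), le_antisymm (hu b) (not_lt.1 h2)] at h3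
      simp at h3
  have := hprime v hvB
  have := hprime w hwB
  have hlt : ∀ f : F, v (algebraMap F E f) < 1 ↔ w (algebraMap F E f) < 1 := fun f => by
    by_cases hf : f = 0
    · simp [hf]
    have e := hA f⁻¹
    rw [map_inv₀, map_inv₀, map_inv₀, inv_le_one₀ (by simpa [zero_lt_iff] using hf),
      inv_le_one₀ (by simpa [zero_lt_iff] using hf)] at e
    rw [← not_le, ← not_le, e]
  -- The centres of `v` and `w` on `B` lie over the same prime of `A`, hence are conjugate;
  -- `map_le_one_of_trace` then recovers the valuation rings from their centres.
  obtain ⟨g, hg⟩ := Algebra.IsInvariant.exists_smul_of_under_eq_of_profinite (A := A)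
    (G := E ≃ₐ[F] E) (mk v hvB) (mk w hwB) (by
      ext a
      obtain ⟨f, -, hf⟩ := (mem_baseIntegers v).1 a.2
      change v (a : E) < 1 ↔ w (a : E) < 1
      rw [← hf, hlt])
  have hgb : ∀ b : B, w (g b) < 1 ↔ v (b : E) < 1 := by
    intro b
    have : g • b ∈ mk w hwB ↔ g • b ∈ g • mk v hvB := by rw [hg]
    rw [Ideal.smul_mem_pointwise_smul_iff] at this
    exact this
  let w' : Valuation E Γ' := w.comap ((g : E ≃+* E) : E →+* E)
  have hw' : ∀ x, w' x = w (g x) := fun x => rfl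
  have hA' : ∀ f : F, v (algebraMap F E f) ≤ 1 ↔ w' (algebraMap F E f) ≤ 1 := fun f => by
    rw [hw', AlgEquiv.commutes, hA]
  have hBA := baseIntegers_eq v w' hA'
  refine ⟨g, fun x => ⟨fun hx => ?_, fun hx => ?_⟩⟩
  · exact map_le_one_of_trace (F := F) v w' hA' (fun b hb h => (hgb ⟨b, hb⟩).1 h) hx
  · exact map_le_one_of_trace (F := F) w' v (fun f => (hA' f).symm)
      (fun b hb h => (hgb ⟨b, by rw [← hBA] at hb; exact hb⟩).2 h) hx

theorem le_iff_of_le_one_iff (v : Valuation E Γ) (w : Valuation E Γ')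
    (h : ∀ x, v x ≤ 1 ↔ w x ≤ 1) (a b : E) : v a ≤ v b ↔ w a ≤ w b := by
  by_cases hb : b = 0
  · simp [hb]
  have e := h (a / b)
  rwa [map_div₀, map_div₀, div_le_one₀ (by simpa [zero_lt_iff] using hb),
    div_le_one₀ (by simpa [zero_lt_iff] using hb)] at e

end Conjugacy

/-! ### The theory of algebraically closed valued fields of characteristic zero -/

section Theory

open FirstOrder.Language FirstOrder.Ring

/-- `M` is an algebraically closed nontrivially valued field of characteristic zero. -/
def IsACVFZero (M : Type) [S : langVF.Structure M] : Prop :=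
  ∃ (_ : Field M) (Γ : Type) (_ : LinearOrderedCommGroupWithZero Γ) (v : Valuation M Γ),
    IsAlgClosed M ∧ CharZero M ∧ v.IsNontrivial ∧ S = valuedFieldStructure v

theorem IsACVFZero.isACVF {M : Type} [langVF.Structure M] (h : IsACVFZero M) : IsACVF M := by
  obtain ⟨hf, Γ, hΓ, v, h1, -, h2, h3⟩ := h
  exact ⟨hf, Γ, hΓ, v, h1, h2, h3⟩

/-- The symbol for divisibility in the language of valued fields. -/
def dvdSymbol : langVF.Relations 2 := Sum.inr DivRel.dvd

/-- The divisibility relation of a structure for the language of valued fields. -/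
def DivRelation {M : Type} [langVF.Structure M] (x y : M) : Prop :=
  Structure.RelMap dvdSymbol ![x, y]

/-- The atomic formula for divisibility. -/
abbrev divFormula {α : Type} {n : ℕ} (s t : langVF.Term (α ⊕ Fin n)) :
    langVF.BoundedFormula α n :=
  Relations.boundedFormula₂ dvdSymbol s t

/-- Ring terms as terms of the language of valued fields. -/
abbrev vfTerm {α : Type} (t : Language.ring.Term α) : langVF.Term α := LHom.sumInl.onTerm t

/-- First-order axioms for the divisibility relation. -/
inductive DivAxiom : Type
  | total | trans | mul | add | zero | zeroLeft | nontrivial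

/-- The sentence expressing an axiom. -/
def DivAxiom.toSentence : DivAxiom → langVF.Sentence
  | .total => ∀' ∀' (divFormula (&0) (&1) ⊔ divFormula (&1) (&0))
  | .trans => ∀' ∀' ∀' (divFormula (&0) (&1) ⟹ (divFormula (&1) (&2) ⟹ divFormula (&0) (&2)))
  | .mul => ∀' ∀' ∀' (divFormula (&0) (&1) ⟹
      divFormula (vfTerm (&0 * &2)) (vfTerm (&1 * &2)))
  | .add => ∀' ∀' ∀' (divFormula (&0) (&1) ⟹ (divFormula (&0) (&2) ⟹
      divFormula (&0) (vfTerm (&1 + &2))))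
  | .zero => ∀' divFormula (&0) (vfTerm 0)
  | .zeroLeft => ∀' (divFormula (vfTerm 0) (&0) ⟹ (&0 =' vfTerm 0))
  | .nontrivial => ∃' (∼ (divFormula (vfTerm 1) (&0)))

/-- The property expressed by an axiom. -/
def DivAxiom.toProp (M : Type) [Add M] [Mul M] [Zero M] [One M] (D : M → M → Prop) :
    DivAxiom → Prop
  | .total => ∀ x y, D x y ∨ D y x
  | .trans => ∀ x y z, D x y → D y z → D x z
  | .mul => ∀ x y z, D x y → D (x * z) (y * z)
  | .add => ∀ x y z, D x y → D x z → D x (y + z)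
  | .zero => ∀ x, D x 0
  | .zeroLeft => ∀ x, D 0 x → x = 0
  | .nontrivial => ∃ x, ¬ D 1 x

theorem DivAxiom.realize_iff {M : Type} [Field M] [S : langVF.Structure M] [CompatibleRing M]
    [(LHom.sumInl : Language.ring →ᴸ langVF).IsExpansionOn M] (ax : DivAxiom) :
    M ⊨ ax.toSentence ↔ ax.toProp M DivRelation := by
  cases ax <;>
  simp [DivAxiom.toSentence, DivAxiom.toProp, Sentence.Realize, Formula.Realize,
    DivRelation, Fin.snoc, LHom.realize_onTerm]

theorem DivAxiom.toProp_valuation {F Γ : Type} [Field F] [LinearOrderedCommGroupWithZero Γ]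
    (v : Valuation F Γ) (hv : v.IsNontrivial) (ax : DivAxiom) :
    ax.toProp F (fun x y => v y ≤ v x) := by
  cases ax with
  | total => exact fun x y => le_total _ _
  | trans => exact fun x y z h1 h2 => h2.trans h1
  | mul => exact fun x y z h => by simpa using mul_le_mul_left h _
  | add => exact fun x y z h1 h2 => (v.map_add _ _).trans (max_le h1 h2)
  | zero => exact fun x => by simp
  | zeroLeft => exact fun x h => by simpa using h
  | nontrivial =>
    obtain ⟨x, hx⟩ := hv.exists_one_lt
    exact ⟨x, by simpa using hx⟩

theorem IsACVFZero.realize_axiom {M : Type} [langVF.Structure M] (h : IsACVFZero M)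
    (ax : DivAxiom) : M ⊨ ax.toSentence := by
  obtain ⟨hf, Γ, hΓ, v, -, -, hv, rfl⟩ := h
  let := (Ring.compatibleRingOfRing M)
  let := valuedFieldStructure v
  have : (LHom.sumInl : Language.ring →ᴸ langVF).IsExpansionOn M := ⟨fun _ _ => rfl, fun _ _ => rfl⟩
  exact (DivAxiom.realize_iff ax).2 (DivAxiom.toProp_valuation v hv ax)

theorem IsACVFZero.realize_acf {M : Type} [langVF.Structure M] (h : IsACVFZero M)
    (σ : Language.ring.Sentence) (hσ : σ ∈ Theory.ACF 0) : M ⊨ (LHom.sumInl : Language.ring →ᴸ langVF).onSentence σ := by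
  obtain ⟨hf, Γ, hΓ, v, _, _, hv, rfl⟩ := h
  let := (Ring.compatibleRingOfRing M)
  let := valuedFieldStructure v
  have : (LHom.sumInl : Language.ring →ᴸ langVF).IsExpansionOn M := ⟨fun _ _ => rfl, fun _ _ => rfl⟩
  rw [LHom.realize_onSentence]
  have : CharP M 0 := CharP.ofCharZero M
  exact Theory.realize_sentence_of_mem (Theory.ACF 0) hσ

/-- The divisibility relation of a model of the axioms comes from a valuation. -/
theorem exists_valuation {M : Type} [Field M] (D : M → M → Prop)
    (h : ∀ ax : DivAxiom, ax.toProp M D) :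
    ∃ (Γ : Type) (_ : LinearOrderedCommGroupWithZero Γ) (v : Valuation M Γ), v.IsNontrivial ∧
      ∀ x y, D x y ↔ v y ≤ v x := by
  have total := h .total
  have trans := h .trans
  have mul := h .mul
  have add := h .add
  have zero := h .zero
  have zeroLeft := h .zeroLeft
  obtain ⟨t, ht⟩ := h .nontrivial
  simp only [DivAxiom.toProp] at total trans mul add zero zeroLeft
  have refl : ∀ x, D x x := fun x => (total x x).elim id id
  -- The axioms do not mention negation: if 1 divides -1, multiply D(1, x) by -1; if instead -1
  -- divides 1, multiply that relation by -x.
  have hneg : ∀ x, D 1 x → D 1 (-x) := fun x hx => by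
    rcases total 1 (-1) with h1 | h1
    · exact trans _ _ _ h1 (by simpa using mul _ _ (-1) hx)
    · have h2 := mul _ _ (-x) h1
      simp only [neg_mul, one_mul, mul_neg, neg_neg] at h2
      exact trans _ _ _ hx h2
  let O : ValuationSubring M :=
    { carrier := {x | D 1 x}
      mul_mem' := fun {a b} ha hb => by
        have h1 := mul _ _ b ha
        rw [one_mul] at h1
        exact trans _ _ _ hb h1
      one_mem' := refl 1
      add_mem' := fun {a b} ha hb => add _ _ _ ha hb
      zero_mem' := zero 1
      neg_mem' := fun {a} ha => hneg a ha
      mem_or_inv_mem' := fun x => by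
        by_cases hx : x = 0
        · left; rw [hx]; exact zero 1
        rcases total 1 x with h1 | h1
        · exact Or.inl h1
        · right
          have := mul _ _ x⁻¹ h1
          rwa [mul_inv_cancel₀ hx, one_mul] at this }
  have hO : ∀ x, O.valuation x ≤ 1 ↔ D 1 x := fun x => O.valuation_le_one_iff x
  refine ⟨O.ValueGroup, inferInstance, O.valuation, ?_, fun x y => ?_⟩
  · refine ⟨t, ?_, ?_⟩
    · rw [ne_eq, map_eq_zero]
      rintro rfl
      exact ht (zero 1)
    · intro h1
      exact ht ((hO t).1 h1.le)
  · by_cases hx : x = 0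
    · subst hx
      simp only [map_zero, le_zero_iff, map_eq_zero]
      exact ⟨zeroLeft y, fun h => h ▸ zero 0⟩
    · have hx' : 0 < O.valuation x := by simpa [zero_lt_iff] using hx
      rw [← div_le_one₀ hx', ← map_div₀, hO]
      constructor
      · intro h1
        have := mul _ _ x⁻¹ h1
        rwa [mul_inv_cancel₀ hx, ← div_eq_mul_inv] at this
      · intro h1
        have := mul _ _ x h1
        rwa [one_mul, div_mul_cancel₀ _ hx] at this

theorem valuedFieldStructure_unique {M Γ : Type} [Field M] [LinearOrderedCommGroupWithZero Γ]
    (v : Valuation M Γ) (S : langVF.Structure M) [C : CompatibleRing M]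
    (hS : ∀ n (f : Language.ring.Functions n) (x : Fin n → M),
      S.funMap (Sum.inl f : langVF.Functions n) x = C.toStructure.funMap f x)
    (hD : ∀ x y : M, DivRelation x y ↔ v y ≤ v x) : S = valuedFieldStructure v := by
  refine Structure.ext ?_ ?_
  · funext n f x
    rcases f with f | f
    · rw [hS]
      cases f with
      | add => exact CompatibleRing.funMap_add x
      | mul => exact CompatibleRing.funMap_mul x
      | neg => exact CompatibleRing.funMap_neg x
      | zero => exact CompatibleRing.funMap_zero x
      | one => exact CompatibleRing.funMap_one x
    · exact f.elim
  · funext n r x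
    rcases r with r | r
    · exact r.elim
    · cases r with
      | dvd =>
        have hx : x = ![x 0, x 1] := by
          funext i; fin_cases i <;> rfl
        refine propext ?_
        have := hD (x 0) (x 1)
        rw [DivRelation, ← hx] at this
        exact this

/-- A structure satisfying all sentences that hold in every algebraically closed nontrivially
valued field of characteristic zero is such a field. -/
theorem isACVFZero_of_sentences (N : Type) [S : langVF.Structure N]
    (h : ∀ σ : langVF.Sentence, (∀ (M : Type) [langVF.Structure M], IsACVFZero M → M ⊨ σ) →
      N ⊨ σ) : IsACVFZero N := by
  let R : Language.ring.Structure N := (LHom.sumInl : Language.ring →ᴸ langVF).reduct N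
  have hexp : (LHom.sumInl : Language.ring →ᴸ langVF).IsExpansionOn N :=
    LHom.isExpansionOn_reduct _ N
  have hACF : (Theory.ACF 0).Model N := ⟨fun σ hσ => by
    rw [← LHom.realize_onSentence N (LHom.sumInl : Language.ring →ᴸ langVF)]
    exact h _ fun M _ hM => hM.realize_acf σ hσ⟩
  let F : Field N := FirstOrder.Field.fieldOfModelACF 0 N
  have := FirstOrder.Field.modelField_of_modelACF 0 N
  let C : CompatibleRing N := FirstOrder.Field.compatibleRingOfModelField N
  have : IsAlgClosed N := FirstOrder.Field.isAlgClosed_of_model_ACF 0 N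
  have : CharP N 0 := FirstOrder.Field.charP_of_model_fieldOfChar 0 N
  have : CharZero N := CharP.charP_to_charZero N
  obtain ⟨Γ, hΓ, v, hv, hD⟩ := exists_valuation (M := N) DivRelation fun ax =>
    (DivAxiom.realize_iff ax).1 (h _ fun M _ hM => hM.realize_axiom ax)
  exact ⟨F, Γ, hΓ, v, inferInstance, inferInstance, hv,
    valuedFieldStructure_unique v S (fun n f x => rfl) hD⟩

theorem IsACVFZero.of_elementarilyEquivalent {M N : Type} [langVF.Structure M]
    [langVF.Structure N] (hM : IsACVFZero M) (h : langVF.ElementarilyEquivalent M N) :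
    IsACVFZero N :=
  isACVFZero_of_sentences N fun σ hσ => (elementarilyEquivalent_iff.1 h σ).1 (hσ M hM)

theorem IsACVFZero.ultraproduct {ι : Type} (u : Ultrafilter ι) (M : ι → Type)
    [∀ i, langVF.Structure (M i)] (hM : ∀ i, IsACVFZero (M i)) :
    IsACVFZero ((u : Filter ι).Product M) := by
  have : ∀ i, Nonempty (M i) := fun i => by
    obtain ⟨hf, -⟩ := hM i
    exact ⟨0⟩
  exact isACVFZero_of_sentences _ fun σ hσ =>
    (Ultraproduct.sentence_realize σ).2 (Filter.Eventually.of_forall fun i => hσ (M i) (hM i))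

end Theory

/-! ### Elimination of quantifiers -/

section Elimination

open FirstOrder.Language FirstOrder.Ring

/-- A tuple in an algebraically closed nontrivially valued field of characteristic zero. -/
structure VFPoint (β : Type) where
  carrier : Type
  [field : Field carrier]
  Γ : Type
  [group : LinearOrderedCommGroupWithZero Γ]
  v : Valuation carrier Γ
  [isAlgClosed : IsAlgClosed carrier]
  [charZero : CharZero carrier]
  nontrivial : v.IsNontrivial
  x : β → carrier

attribute [instance] VFPoint.field VFPoint.group VFPoint.isAlgClosed VFPoint.charZero

namespace VFPoint

/-- The value of an integral polynomial at a point. -/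
noncomputable def val {β : Type} (p : VFPoint β) (f : MvPolynomial β ℤ) : p.Γ :=
  p.v (MvPolynomial.aeval p.x f)

/-- Two points which agree on the comparison of the values of the polynomials in `Q`. -/
def Agree {β : Type} (Q : Set (MvPolynomial β ℤ)) (p q : VFPoint β) : Prop :=
  ∀ f ∈ Q, ∀ g ∈ Q, p.val f ≤ p.val g ↔ q.val f ≤ q.val g

/-- The point with the same field and a different tuple. -/
abbrev withTuple {β γ : Type} (p : VFPoint β) (y : γ → p.carrier) : VFPoint γ :=
  { carrier := p.carrier, Γ := p.Γ, v := p.v, nontrivial := p.nontrivial, x := y }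

/-- The structure of valued field on the field of a point. -/
@[reducible]
def str {β : Type} (p : VFPoint β) : langVF.Structure p.carrier := valuedFieldStructure p.v

theorem isACVFZero {β : Type} (p : VFPoint β) :
    @IsACVFZero p.carrier p.str :=
  ⟨p.field, p.Γ, p.group, p.v, p.isAlgClosed, p.charZero, p.nontrivial, rfl⟩

/-- The quotient of the integral polynomial ring by the relations of the tuple, its fraction field
and its algebraic closure embed on both sides. The two pulled-back valuations agree on the fraction
field, and conjugacy lets one correct an embedding so that they agree on the closure. -/
theorem exists_common_closure {β : Type} (p q : VFPoint β) (h : Agree Set.univ p q) :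
    ∃ (E : Type) (_ : Field E) (_ : IsAlgClosed E) (i : E →+* p.carrier) (j : E →+* q.carrier)
      (e : β → E), (∀ b, i (e b) = p.x b) ∧ (∀ b, j (e b) = q.x b) ∧
      ∀ a b, q.v (j a) ≤ q.v (j b) ↔ p.v (i a) ≤ p.v (i b) := by
  let φ : MvPolynomial β ℤ →+* p.carrier := (MvPolynomial.aeval p.x).toRingHom
  let ψ : MvPolynomial β ℤ →+* q.carrier := (MvPolynomial.aeval q.x).toRingHom
  have hval : ∀ f g, p.v (φ f) ≤ p.v (φ g) ↔ q.v (ψ f) ≤ q.v (ψ g) := fun f g =>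
    h f trivial g trivial
  -- Vanishing is the comparison of a value with the value of 0, so both tuples satisfy the same
  -- polynomial relations.
  have hker : ∀ f, φ f = 0 ↔ ψ f = 0 := fun f => by
    have := hval f 0
    simpa using this
  let A := MvPolynomial β ℤ ⧸ RingHom.ker φ
  have : (RingHom.ker φ).IsPrime := RingHom.ker_isPrime φ
  let φ' : A →+* p.carrier := RingHom.kerLift φ
  let ψ' : A →+* q.carrier := Ideal.Quotient.lift _ ψ fun f hf => (hker f).1 hf
  have hφ' : Function.Injective φ' := RingHom.kerLift_injective φ
  have hψ' : Function.Injective ψ' := by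
    rw [injective_iff_map_eq_zero]
    intro a ha
    obtain ⟨f, rfl⟩ := Ideal.Quotient.mk_surjective a
    rw [Ideal.Quotient.lift_mk] at ha
    exact Ideal.Quotient.eq_zero_iff_mem.2 ((hker f).2 ha)
  let F := FractionRing A
  let i0 : F →+* p.carrier := IsFractionRing.lift hφ'
  let j0 : F →+* q.carrier := IsFractionRing.lift hψ'
  have : CharZero F := RingHom.charZero i0
  have h1 : ∀ x : F, p.v (i0 x) ≤ 1 ↔ q.v (j0 x) ≤ 1 := by
    intro x
    obtain ⟨a, b, hb, rfl⟩ := IsFractionRing.div_surjective (A := A) x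
    obtain ⟨f, rfl⟩ := Ideal.Quotient.mk_surjective a
    obtain ⟨g, rfl⟩ := Ideal.Quotient.mk_surjective b
    have hg : φ g ≠ 0 := fun h0 =>
      nonZeroDivisors.ne_zero hb (Ideal.Quotient.eq_zero_iff_mem.2 h0)
    have hg' : ψ g ≠ 0 := fun h0 => hg ((hker g).2 h0)
    have e1 : ∀ f, i0 (algebraMap A F (Ideal.Quotient.mk _ f)) = φ f := fun f => by
      simp only [i0, IsFractionRing.lift_algebraMap]; rfl
    have e2 : ∀ f, j0 (algebraMap A F (Ideal.Quotient.mk _ f)) = ψ f := fun f => by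
      simp only [j0, IsFractionRing.lift_algebraMap]; rfl
    rw [map_div₀, map_div₀, map_div₀, map_div₀, e1, e1, e2, e2,
      div_le_one₀ (by simpa [zero_lt_iff] using hg), div_le_one₀ (by simpa [zero_lt_iff] using hg'),
      hval]
  let E := AlgebraicClosure F
  let := i0.toAlgebra
  let := j0.toAlgebra
  let i : E →ₐ[F] p.carrier := IsAlgClosed.lift
  let j : E →ₐ[F] q.carrier := IsAlgClosed.lift
  obtain ⟨σ, hσ⟩ := exists_conj (F := F) (p.v.comap (i : E →+* p.carrier))
    (q.v.comap (j : E →+* q.carrier)) fun x => by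
      simp only [Valuation.comap_apply, RingHom.coe_coe, AlgHom.commutes]
      exact h1 x
  have hσ' := le_iff_of_le_one_iff (p.v.comap (i : E →+* p.carrier))
    (q.v.comap ((j : E →+* q.carrier).comp (σ : E →+* E))) hσ
  refine ⟨E, inferInstance, inferInstance, i, (j : E →+* q.carrier).comp (σ : E →+* E),
    fun b => algebraMap F E (algebraMap A F (Ideal.Quotient.mk _ (MvPolynomial.X b))),
    fun b => ?_, fun b => ?_, fun a b => (hσ' a b).symm⟩
  · change i _ = _
    rw [AlgHom.commutes]
    change i0 _ = _
    simp only [i0, IsFractionRing.lift_algebraMap]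
    exact MvPolynomial.aeval_X _ _
  · change j (σ _) = _
    rw [AlgEquiv.commutes, AlgHom.commutes]
    change j0 _ = _
    simp only [j0, IsFractionRing.lift_algebraMap]
    exact MvPolynomial.aeval_X _ _

/-- One half of a back-and-forth step: over the common algebraically closed field, the polynomials
in `Q` become polynomials in the new element alone, and their comparison depends only on its
position relative to finitely many centres, which can be realised on the other side. The value
`none` of `c` marks the new coordinate. -/
theorem exists_agree {β γ : Type} (p q : VFPoint β) (h : Agree Set.univ p q) (c : γ → Option β)
    (Q : Set (MvPolynomial γ ℤ)) (hQ : Q.Finite) (y : p.carrier) :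
    ∃ z : q.carrier, Agree Q (p.withTuple fun s => (c s).elim y p.x)
      (q.withTuple fun s => (c s).elim z q.x) := by
  classical
  obtain ⟨E, hE, hE', i, j, e, hi, hj, hij⟩ := exists_common_closure p q h
  let vE : Valuation E p.Γ := p.v.comap i
  let P : ExtPoint vE := ⟨p.carrier, p.Γ, p.v, i, fun a b => Iff.rfl, y⟩
  let pol : MvPolynomial γ ℤ → Polynomial E :=
    MvPolynomial.aeval fun s => (c s).elim Polynomial.X fun b => Polynomial.C (e b)
  have hpol : ∀ {M : Type} [Field M] (k : E →+* M) (t : M) (f : MvPolynomial γ ℤ),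
      (pol f).eval₂ k t = MvPolynomial.aeval (fun s => (c s).elim t fun b => k (e b)) f := by
    intro M _ k t f
    have : (Polynomial.eval₂RingHom k t).comp (MvPolynomial.aeval fun s =>
        (c s).elim Polynomial.X fun b => Polynomial.C (e b) : MvPolynomial γ ℤ →ₐ[ℤ] _).toRingHom =
        (MvPolynomial.aeval (fun s => (c s).elim t fun b => k (e b)) :
          MvPolynomial γ ℤ →ₐ[ℤ] M).toRingHom := by
      refine MvPolynomial.ringHom_ext (fun n => by simp) fun s => ?_
      simp only [RingHom.comp_apply, AlgHom.toRingHom_eq_coe, RingHom.coe_coe,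
        MvPolynomial.aeval_X]
      cases c s <;> simp
    exact congrArg (fun r : MvPolynomial γ ℤ →+* M => r f) this
  have hdet : ∃ R : Finset E, ∀ p' q' : ExtPoint vE, ExtPoint.Equiv R p' q' →
      ∀ f ∈ Q, ∀ g ∈ Q, p'.val (pol f) ≤ p'.val (pol g) ↔ q'.val (pol f) ≤ q'.val (pol g) := by
    choose R hR using fun fg : MvPolynomial γ ℤ × MvPolynomial γ ℤ =>
      ExtPoint.det_val_le (vE := vE) (pol fg.1) (pol fg.2)
    refine ⟨(hQ.toFinset ×ˢ hQ.toFinset).biUnion R, fun p' q' hpq f hf g hg => ?_⟩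
    refine hR (f, g) p' q' (hpq.mono ?_)
    exact Finset.subset_biUnion_of_mem R (by simp [hf, hg])
  obtain ⟨R, hR⟩ := hdet
  obtain ⟨z, hz⟩ := P.exists_equiv R q.v q.nontrivial j hij
  refine ⟨z, fun f hf g hg => ?_⟩
  have := hR _ _ hz f hf g hg
  simp only [ExtPoint.val, hpol] at this
  simpa only [val, P, hi, hj] using this

end VFPoint

/-! ### From formulas to polynomial comparisons, by ultraproducts -/

theorem exists_poly {β : Type} (t : langVF.Term β) :
    ∃ P : MvPolynomial β ℤ, ∀ (M Γ : Type) [Field M] [LinearOrderedCommGroupWithZero Γ]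
      (v : Valuation M Γ) (x : β → M),
      letI := valuedFieldStructure v
      t.realize x = MvPolynomial.aeval x P := by
  induction t with
  | var b => exact ⟨MvPolynomial.X b, fun M Γ _ _ v x => by simp⟩
  | func f ts ih =>
    choose P hP using ih
    rcases f with f | f
    · cases f with
      | add => exact ⟨P 0 + P 1, fun M Γ _ _ v x => by
          rw [map_add, ← hP 0 M Γ v, ← hP 1 M Γ v]; rfl⟩
      | mul => exact ⟨P 0 * P 1, fun M Γ _ _ v x => by
          rw [map_mul, ← hP 0 M Γ v, ← hP 1 M Γ v]; rfl⟩
      | neg => exact ⟨-P 0, fun M Γ _ _ v x => by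
          rw [map_neg, ← hP 0 M Γ v]; rfl⟩
      | zero => exact ⟨0, fun M Γ _ _ v x => by rw [map_zero]; rfl⟩
      | one => exact ⟨1, fun M Γ _ _ v x => by rw [map_one]; rfl⟩
    · exact f.elim

/-- The ultraproduct of a family of points. -/
theorem exists_ultraproduct {ι β : Type} (u : Ultrafilter ι) (p : ι → VFPoint β) :
    ∃ P : VFPoint β, ∀ φ : langVF.Formula β,
      (letI := P.str; φ.Realize P.x) ↔ ∀ᶠ i in (u : Filter ι), letI := (p i).str; φ.Realize (p i).x := by
  let : ∀ i, langVF.Structure (p i).carrier := fun i => (p i).str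
  let N := (u : Filter ι).Product fun i => (p i).carrier
  have hN : IsACVFZero N := IsACVFZero.ultraproduct u _ fun i => (p i).isACVFZero
  have hL := fun φ : langVF.Formula β =>
    Ultraproduct.realize_formula_cast (u := u) φ (fun b i => (p i).x b)
  obtain ⟨hf, Γ, hΓ, v, h1, h2, h3, h4⟩ := hN
  refine ⟨{ carrier := N, Γ := Γ, v := v, nontrivial := h3,
            x := fun b => ((fun i => (p i).x b : ∀ i, (p i).carrier) : N) }, fun φ => ?_⟩
  have key : ∀ (S : langVF.Structure N), S = valuedFieldStructure v → ∀ x : β → N,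
      (@Formula.Realize langVF N (valuedFieldStructure v) β φ x ↔
        @Formula.Realize langVF N S β φ x) := by
    rintro S rfl x
    exact Iff.rfl
  exact (key _ h4 _).trans (hL φ)

/-- The formula comparing the values of two integral polynomials. -/
theorem exists_val_formula {β : Type} (f g : MvPolynomial β ℤ) :
    ∃ φ : langVF.Formula β, ∀ p : VFPoint β,
      (letI := p.str; φ.Realize p.x) ↔ p.val f ≤ p.val g := by
  have hterm : ∀ f : MvPolynomial β ℤ, ∃ t : langVF.Term β, ∀ p : VFPoint β,
      letI := p.str
      t.realize p.x = MvPolynomial.aeval p.x f := by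
    intro f
    induction f using MvPolynomial.induction_on with
    | C a =>
      induction a using Int.induction_on with
      | zero => exact ⟨vfTerm 0, fun p => by simp; rfl⟩
      | succ n ih =>
        obtain ⟨t, ht⟩ := ih
        refine ⟨Functions.apply₂ (Sum.inl addFunc : langVF.Functions 2) t (vfTerm 1), fun p => ?_⟩
        rw [map_add, map_add, ← ht p, map_one, map_one]
        rfl
      | pred n ih =>
        obtain ⟨t, ht⟩ := ih
        refine ⟨Functions.apply₂ (Sum.inl addFunc : langVF.Functions 2) t (vfTerm (-1)),
          fun p => ?_⟩
        rw [sub_eq_add_neg, map_add, map_add, ← ht p, map_neg, map_one, map_neg, map_one]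
        rfl
    | add f g hf hg =>
      obtain ⟨s, hs⟩ := hf
      obtain ⟨t, ht⟩ := hg
      refine ⟨Functions.apply₂ (Sum.inl addFunc : langVF.Functions 2) s t, fun p => ?_⟩
      rw [map_add, ← hs p, ← ht p]
      rfl
    | mul_X f b hf =>
      obtain ⟨s, hs⟩ := hf
      refine ⟨Functions.apply₂ (Sum.inl mulFunc : langVF.Functions 2) s (Term.var b), fun p => ?_⟩
      rw [map_mul, ← hs p, MvPolynomial.aeval_X]
      rfl
  obtain ⟨s, hs⟩ := hterm f
  obtain ⟨t, ht⟩ := hterm g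
  refine ⟨dvdSymbol.formula₂ t s, fun p => ?_⟩
  rw [VFPoint.val, VFPoint.val, ← hs p, ← ht p]
  let := p.str
  exact Formula.realize_rel₂

/-- If a family of finite approximations fails to determine a formula, then so does the whole
polynomial type. -/
theorem exists_finite_determining {β : Type} (φ : langVF.Formula β)
    (h : ∀ p q : VFPoint β, VFPoint.Agree Set.univ p q →
      (letI := p.str; φ.Realize p.x) → (letI := q.str; φ.Realize q.x)) :
    ∃ Q : Finset (MvPolynomial β ℤ), ∀ p q : VFPoint β, VFPoint.Agree (Q : Set _) p q →
      ((letI := p.str; φ.Realize p.x) → (letI := q.str; φ.Realize q.x)) := by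
  classical
  by_contra hcon
  push Not at hcon
  choose p q hpq hp hq using hcon
  -- The ultrafilter contains every cone {Q | {f, g} ⊆ Q}, so the two ultraproducts of the
  -- counterexamples agree on every pair of polynomials.
  let u : Ultrafilter (Finset (MvPolynomial β ℤ)) := Ultrafilter.of Filter.atTop
  have hu : (u : Filter (Finset (MvPolynomial β ℤ))) ≤ Filter.atTop := Ultrafilter.of_le _
  obtain ⟨P, hP⟩ := exists_ultraproduct u p
  obtain ⟨P', hP'⟩ := exists_ultraproduct u q
  have hφ : letI := P.str; φ.Realize P.x := (hP φ).2 (Filter.Eventually.of_forall hp)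
  have hφ' : ¬ (letI := P'.str; φ.Realize P'.x) := by
    rw [hP' φ]
    intro hev
    obtain ⟨Q, hQ⟩ := hev.exists
    exact hq Q hQ
  refine hφ' (h P P' (fun f _ g _ => ?_) hφ)
  obtain ⟨θ, hθ⟩ := exists_val_formula f g
  rw [← hθ P, ← hθ P', hP, hP']
  refine Filter.eventually_congr ?_
  refine hu ((Filter.eventually_ge_atTop ({f, g} : Finset _)).mono fun Q hQ => ?_)
  rw [hθ, hθ]
  exact hpq Q f (hQ (by simp)) g (hQ (by simp))

/-- Elimination of quantifiers: a formula depends only on the comparison of the values of finitely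
many integral polynomials. -/
theorem exists_determining {α : Type} {n : ℕ} (φ : langVF.BoundedFormula α n) :
    ∃ Q : Finset (MvPolynomial (α ⊕ Fin n) ℤ), ∀ p q : VFPoint (α ⊕ Fin n),
      VFPoint.Agree (Q : Set _) p q →
      ((letI := p.str; φ.Realize (p.x ∘ Sum.inl) (p.x ∘ Sum.inr)) →
        (letI := q.str; φ.Realize (q.x ∘ Sum.inl) (q.x ∘ Sum.inr))) := by
  classical
  have agree_symm : ∀ {β : Type} {Q : Set (MvPolynomial β ℤ)} {p q : VFPoint β},
      VFPoint.Agree Q p q → VFPoint.Agree Q q p := fun h f hf g hg => (h f hf g hg).symm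
  have agree_mono : ∀ {β : Type} {Q Q' : Set (MvPolynomial β ℤ)} {p q : VFPoint β}, Q ⊆ Q' →
      VFPoint.Agree Q' p q → VFPoint.Agree Q p q :=
    fun hQ h f hf g hg => h f (hQ hf) g (hQ hg)
  induction φ with
  | falsum => exact ⟨∅, fun p q _ h => h.elim⟩
  | equal s t =>
    obtain ⟨P, hP⟩ := exists_poly s
    obtain ⟨P', hP'⟩ := exists_poly t
    refine ⟨{P - P', 0}, fun p q hpq h => ?_⟩
    have e : ∀ r : VFPoint (α ⊕ Fin _), (letI := r.str
        (s.equal t : langVF.Formula _).Realize r.x) ↔ r.val (P - P') ≤ r.val 0 := by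
      intro r
      rw [VFPoint.val, VFPoint.val, map_zero, map_zero, le_zero_iff, Valuation.zero_iff, map_sub,
        sub_eq_zero, ← hP r.carrier r.Γ r.v, ← hP' r.carrier r.Γ r.v]
      let := r.str
      exact Formula.realize_equal
    have e' : ∀ r : VFPoint (α ⊕ Fin _), (letI := r.str
        (BoundedFormula.equal s t).Realize (r.x ∘ Sum.inl) (r.x ∘ Sum.inr)) ↔
        (letI := r.str; (s.equal t : langVF.Formula _).Realize r.x) := by
      intro r
      let := r.str
      rw [Formula.realize_equal]
      simp only [BoundedFormula.Realize, Sum.elim_comp_inl_inr]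
    rw [e', e] at h ⊢
    exact (hpq _ (by simp) _ (by simp)).1 h
  | rel R ts =>
    rcases R with R | R
    · exact R.elim
    cases R with
    | dvd =>
      choose P hP using fun i => exists_poly (ts i)
      refine ⟨{P 0, P 1}, fun p q hpq h => ?_⟩
      have e : ∀ r : VFPoint (α ⊕ Fin _), (letI := r.str
          (BoundedFormula.rel (Sum.inr DivRel.dvd) ts : langVF.BoundedFormula α _).Realize
            (r.x ∘ Sum.inl) (r.x ∘ Sum.inr)) ↔ r.val (P 1) ≤ r.val (P 0) := by
        intro r
        rw [VFPoint.val, VFPoint.val, ← hP 0 r.carrier r.Γ r.v, ← hP 1 r.carrier r.Γ r.v]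
        let := r.str
        simp only [BoundedFormula.Realize, Sum.elim_comp_inl_inr]
        exact Iff.rfl
      rw [e] at h ⊢
      exact (hpq _ (by simp) _ (by simp)).1 h
  | imp φ ψ ihφ ihψ =>
    obtain ⟨Q, hQ⟩ := ihφ
    obtain ⟨Q', hQ'⟩ := ihψ
    refine ⟨Q ∪ Q', fun p q hpq h hq => ?_⟩
    refine hQ' p q (agree_mono (by simp) hpq) (h ?_)
    exact hQ q p (agree_symm (agree_mono (by simp) hpq)) hq
  | @all n φ ih =>
    obtain ⟨Q, hQ⟩ := ih
    -- The last bound variable is the new coordinate; all others are copied from the old tuple.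
    let c : α ⊕ Fin (n + 1) → Option (α ⊕ Fin n) :=
      Sum.elim (fun a => some (Sum.inl a)) (Fin.snoc (α := fun _ => Option (α ⊕ Fin n))
        (fun k => some (Sum.inr k)) none)
    have hc1 : ∀ (r : VFPoint (α ⊕ Fin n)) (y : r.carrier),
        (fun s => (c s).elim y r.x) ∘ Sum.inl = r.x ∘ Sum.inl := fun r y => rfl
    have hc2 : ∀ (r : VFPoint (α ⊕ Fin n)) (y : r.carrier),
        (fun s => (c s).elim y r.x) ∘ Sum.inr = Fin.snoc (α := fun _ => r.carrier)
          (r.x ∘ Sum.inr) y := by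
      intro r y
      funext k
      refine Fin.lastCases ?_ (fun k => ?_) k
      · simp [c]
      · simp [c]
    -- No quantifier-free formula is written down. Full agreement transfers ∀, since each z on one
    -- side has a counterpart y agreeing with it on the finite set `Q` of the inner formula;
    -- compactness then replaces full agreement by finite agreement.
    have key := exists_finite_determining (φ.all.toFormula) (fun p q hpq => by
      let := p.str
      let := q.str
      rw [BoundedFormula.realize_toFormula, BoundedFormula.realize_toFormula,
        BoundedFormula.realize_all, BoundedFormula.realize_all]
      intro h z
      obtain ⟨y, hy⟩ := VFPoint.exists_agree q p (agree_symm hpq) c Q Q.finite_toSet z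
      have := hQ _ _ (agree_symm hy)
      simp only [hc1, hc2] at this
      exact this (h y))
    obtain ⟨Q', hQ'⟩ := key
    refine ⟨Q', fun p q hpq h => ?_⟩
    have key := hQ' p q hpq
    let := p.str
    let := q.str
    rw [BoundedFormula.realize_toFormula, BoundedFormula.realize_toFormula] at key
    exact key h

end Elimination

/-! ### Definable sets in algebraically closed valued fields -/

section Definable

open FirstOrder.Language FirstOrder.Ring

/-- `exists_determining` speaks of variables in `β ⊕ Fin 0`; renaming identifies these with `β`, and
a second use of compactness returns to a finite set. -/
theorem exists_determining_formula {β : Type} (φ : langVF.Formula β) :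
    ∃ Q : Finset (MvPolynomial β ℤ), ∀ p q : VFPoint β, VFPoint.Agree (Q : Set _) p q →
      ((letI := p.str; φ.Realize p.x) → (letI := q.str; φ.Realize q.x)) := by
  refine exists_finite_determining φ fun p q hpq hp => ?_
  obtain ⟨Q, hQ⟩ := exists_determining φ
  have hval : ∀ (r : VFPoint β) (f : MvPolynomial (β ⊕ Fin 0) ℤ),
      (r.withTuple (Sum.elim r.x Fin.elim0)).val f =
        r.val (MvPolynomial.rename (Sum.elim id Fin.elim0) f) := by
    intro r f
    simp only [VFPoint.val, MvPolynomial.aeval_rename]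
    congr 3
    funext s
    rcases s with s | s
    · rfl
    · exact s.elim0
  have key := hQ (p.withTuple (Sum.elim p.x Fin.elim0)) (q.withTuple (Sum.elim q.x Fin.elim0))
    (fun f _ g _ => by rw [hval, hval, hval, hval]; exact hpq _ trivial _ trivial)
  have e : ∀ r : VFPoint β, (letI := r.str
      BoundedFormula.Realize φ (Sum.elim r.x Fin.elim0 ∘ Sum.inl)
        (Sum.elim r.x Fin.elim0 ∘ Sum.inr)) ↔ (letI := r.str; φ.Realize r.x) := by
    intro r
    let := r.str
    rw [Formula.Realize, Subsingleton.elim (Sum.elim r.x Fin.elim0 ∘ Sum.inr) default]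
    exact Iff.rfl
  exact (e q).1 (key ((e p).2 hp))

/-- A property of sets which is stable under Boolean combinations holds for every set which is
determined by finitely many sets with this property. -/
theorem of_determined {X ι : Type*} (𝒜 : Set X → Prop) (huniv : 𝒜 Set.univ)
    (hunion : ∀ A B, 𝒜 A → 𝒜 B → 𝒜 (A ∪ B)) (hcompl : ∀ A, 𝒜 A → 𝒜 Aᶜ)
    (s : Finset ι) (A : ι → Set X) (hA : ∀ i ∈ s, 𝒜 (A i)) (D : Set X)
    (hD : ∀ a b, (∀ i ∈ s, a ∈ A i ↔ b ∈ A i) → a ∈ D → b ∈ D) : 𝒜 D := by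
  classical
  have hinter : ∀ A B, 𝒜 A → 𝒜 B → 𝒜 (A ∩ B) := fun A B h1 h2 => by
    have := hcompl _ (hunion _ _ (hcompl _ h1) (hcompl _ h2))
    rwa [Set.compl_union, compl_compl, compl_compl] at this
  induction s using Finset.induction_on generalizing D with
  | empty =>
    rcases D.eq_empty_or_nonempty with rfl | ⟨d, hd⟩
    · simpa using hcompl _ huniv
    · rwa [Set.eq_univ_of_forall fun x => hD d x (by simp) hd]
  | insert i s _ ih =>
    have ih := ih fun j hj => hA j (Finset.mem_insert_of_mem hj)
    have hi := hA i (Finset.mem_insert_self i s)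
    have h1 : ∀ B : Set X, 𝒜 {x | ∃ d ∈ D ∩ B, ∀ j ∈ s, d ∈ A j ↔ x ∈ A j} := fun B =>
      ih _ fun a b hab ⟨d, hd, hda⟩ => ⟨d, hd, fun j hj => (hda j hj).trans (hab j hj)⟩
    have h2 : D = (A i ∩ {x | ∃ d ∈ D ∩ A i, ∀ j ∈ s, d ∈ A j ↔ x ∈ A j}) ∪
        ((A i)ᶜ ∩ {x | ∃ d ∈ D ∩ (A i)ᶜ, ∀ j ∈ s, d ∈ A j ↔ x ∈ A j}) := by
      ext x
      constructor
      · intro hx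
        by_cases hxi : x ∈ A i
        · exact Or.inl ⟨hxi, x, ⟨hx, hxi⟩, fun _ _ => Iff.rfl⟩
        · exact Or.inr ⟨hxi, x, ⟨hx, hxi⟩, fun _ _ => Iff.rfl⟩
      · rintro (⟨hxi, d, ⟨hd, hdi⟩, hdx⟩ | ⟨hxi, d, ⟨hd, hdi⟩, hdx⟩)
        · refine hD d x (fun j hj => ?_) hd
          rcases Finset.mem_insert.1 hj with rfl | hj
          · exact iff_of_true hdi hxi
          · exact hdx j hj
        · refine hD d x (fun j hj => ?_) hd
          rcases Finset.mem_insert.1 hj with rfl | hj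
          · exact iff_of_false hdi hxi
          · exact hdx j hj
    rw [h2]
    exact hunion _ _ (hinter _ _ hi (h1 _)) (hinter _ _ (hcompl _ hi) (h1 _))

/-! ### Parameters, elementary subfields and definability of types -/

variable {M Γ : Type} [Field M] [LinearOrderedCommGroupWithZero Γ]
  (v : Valuation M Γ)

/-- Coefficients from `M` are traded for extra variables evaluated at the parameters, so that the
results on integral polynomials apply to polynomials over `M`. -/
theorem exists_aeval_eq_eval {β : Type} (P : MvPolynomial β M) :
    ∃ P' : MvPolynomial ((Set.univ : Set M) ⊕ β) ℤ, ∀ a : β → M,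
      MvPolynomial.aeval (Sum.elim (↑) a) P' = P.eval a := by
  induction P using MvPolynomial.induction_on with
  | C c => exact ⟨MvPolynomial.X (Sum.inl ⟨c, trivial⟩), fun a => by simp⟩
  | add P Q hP hQ =>
    obtain ⟨P', hP⟩ := hP
    obtain ⟨Q', hQ⟩ := hQ
    exact ⟨P' + Q', fun a => by simp [hP, hQ]⟩
  | mul_X P b hP =>
    obtain ⟨P', hP⟩ := hP
    exact ⟨P' * MvPolynomial.X (Sum.inr b), fun a => by simp [hP]⟩

/-- A subfield as a substructure. -/
def subfieldSubstructure (K : Subfield M) :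
    letI := valuedFieldStructure v
    langVF.Substructure M :=
  letI := valuedFieldStructure v
  { carrier := K
    fun_mem := fun {n} f x hx => by
      rcases f with f | f
      · cases f with
        | add => exact K.add_mem (hx 0) (hx 1)
        | mul => exact K.mul_mem (hx 0) (hx 1)
        | neg => exact K.neg_mem (hx 0)
        | zero => exact K.zero_mem
        | one => exact K.one_mem
      · exact f.elim }

theorem inducedStructure_eq (K : Subfield M) :
    letI := valuedFieldStructure v
    (Substructure.inducedStructure : langVF.Structure (subfieldSubstructure v K)) =
      valuedFieldStructure (F := K) (v.comap K.subtype) := by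
  let := valuedFieldStructure v
  refine Structure.ext ?_ ?_
  · funext n f x
    rcases f with f | f
    · cases f <;> rfl
    · exact f.elim
  · funext n r x
    rcases r with r | r
    · exact r.elim
    · cases r; rfl

variable [IsAlgClosed M] [CharZero M]

/-- A set definable with parameters depends only on the comparison of the values of finitely many
polynomials. -/
theorem exists_determining_of_definable (hv : v.IsNontrivial) {β : Type} {D : Set (β → M)}
    (hD : letI := valuedFieldStructure v; (Set.univ : Set M).Definable langVF D) :
    ∃ Q : Finset (MvPolynomial β M), ∀ a b : β → M,
      (∀ f ∈ Q, ∀ g ∈ Q, v (f.eval a) ≤ v (g.eval a) ↔ v (f.eval b) ≤ v (g.eval b)) →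
        a ∈ D → b ∈ D := by
  classical
  let := valuedFieldStructure v
  obtain ⟨φ, rfl⟩ := Set.definable_iff_exists_formula_sum.1 hD
  obtain ⟨Q, hQ⟩ := exists_determining_formula φ
  let pol : MvPolynomial ((Set.univ : Set M) ⊕ β) ℤ → MvPolynomial β M :=
    (MvPolynomial.aeval (Sum.elim (fun c => MvPolynomial.C (c : M)) MvPolynomial.X) :
      MvPolynomial ((Set.univ : Set M) ⊕ β) ℤ →ₐ[ℤ] MvPolynomial β M)
  have hpol : ∀ a f, (pol f).eval a = MvPolynomial.aeval (Sum.elim (↑) a) f := by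
    intro a f
    have : (MvPolynomial.eval a).comp (MvPolynomial.aeval (Sum.elim (fun c => MvPolynomial.C (c : M))
        MvPolynomial.X) : MvPolynomial ((Set.univ : Set M) ⊕ β) ℤ →ₐ[ℤ] MvPolynomial β M).toRingHom =
        (MvPolynomial.aeval (Sum.elim (↑) a) : _ →ₐ[ℤ] M).toRingHom := by
      refine MvPolynomial.ringHom_ext (fun n => by simp) fun s => ?_
      rcases s with s | s <;> simp
    exact congrArg (fun r : MvPolynomial ((Set.univ : Set M) ⊕ β) ℤ →+* M => r f) this
  refine ⟨Q.image pol, fun a b hab => ?_⟩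
  refine hQ ⟨M, Γ, v, hv, Sum.elim (↑) a⟩ ⟨M, Γ, v, hv, Sum.elim (↑) b⟩ fun f hf g hg => ?_
  have := hab _ (Finset.mem_image_of_mem _ hf) _ (Finset.mem_image_of_mem _ hg)
  rw [hpol, hpol, hpol, hpol] at this
  exact this

theorem definable_val_le (hv : v.IsNontrivial) {β : Type} (P Q : MvPolynomial β M) :
    letI := valuedFieldStructure v
    (Set.univ : Set M).Definable langVF {a : β → M | v (P.eval a) ≤ v (Q.eval a)} := by
  let := valuedFieldStructure v
  obtain ⟨P', hP⟩ := exists_aeval_eq_eval P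
  obtain ⟨Q', hQ⟩ := exists_aeval_eq_eval Q
  obtain ⟨φ, hφ⟩ := exists_val_formula P' Q'
  refine Set.definable_iff_exists_formula_sum.2 ⟨φ, ?_⟩
  ext a
  have := hφ ⟨M, Γ, v, hv, Sum.elim (↑) a⟩
  simp only [VFPoint.val, hP, hQ] at this
  exact this.symm

/-- An algebraically closed subfield is an elementary substructure. -/
def elementarySubfield (K : Subfield M) [IsAlgClosed K] (hK : (v.comap K.subtype).IsNontrivial)
    (hv : v.IsNontrivial) :
    letI := valuedFieldStructure v
    langVF.ElementarySubstructure M :=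
  letI := valuedFieldStructure v
  { toSubstructure := subfieldSubstructure v K
    isElementary' := by
      intro n φ x
      obtain ⟨Q, hQ⟩ := exists_determining_formula φ
      let y : Fin n → K := x
      have hval : ∀ f : MvPolynomial (Fin n) ℤ, v (MvPolynomial.aeval ((↑) ∘ y : Fin n → M) f) =
          v.comap K.subtype (MvPolynomial.aeval y f) := by
        intro f
        rw [Valuation.comap_apply]
        congr 1
        exact (MvPolynomial.aeval_algebraMap_apply (A := K) M y f)
      let p : VFPoint (Fin n) := ⟨M, Γ, v, hv, (↑) ∘ y⟩
      let q : VFPoint (Fin n) := ⟨K, Γ, v.comap K.subtype, hK, y⟩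
      have hpq : ∀ f g, p.val f ≤ p.val g ↔ q.val f ≤ q.val g := by
        intro f g
        simp only [VFPoint.val, p, q, hval]
      have key : (letI := p.str; φ.Realize p.x) ↔ (letI := q.str; φ.Realize q.x) :=
        ⟨hQ p q fun f _ g _ => hpq f g, hQ q p fun f _ g _ => (hpq f g).symm⟩
      rw [inducedStructure_eq]
      exact key }

theorem isACVFZero_elementarySubfield (K : Subfield M) [IsAlgClosed K]
    (hK : (v.comap K.subtype).IsNontrivial) (hv : v.IsNontrivial) :
    letI := valuedFieldStructure v
    IsACVFZero (elementarySubfield v K hK hv) := by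
  let := valuedFieldStructure v
  have h : @IsACVFZero K (ElementarySubstructure.inducedStructure (elementarySubfield v K hK hv)) :=
    ⟨inferInstance, Γ, inferInstance, v.comap K.subtype, inferInstance, inferInstance, hK,
      inducedStructure_eq v K⟩
  exact h

/-- A criterion for definability of types: the values of the polynomials in `c` over `K` are maxima
of values of polynomials. -/
theorem typeIsDefinable_of_max (K : Subfield M) [IsAlgClosed K]
    (hK : (v.comap K.subtype).IsNontrivial) (hv : v.IsNontrivial) {n : ℕ} (c : Fin n → M)
    (h : ∀ (m : ℕ) (f : MvPolynomial (Fin n ⊕ Fin m) ℤ), ∃ s : Finset (MvPolynomial (Fin m) K),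
      ∀ a : Fin m → K, (∃ P ∈ s, v (MvPolynomial.aeval (Sum.elim c fun i => (a i : M)) f) ≤
          v (P.eval a : K)) ∧
        ∀ P ∈ s, v (P.eval a : K) ≤ v (MvPolynomial.aeval (Sum.elim c fun i => (a i : M)) f)) :
    letI := valuedFieldStructure v
    TypeIsDefinable (elementarySubfield v K hK hv) c := by
  classical
  let := valuedFieldStructure v
  intro m φ
  change @Set.Definable K Set.univ langVF
    (ElementarySubstructure.inducedStructure (elementarySubfield v K hK hv)) _ {a : Fin m → K | _}
  have hstr : (ElementarySubstructure.inducedStructure (elementarySubfield v K hK hv) :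
      langVF.Structure K) = valuedFieldStructure (F := K) (v.comap K.subtype) :=
    inducedStructure_eq v K
  rw [hstr]
  let := valuedFieldStructure (F := K) (v.comap K.subtype)
  obtain ⟨Q, hQ⟩ := exists_determining_formula φ
  choose s hs using h m
  refine of_determined (fun D : Set (Fin m → K) => (Set.univ : Set K).Definable langVF D)
    Set.definable_univ (fun A B => Set.Definable.union) (fun A => Set.Definable.compl) (Q ×ˢ Q)
    (fun fg => {a : Fin m → K | v (MvPolynomial.aeval (Sum.elim c fun i => (a i : M)) fg.1) ≤
      v (MvPolynomial.aeval (Sum.elim c fun i => (a i : M)) fg.2)}) ?_ _ ?_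
  · rintro ⟨f, g⟩ -
    -- A maximum is at most another maximum exactly when each term of the first is bounded by some
    -- term of the second.
    have : {a : Fin m → K | v (MvPolynomial.aeval (Sum.elim c fun i => (a i : M)) f) ≤
        v (MvPolynomial.aeval (Sum.elim c fun i => (a i : M)) g)} =
        ⋂ P ∈ s f, ⋃ P' ∈ s g, {a : Fin m → K | v.comap K.subtype (P.eval a) ≤
          v.comap K.subtype (P'.eval a)} := by
      ext a
      simp only [Set.mem_ofPred_eq, Set.mem_iInter, Set.mem_iUnion, exists_prop,
        Valuation.comap_apply]
      obtain ⟨⟨P, hP, hfP⟩, hf⟩ := hs f a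
      obtain ⟨⟨P', hP', hgP'⟩, hg⟩ := hs g a
      constructor
      · exact fun h1 R hR => ⟨P', hP', (hf R hR).trans (h1.trans hgP')⟩
      · intro h1
        obtain ⟨R, hR, h2⟩ := h1 P hP
        exact hfP.trans (h2.trans (hg R hR))
    rw [this]
    exact Set.definable_biInter_finset (fun P => Set.definable_biUnion_finset
      (fun P' => definable_val_le (v.comap K.subtype) hK P P') _) _
  · intro a b hab ha
    exact hQ ⟨M, Γ, v, hv, Sum.elim c fun i => (a i : M)⟩ ⟨M, Γ, v, hv, Sum.elim c fun i => (b i : M)⟩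
      (fun f hf g hg => hab (f, g) (Finset.mem_product.2 ⟨hf, hg⟩)) ha

/-- If all types of tuples of a given length are definable, then the comparison of the values of
two polynomials in such a tuple depends only on finitely many comparisons in the small field. -/
theorem exists_determining_of_typeIsDefinable (K : Subfield M) [IsAlgClosed K]
    (hK : (v.comap K.subtype).IsNontrivial) (hv : v.IsNontrivial) {n : ℕ} (c : Fin n → M)
    (h : letI := valuedFieldStructure v
      TypeIsDefinable (elementarySubfield v K hK hv) c) {m : ℕ}
    (f g : MvPolynomial (Fin n ⊕ Fin m) ℤ) :
    ∃ Q : Finset (MvPolynomial (Fin m) K), ∀ a b : Fin m → K,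
      (∀ P ∈ Q, ∀ P' ∈ Q, v (P.eval a : K) ≤ v (P'.eval a : K) ↔
        v (P.eval b : K) ≤ v (P'.eval b : K)) →
      v (MvPolynomial.aeval (Sum.elim c fun i => (a i : M)) f) ≤
        v (MvPolynomial.aeval (Sum.elim c fun i => (a i : M)) g) →
      v (MvPolynomial.aeval (Sum.elim c fun i => (b i : M)) f) ≤
        v (MvPolynomial.aeval (Sum.elim c fun i => (b i : M)) g) := by
  let := valuedFieldStructure v
  obtain ⟨φ, hφ⟩ := exists_val_formula f g
  have h1 := h m φ
  change @Set.Definable K Set.univ langVF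
    (ElementarySubstructure.inducedStructure (elementarySubfield v K hK hv)) _ {a : Fin m → K | _} at h1
  have hstr : (ElementarySubstructure.inducedStructure (elementarySubfield v K hK hv) :
      langVF.Structure K) = valuedFieldStructure (F := K) (v.comap K.subtype) :=
    inducedStructure_eq v K
  rw [hstr] at h1
  obtain ⟨Q, hQ⟩ := exists_determining_of_definable (v.comap K.subtype) hK h1
  refine ⟨Q, fun a b hab ha => ?_⟩
  have e : ∀ a : Fin m → K, φ.Realize (Sum.elim c fun i => (a i : M)) ↔
      v (MvPolynomial.aeval (Sum.elim c fun i => (a i : M)) f) ≤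
        v (MvPolynomial.aeval (Sum.elim c fun i => (a i : M)) g) := fun a =>
    hφ ⟨M, Γ, v, hv, Sum.elim c fun i => (a i : M)⟩
  exact (e b).1 (hQ a b hab ((e a).2 ha))

end Definable

/-! ### `C`-minimality of algebraically closed valued fields -/

section CMinimality

open FirstOrder.Language

theorem isCSet_valuation {F Γ : Type} [Field F] [LinearOrderedCommGroupWithZero Γ]
    (v : Valuation F Γ) : IsCSet fun x y z : F => v (y - z) < v (x - y) := by
  have key : ∀ x y z : F, v (y - z) < v (x - y) → v (x - z) = v (x - y) := fun x y z h => by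
    have : x - z = (x - y) + (y - z) := by ring
    rw [this, Valuation.map_add_eq_of_lt_left _ h]
  refine ⟨fun x y z h => ?_, fun x y z h => ?_, fun x y z w h => ?_, fun x y h => ?_⟩
  · rwa [key x y z h, v.map_sub_swap]
  · rw [key x y z h, v.map_sub_swap]
    exact lt_irrefl _
  · by_cases h1 : v (y - z) < v (w - y)
    · exact Or.inl h1
    · right
      have h1 := not_lt.1 h1
      have h2 : v (w - z) ≤ v (y - z) := by
        have : w - z = (w - y) + (y - z) := by ring
        rw [this]
        exact (v.map_add _ _).trans (max_le h1 le_rfl)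
      have h3 : v (x - w) = v (x - y) := by
        refine key x y w ?_
        rw [v.map_sub_swap]
        exact h1.trans_lt h
      rw [h3]
      exact h2.trans_lt h
  · rw [sub_self, map_zero, zero_lt_iff, ne_eq, map_eq_zero, sub_eq_zero]
    exact h

/-! ### Boolean combinations and atomic sets for `C` -/

section QuantifierFree

variable {M : Type} (C : M → M → M → Prop)

theorem isQFDefinableC_univ : IsQFDefinableC C Set.univ := by
  let := structureC C
  exact ⟨⊤, BoundedFormula.IsQF.top, fun x => by simp⟩

variable {C}

theorem IsQFDefinableC.compl {A : Set M} (hA : IsQFDefinableC C A) : IsQFDefinableC C Aᶜ := by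
  let := structureC C
  obtain ⟨φ, h1, h2⟩ := hA
  exact ⟨φ.not, h1.not, fun x => by rw [Formula.realize_not, Set.mem_compl_iff, h2 x]⟩

theorem IsQFDefinableC.union {A B : Set M} (hA : IsQFDefinableC C A) (hB : IsQFDefinableC C B) :
    IsQFDefinableC C (A ∪ B) := by
  let := structureC C
  obtain ⟨φ, h1, h2⟩ := hA
  obtain ⟨ψ, h3, h4⟩ := hB
  exact ⟨φ ⊔ ψ, h1.sup h3, fun x => by rw [Formula.realize_sup, Set.mem_union, h2 x, h4 x]⟩

variable (C)

theorem isQFDefinableC_rel (t : Fin 3 → M ⊕ Unit) : IsQFDefinableC C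
    {x | C (Sum.elim id (fun _ => x) (t 0)) (Sum.elim id (fun _ => x) (t 1))
      (Sum.elim id (fun _ => x) (t 2))} := by
  let := structureC C
  let R : langC.Relations 3 := CRel.rel
  refine ⟨R.formula fun i => Term.var (t i), (BoundedFormula.IsAtomic.rel _ _).isQF, fun x => ?_⟩
  refine Iff.trans ?_ Formula.realize_rel.symm
  exact Iff.rfl

end QuantifierFree

/-- By elimination and `det_val_le`, membership depends only on the position of x relative to a
finite set of centres. The three kinds of comparison in `ExtPoint.Equiv` are the negations of C(r,
x, s), C(x, r, s) and C(s, r, x). -/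
theorem isQFDefinableC_of_definable₁ {M Γ : Type} [Field M] [LinearOrderedCommGroupWithZero Γ]
    [IsAlgClosed M] [CharZero M] (v : Valuation M Γ) (hv : v.IsNontrivial) (D : Set M)
    (hD : letI := valuedFieldStructure v; (Set.univ : Set M).Definable₁ langVF D) :
    IsQFDefinableC (fun x y z : M => v (y - z) < v (x - y)) D := by
  classical
  obtain ⟨Q, hQ⟩ := exists_determining_of_definable v hv hD
  let pol : MvPolynomial (Fin 1) M → Polynomial M := MvPolynomial.aeval fun _ => Polynomial.X
  let P : M → ExtPoint v := fun x => ⟨M, Γ, v, RingHom.id M, fun a b => Iff.rfl, x⟩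
  have hpol : ∀ (x : M) (f : MvPolynomial (Fin 1) M), v (f.eval fun _ => x) = (P x).val (pol f) := by
    intro x f
    change _ = v ((pol f).eval₂ (RingHom.id M) x)
    congr 1
    have : MvPolynomial.eval (fun _ : Fin 1 => x) = (Polynomial.evalRingHom x).comp
        (MvPolynomial.aeval fun _ => Polynomial.X :
          MvPolynomial (Fin 1) M →ₐ[M] Polynomial M).toRingHom := by
      refine MvPolynomial.ringHom_ext (fun n => by simp) fun s => by simp
    exact congrArg (fun r : MvPolynomial (Fin 1) M →+* M => r f) this
  choose R hR using fun fg : MvPolynomial (Fin 1) M × MvPolynomial (Fin 1) M =>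
    ExtPoint.det_val_le (vE := v) (pol fg.1) (pol fg.2)
  let S := (Q ×ˢ Q).biUnion R
  have hS : ∀ x y, ExtPoint.Equiv S (P x) (P y) → x ∈ D → y ∈ D := by
    intro x y hxy hx
    refine hQ (fun _ => x) (fun _ => y) (fun f hf g hg => ?_) hx
    rw [hpol, hpol, hpol, hpol]
    exact hR (f, g) _ _ (hxy.mono (Finset.subset_biUnion_of_mem R (by simp [hf, hg])))
  let C := fun x y z : M => v (y - z) < v (x - y)
  have hrel := fun t => (isQFDefinableC_rel C t).compl
  let A : (M × M) × Fin 3 → Set M := fun i =>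
    ![{x | v (x - i.1.1) ≤ v (x - i.1.2)}, {x | v (x - i.1.1) ≤ v (i.1.1 - i.1.2)},
      {x | v (i.1.1 - i.1.2) ≤ v (x - i.1.1)}] i.2
  refine of_determined (IsQFDefinableC C) (isQFDefinableC_univ C) (fun _ _ => .union)
    (fun _ => .compl) ((S ×ˢ S) ×ˢ Finset.univ) A ?_ D ?_
  · rintro ⟨⟨r, s⟩, k⟩ -
    fin_cases k
    · convert hrel ![Sum.inl r, Sum.inr (), Sum.inl s] using 1
      ext x
      simp [A, C, v.map_sub_swap x r]
    · convert hrel ![Sum.inr (), Sum.inl r, Sum.inl s] using 1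
      ext x
      simp [A, C]
    · convert hrel ![Sum.inl s, Sum.inl r, Sum.inr ()] using 1
      ext x
      simp [A, C, v.map_sub_swap x r, v.map_sub_swap r s]
  · intro x y hxy
    refine hS x y fun r hr s hs => ?_
    have h := fun k => hxy ((r, s), k) (by simp [hr, hs])
    exact ⟨h 0, h 1, h 2⟩

theorem isCMinimalTheory_completeTheory {M : Type} [langVF.Structure M] (hM : IsACVFZero M) :
    IsCMinimalTheory cFormula (langVF.completeTheory M) := by
  have hne : Nonempty M := by
    obtain ⟨hf, -⟩ := hM
    exact ⟨0⟩
  have hrel : ∀ {N Γ : Type} [Field N] [LinearOrderedCommGroupWithZero Γ] (v : Valuation N Γ),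
      letI := valuedFieldStructure v
      relOf cFormula N = fun x y z => v (y - z) < v (x - y) := by
    intro N Γ _ _ v
    funext x y z
    exact propext (relOf_cFormula v x y z)
  refine ⟨completeTheory.isComplete _ _, M, hne, inferInstance, inferInstance, ?_, ?_⟩
  · obtain ⟨hf, Γ, hΓ, v, -, -, -, rfl⟩ := hM
    rw [hrel]
    exact isCSet_valuation v
  · intro N _ hN D hD
    obtain ⟨hf, Γ, hΓ, v, _, _, hv, rfl⟩ := hM.of_elementarilyEquivalent hN
    rw [hrel]
    exact isQFDefinableC_of_definable₁ v hv D hD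

end CMinimality

/-! ### Derivations of fields of characteristic zero -/

section Derivations

/-- A derivation which vanishes on a field vanishes on the elements algebraic over it. -/
theorem derivation_eq_zero_of_isAlgebraic {F L Ω : Type*} [Field F] [Field L] [CharZero L]
    [Algebra F L] [Field Ω] [Algebra L Ω] (D : Derivation ℤ L Ω)
    (hD : ∀ a : F, D (algebraMap F L a) = 0) {y : L} (hy : IsAlgebraic F y) : D y = 0 := by
  let := ((algebraMap L Ω).comp (algebraMap F L)).toAlgebra
  have : IsScalarTower F L Ω := IsScalarTower.of_algebraMap_eq fun _ => rfl
  have : CharZero F := (algebraMap F L).charZero_iff (algebraMap F L).injective |>.2 inferInstance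
  let D' : Derivation F L Ω :=
    { toFun := D
      map_add' := D.map_add
      map_smul' := fun a x => by
        rw [Algebra.smul_def, D.leibniz, hD, smul_zero, add_zero, algebraMap_smul]
        rfl
      map_one_eq_zero' := D.map_one_eq_zero
      leibniz' := D.leibniz }
  -- Differentiating the minimal equation gives minpoly'(y) · D y = 0, and the first factor is
  -- nonzero by separability.
  have h1 : D' (Polynomial.aeval y (minpoly F y)) = 0 := by rw [minpoly.aeval, map_zero]
  rw [Derivation.map_aeval] at h1
  rcases smul_eq_zero.1 h1 with h | h
  · exfalso
    exact (minpoly.irreducible hy.isIntegral).separable.aeval_derivative_ne_zero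
      (minpoly.aeval F y) h
  · exact h

/-- A derivation vanishing on the generators of a field vanishes on all elements algebraic over
this field. -/
theorem derivation_eq_zero_of_isAlgebraic_adjoin {F L Ω : Type*} [Field F] [Field L] [CharZero L]
    [Algebra F L] [Field Ω] [Algebra L Ω] [Algebra F Ω] [IsScalarTower F L Ω]
    (D : Derivation F L Ω) (S : Set L) (hS : ∀ s ∈ S, D s = 0) {y : L}
    (hy : IsAlgebraic (IntermediateField.adjoin F S) y) : D y = 0 := by
  refine derivation_eq_zero_of_isAlgebraic (D.restrictScalars ℤ) (fun a => ?_) hy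
  change D (a : L) = 0
  have ha := a.2
  refine IntermediateField.adjoin_induction F (p := fun x _ => D x = 0) hS D.map_algebraMap
    ?_ ?_ ?_ ha
  · intro x y _ _ hx hy
    rw [map_add, hx, hy, add_zero]
  · intro x _ hx
    rw [Derivation.leibniz_inv, hx, smul_zero]
  · intro x y _ _ hx hy
    rw [D.leibniz, hx, hy, smul_zero, smul_zero, add_zero]

/-- In characteristic zero `E` is formally étale over the polynomial ring F[xᵢ]: pass to the
fraction field by localization, then to `E` by a separable algebraic extension. So Kähler
differentials are obtained by base change and the partial derivative extends to `E`. -/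
theorem exists_derivation_of_isTranscendenceBasis {F E ι : Type*} [Field F] [Field E] [CharZero E]
    [Algebra F E] {x : ι → E} (hx : IsTranscendenceBasis F x) (i : ι) :
    ∃ D : Derivation F E E, D (x i) = 1 ∧ ∀ j, j ≠ i → D (x j) = 0 := by
  classical
  let A := MvPolynomial ι F
  let φ : A →ₐ[F] E := MvPolynomial.aeval x
  have hφ : Function.Injective φ := hx.1
  let := φ.toRingHom.toAlgebra
  have : IsScalarTower F A E := IsScalarTower.of_algebraMap_eq fun a => (φ.commutes a).symm
  have : FaithfulSMul A E := (faithfulSMul_iff_algebraMap_injective A E).2 hφ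
  let Q := FractionRing A
  let : Algebra Q E := FractionRing.liftAlgebra A E
  have : IsScalarTower A Q E := FractionRing.isScalarTower_liftAlgebra A E
  have halg : Algebra.IsAlgebraic A E := by
    have h1 := hx.isAlgebraic
    refine ⟨fun y => ?_⟩
    have h2 := h1.isAlgebraic y
    let e : A ≃ₐ[F] Algebra.adjoin F (Set.range x) := hx.1.aevalEquiv
    refine IsAlgebraic.of_ringHom_of_comp_eq (e : A →+* Algebra.adjoin F (Set.range x))
      (RingHom.id E) h2 e.surjective Function.injective_id ?_
    refine RingHom.ext fun a => ?_
    exact hx.1.algebraMap_aevalEquiv a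
  have : Algebra.IsAlgebraic Q E := (IsFractionRing.comap_isAlgebraic_iff (A := A)).1 halg
  have : CharZero Q := (algebraMap Q E).charZero_iff (algebraMap Q E).injective |>.2 inferInstance
  have : Algebra.FormallyEtale Q E := Algebra.FormallyEtale.of_isSeparable Q E
  have : Algebra.FormallyEtale A Q := Algebra.FormallyEtale.of_isLocalization (nonZeroDivisors A)
  have : Algebra.FormallyEtale A E := Algebra.FormallyEtale.comp A Q E
  let d : Derivation F A E := MvPolynomial.mkDerivation F (Pi.single i (1 : E))
  let T := KaehlerDifferential.tensorKaehlerEquivOfFormallyEtale F A E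
  let l : TensorProduct A E (KaehlerDifferential F A) →ₗ[E] E :=
    d.liftKaehlerDifferential.liftBaseChange E
  have key : ∀ j, (l ∘ₗ T.symm.toLinearMap).compDer (KaehlerDifferential.D F E) (x j) =
      (Pi.single i (1 : E) : ι → E) j := by
    intro j
    have : x j = algebraMap A E (MvPolynomial.X j) := (MvPolynomial.aeval_X x j).symm
    change l (T.symm (KaehlerDifferential.D F E (x j))) = _
    rw [this]
    simp only [T, KaehlerDifferential.tensorKaehlerEquivOfFormallyEtale_symm_D_algebraMap]
    simp only [l, LinearMap.liftBaseChange_tmul, Derivation.liftKaehlerDifferential_comp_D, one_smul]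
    exact MvPolynomial.mkDerivation_X F _ j
  refine ⟨_, (key i).trans (Pi.single_eq_same i 1), fun j hj => ?_⟩
  exact (key j).trans (Pi.single_eq_of_ne hj 1)

/-- The partial derivative with respect to a member of an algebraically independent family. -/
theorem exists_derivation_of_algebraicIndependent {F E ι : Type*} [Field F] [Field E] [CharZero E]
    [Algebra F E] {x : ι → E} (hx : AlgebraicIndependent F x) (i : ι) :
    ∃ D : Derivation F E E, D (x i) = 1 ∧ ∀ j, j ≠ i → D (x j) = 0 := by
  have h : AlgebraicIndepOn F id (Set.range x) := hx.coe_range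
  obtain ⟨B, hB, hB'⟩ := exists_isTranscendenceBasis_superset (R := F) h
  obtain ⟨D, h1, h2⟩ := exists_derivation_of_isTranscendenceBasis hB' ⟨x i, hB ⟨i, rfl⟩⟩
  refine ⟨D, h1, fun j hj => h2 ⟨x j, hB ⟨j, rfl⟩⟩ fun h => hj ?_⟩
  exact hx.injective (congrArg Subtype.val h)

/-- The existence of a derivation which does not vanish on a transcendental element. -/
theorem exists_derivation {F E : Type*} [Field F] [Field E] [CharZero E] [Algebra F E] {x : E}
    (hx : Transcendental F x) : ∃ D : Derivation F E E, D x = 1 := by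
  have h : AlgebraicIndependent F fun _ : Unit => x :=
    (algebraicIndependent_unique_type_iff (R := F)).2 hx
  obtain ⟨D, hD, -⟩ := exists_derivation_of_algebraicIndependent h ()
  exact ⟨D, hD⟩

/-- Two derivations on a field and on an extension which agree on a transcendence basis agree. -/
theorem derivation_algebraMap_eq {K L Ω ι : Type*} [Field K] [Field L] [CharZero L] [Field Ω]
    [Algebra K L] [Algebra K Ω] [Algebra L Ω] [IsScalarTower K L Ω] {x : ι → L}
    (hx : IsTranscendenceBasis K x) (D : Derivation K Ω Ω) (d : Derivation K L L) (c : Ω)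
    (h : ∀ i, D (algebraMap L Ω (x i)) = c * algebraMap L Ω (d (x i))) (y : L) :
    D (algebraMap L Ω y) = c * algebraMap L Ω (d y) := by
  let D1 : Derivation K L Ω := D.compAlgebraMap L
  let D2 : Derivation K L Ω := (LinearMap.toSpanSingleton L Ω c).compDer d
  have h1 : ∀ z, (D1 - D2) z = D (algebraMap L Ω z) - c * algebraMap L Ω (d z) := by
    intro z
    change D (algebraMap L Ω z) - d z • c = _
    rw [Algebra.smul_def, mul_comm]
  have h2 := derivation_eq_zero_of_isAlgebraic_adjoin (D1 - D2) (Set.range x) (y := y) (by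
    rintro _ ⟨i, rfl⟩
    rw [h1, h, sub_self]) (hx.isAlgebraic_field.isAlgebraic y)
  rwa [h1, sub_eq_zero] at h2

end Derivations

/-! ### Linear disjointness over an algebraically closed field -/

section Disjointness

variable {K H Ω : Type*} [Field K] [Field H] [Field Ω] [CharZero H] [CharZero Ω] [Algebra K H]
  [Algebra K Ω] [Algebra H Ω] [IsScalarTower K H Ω]

/-- Complete h to a transcendence basis of `H` over `K`. Together with c it stays algebraically
independent in `Ω`, and the partial derivatives in the direction h, taken in `H` and in `Ω`, agree
on that basis, hence on `H`; the one on `Ω` kills c. -/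
theorem exists_compatible_derivation {ι : Type*} {c : ι → Ω} (hc : AlgebraicIndependent H c)
    {h : H} (hh : Transcendental K h) :
    ∃ (d : H → H) (D : Derivation K Ω Ω), (∀ a, D (algebraMap H Ω a) = algebraMap H Ω (d a)) ∧
      d h = 1 ∧ ∀ f, IsAlgebraic (IntermediateField.adjoin K (Set.range c)) f → D f = 0 := by
  have h1 : AlgebraicIndepOn K id ({h} : Set H) :=
    (algebraicIndependent_unique_type_iff (R := K)).2 hh
  obtain ⟨B, hB, hB'⟩ := exists_isTranscendenceBasis_superset (R := K) h1
  obtain ⟨d, hd1, hd2⟩ := exists_derivation_of_isTranscendenceBasis hB' ⟨h, hB rfl⟩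
  obtain ⟨D, hD1, hD2⟩ := exists_derivation_of_algebraicIndependent (hB'.1.sumElim_comp hc)
    (Sum.inr ⟨h, hB rfl⟩)
  refine ⟨d, D, fun a => ?_, hd1, fun f hf => ?_⟩
  · rw [derivation_algebraMap_eq hB' D d 1 (fun i => ?_), one_mul]
    by_cases hi : i = ⟨h, hB rfl⟩
    · subst hi
      rw [hd1, map_one, one_mul]
      exact hD1
    · rw [hd2 i hi, map_zero, mul_zero]
      exact hD2 (Sum.inr i) fun h => hi (Sum.inr_injective h)
  · refine derivation_eq_zero_of_isAlgebraic_adjoin D (Set.range c) ?_ hf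
    rintro _ ⟨i, rfl⟩
    exact hD2 (Sum.inl i) Sum.inl_ne_inr

/-- Elements algebraic over a purely transcendental extension of an algebraically closed field
remain linearly independent over a larger field over which the extension is still purely
transcendental. -/
theorem linearIndependent_of_algebraicIndependent [IsAlgClosed K] {ι κ : Type*} {c : ι → Ω}
    (hc : AlgebraicIndependent H c) {f : κ → Ω}
    (hf : ∀ j, IsAlgebraic (IntermediateField.adjoin K (Set.range c)) (f j))
    (hK : LinearIndependent K f) : LinearIndependent H f := by
  classical
  rw [linearIndependent_iff']
  intro s
  induction s using Finset.strongInduction with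
  | H s ih =>
  intro g hg
  by_contra hne
  push Not at hne
  obtain ⟨i0, hi0, hg0⟩ := hne
  let g' : κ → H := fun i => g i / g i0
  have hg' : ∑ i ∈ s, g' i • f i = 0 := by
    have : ∑ i ∈ s, g' i • f i = (g i0)⁻¹ • ∑ i ∈ s, g i • f i := by
      rw [Finset.smul_sum]
      refine Finset.sum_congr rfl fun i _ => ?_
      rw [smul_smul, ← div_eq_inv_mul]
    rw [this, hg, smul_zero]
  have h0 : g' i0 = 1 := div_self hg0
  -- In a shortest relation normalised to have one coefficient 1, all coefficients lie in `K`: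
  -- otherwise differentiating in the direction of a coefficient outside `K` removes the term with
  -- coefficient 1 and leaves a nontrivial relation.
  have halg : ∀ i ∈ s, ∃ a : K, algebraMap K H a = g' i := by
    intro i hi
    by_contra hcon
    have htr : Transcendental K (g' i) := fun halg => by
      exact hcon (minpoly.mem_range_of_degree_eq_one K _
        (IsAlgClosed.degree_eq_one_of_irreducible K (minpoly.irreducible halg.isIntegral)))
    obtain ⟨d, D, h1, h2, h3⟩ := exists_compatible_derivation (K := K) hc htr
    have hd1 : d 1 = 0 := by
      apply (algebraMap H Ω).injective
      rw [← h1, map_one, map_zero, D.map_one_eq_zero]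
    have hsum : ∑ j ∈ s.erase i0, d (g' j) • f j = 0 := by
      have h4 : D (∑ i ∈ s, g' i • f i) = 0 := by rw [hg', map_zero]
      rw [map_sum, ← Finset.add_sum_erase s _ hi0] at h4
      have h5 : ∀ j, D (g' j • f j) = d (g' j) • f j := fun j => by
        rw [Algebra.smul_def, D.leibniz, h3 _ (hf j), h1, smul_zero, zero_add, smul_eq_mul,
          mul_comm, Algebra.smul_def]
      simp only [h5] at h4
      rwa [h0, hd1, zero_smul, zero_add] at h4
    have hi' : i ∈ s.erase i0 := by
      refine Finset.mem_erase.2 ⟨?_, hi⟩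
      rintro rfl
      exact hcon ⟨1, by rw [map_one, h0]⟩
    have := ih _ (Finset.erase_ssubset hi0) _ hsum i hi'
    rw [h2] at this
    exact one_ne_zero this
  choose! a ha using halg
  have hsum : ∑ i ∈ s, a i • f i = 0 := by
    rw [← hg']
    refine Finset.sum_congr rfl fun i hi => ?_
    rw [← ha i hi, algebraMap_smul]
  have := linearIndependent_iff'.1 hK s a hsum i0 hi0
  have h1 := ha i0 hi0
  rw [this, map_zero, h0] at h1
  exact zero_ne_one h1

end Disjointness

/-! ### The extension generated by a generic point of a generic hyperplane -/

section GenericLine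

variable {K H L Ω : Type} [Field K] [Field H] [Field L] [Field Ω]
  [Algebra K H] [Algebra K L] [Algebra K Ω] [Algebra H Ω] [Algebra L Ω] [IsScalarTower K H Ω]
  [IsScalarTower K L Ω]

/-- The configuration of a point `(t, b)` with `b = α₀ + ∑ αᵢ tᵢ`, where the coefficients are
algebraically independent over `K` and `t` is algebraically independent over `H ∋ αᵢ`. -/
structure GenericLine (K H L Ω : Type) [Field K] [Field H] [Field L] [Field Ω]
    [Algebra K H] [Algebra K L] [Algebra H Ω] [Algebra L Ω] (n : ℕ) where
  t : Fin n → L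
  b : L
  α : Fin n → H
  α₀ : H
  indep_α : AlgebraicIndependent K fun o : Option (Fin n) => o.elim α₀ α
  indep_t : AlgebraicIndependent H fun i => algebraMap L Ω (t i)
  eq_b : algebraMap L Ω b = algebraMap H Ω α₀ +
    ∑ i, algebraMap H Ω (α i) * algebraMap L Ω (t i)
  isAlgebraic : Algebra.IsAlgebraic
    (Algebra.adjoin K (Set.range fun o : Option (Fin n) => o.elim b t)) L

theorem exists_adjoin_ringHom (S : Set L) :
    ∃ ψ : Algebra.adjoin K S →+* Algebra.adjoin K (algebraMap L Ω '' S),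
      ∀ a, (ψ a : Ω) = algebraMap L Ω a := by
  let φ : L →ₐ[K] Ω := IsScalarTower.toAlgHom K L Ω
  have hφ : (Algebra.adjoin K S).map φ = Algebra.adjoin K (algebraMap L Ω '' S) :=
    AlgHom.map_adjoin φ S
  refine ⟨(φ.toRingHom.comp (Algebra.adjoin K S).val.toRingHom).codRestrict
    (Algebra.adjoin K (algebraMap L Ω '' S)) fun a => ?_, fun a => rfl⟩
  rw [← hφ]
  exact ⟨a, a.2, rfl⟩

namespace GenericLine

variable {n : ℕ} (g : GenericLine K H L Ω n)

include g

/-- Since α₀ = b - ∑ αᵢtᵢ, the element α₀ can be exchanged for b in the independent family α₀, α, t.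
-/
theorem algebraicIndependent_coefficients_point :
    AlgebraicIndependent K (Sum.elim (fun i => algebraMap H Ω (g.α i))
      (fun o : Option (Fin n) => algebraMap L Ω (o.elim g.b g.t))) := by
  have h1 := g.indep_α.sumElim_comp g.indep_t
  let x : Fin n ⊕ Fin n → Ω := Sum.elim (fun i => algebraMap L Ω (g.t i))
    (fun i => algebraMap H Ω (g.α i))
  let e : Option (Fin n ⊕ Fin n) → Fin n ⊕ Option (Fin n) :=
    fun o => o.elim (Sum.inr none) (Sum.elim Sum.inl fun i => Sum.inr (some i))
  have he : Function.Injective e := by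
    rintro (_ | i | i) (_ | j | j) <;> simp [e]
  have h2 : AlgebraicIndependent K fun o : Option (Fin n ⊕ Fin n) =>
      o.elim (algebraMap H Ω g.α₀) x := by
    convert h1.comp e he using 1
    funext o
    rcases o with _ | i | i <;> rfl
  have hx : AlgebraicIndependent K x := h2.comp some (Option.some_injective _)
  have h3 := (hx.option_iff_transcendental _).1 h2
  have h4 : Transcendental (Algebra.adjoin K (Set.range x)) (algebraMap L Ω g.b) := by
    intro hb
    apply h3
    have hmem : ∀ i, x i ∈ Algebra.adjoin K (Set.range x) := fun i =>
      Algebra.subset_adjoin ⟨i, rfl⟩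
    let s : Algebra.adjoin K (Set.range x) :=
      ∑ i : Fin n, ⟨x (Sum.inr i), hmem _⟩ * ⟨x (Sum.inl i), hmem _⟩
    have hs : algebraMap H Ω g.α₀ =
        algebraMap L Ω g.b - algebraMap (Algebra.adjoin K (Set.range x)) Ω s := by
      rw [g.eq_b, map_sum]
      exact (add_sub_cancel_right _ _).symm
    rw [hs]
    exact hb.sub (isAlgebraic_algebraMap s)
  have h5 := (hx.option_iff_transcendental _).2 h4
  let e' : Fin n ⊕ Option (Fin n) → Option (Fin n ⊕ Fin n) :=
    Sum.elim (fun i => some (Sum.inr i)) fun o => o.elim none fun i => some (Sum.inl i)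
  have he' : Function.Injective e' := by
    rintro (i | _ | i) (j | _ | j) <;> simp [e']
  convert h5.comp e' he' using 1
  funext o
  rcases o with i | _ | i <;> rfl

theorem isTranscendenceBasis :
    IsTranscendenceBasis K fun o : Option (Fin n) => o.elim g.b g.t := by
  have h := (AlgebraicIndependent.sumElim_iff.1 g.algebraicIndependent_coefficients_point).1
  have h1 : AlgebraicIndependent K fun o : Option (Fin n) => o.elim g.b g.t :=
    AlgebraicIndependent.of_comp (IsScalarTower.toAlgHom K L Ω) h
  exact h1.isTranscendenceBasis_iff_isAlgebraic.2 g.isAlgebraic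

/-- The coefficients α₁,…,αₙ are independent over K[b, t], and `L` is algebraic over it. This
genericity over `L` is what rules out further relations. -/
theorem indep_over : AlgebraicIndependent L fun i => algebraMap H Ω (g.α i) := by
  have h := (AlgebraicIndependent.sumElim_iff.1 g.algebraicIndependent_coefficients_point).2
  let S : Set L := Set.range fun o : Option (Fin n) => o.elim g.b g.t
  obtain ⟨ψ, hψ⟩ := exists_adjoin_ringHom (K := K) (Ω := Ω) S
  have hS : (algebraMap L Ω '' S) =
      Set.range fun o : Option (Fin n) => algebraMap L Ω (o.elim g.b g.t) := by
    rw [← Set.range_comp]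
    rfl
  rw [← hS] at h
  have hA : AlgebraicIndependent (Algebra.adjoin K S) fun i => algebraMap H Ω (g.α i) := by
    refine AlgebraicIndependent.of_ringHom_of_comp_eq (x := fun i => algebraMap H Ω (g.α i)) ψ
      (RingHom.id Ω) h ?_ (RingHom.ext hψ)
    intro a b hab
    exact Subtype.ext ((algebraMap L Ω).injective (by
      rw [← hψ, ← hψ, hab]))
  have := g.isAlgebraic
  exact hA.extendScalars L

/-- The affine polynomial ∑ τᵢXᵢ - β over `L` vanishes at a tuple algebraically independent over
`L`, so all its coefficients are zero. -/
theorem eq_zero_of_relation (τ : Fin n → L) (β : L)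
    (h : algebraMap L Ω β = ∑ i, algebraMap H Ω (g.α i) * algebraMap L Ω (τ i)) (i : Fin n) :
    τ i = 0 := by
  classical
  let p : MvPolynomial (Fin n) L :=
    ∑ i, MvPolynomial.C (τ i) * MvPolynomial.X i - MvPolynomial.C β
  have hp : MvPolynomial.aeval (fun i => algebraMap H Ω (g.α i)) p = 0 := by
    simp only [p, map_sub, map_sum, map_mul, MvPolynomial.aeval_X, MvPolynomial.algHom_C, h,
      sub_eq_zero]
    exact Finset.sum_congr rfl fun i _ => mul_comm _ _
  have h0 : p = 0 := (injective_iff_map_eq_zero _).1 g.indep_over p hp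
  have h1 := congrArg (MvPolynomial.coeff (Finsupp.single i 1)) h0
  have h2 : (0 : Fin n →₀ ℕ) ≠ Finsupp.single i 1 := fun h => by
    simpa using congrArg (fun f => f i) h
  simpa [p, MvPolynomial.coeff_sum, MvPolynomial.coeff_C_mul, MvPolynomial.coeff_X,
    MvPolynomial.coeff_C, Finsupp.single_left_inj, h2] using h1

/-- If independence were lost over `H`, some tᵢ would be transcendental over H(S), where S consists
of n members of a transcendence basis of `L`. A derivation of `Ω` over H(S) restricts on `L` to a
multiple of one partial derivative d of `L`; applied to the equation of b it yields a relation d b =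
∑ αᵢ d tᵢ with terms in `L`, which forces every d tᵢ to vanish. -/
theorem algebraicIndependent_of_encard_le [CharZero L] [CharZero Ω] {I : Set L} (hI : AlgebraicIndepOn K id I)
    (hn : I.encard ≤ n) : AlgebraicIndependent H fun i : I => algebraMap L Ω i := by
  classical
  obtain ⟨B, hIB, hB⟩ := exists_isTranscendenceBasis_superset (R := K) hI
  have hcard : B.encard = n + 1 := by
    have h1 := hB.cardinalMk_eq g.isTranscendenceBasis
    rw [Set.encard, ENat.card, h1]
    simp
  -- `B` has n+1 elements and `I` at most n; this is the only use of the bound on the size of `I`.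
  obtain ⟨x, hxB, hxI⟩ : ∃ x ∈ B, x ∉ I := by
    by_contra hcon
    push Not at hcon
    have h1 := (Set.encard_le_encard hcon).trans hn
    rw [hcard] at h1
    exact absurd h1 (by exact_mod_cast Nat.not_succ_le_self n)
  have hinj : Function.Injective (algebraMap L Ω) := (algebraMap L Ω).injective
  let S : Set Ω := algebraMap L Ω '' (B \ {x})
  have hS : S.encard = n := by
    rw [hinj.encard_image]
    have h1 := Set.encard_sdiff_singleton_add_one hxB
    rw [hcard] at h1
    exact (ENat.add_left_injective_of_ne_top ENat.one_ne_top) h1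
  by_contra hdep
  let M := AlgebraicIndependent.matroid H Ω
  have hSdep : ¬ M.Indep S := by
    intro h
    rw [AlgebraicIndependent.matroid_indep_iff] at h
    let e : I → S := fun i => ⟨algebraMap L Ω i, i, ⟨hIB i.2, fun h => hxI (h ▸ i.2)⟩, rfl⟩
    exact hdep (AlgebraicIndependent.comp h e fun a b hab =>
      Subtype.ext (hinj (congrArg Subtype.val hab)))
  have hSfin : S.Finite := Set.finite_of_encard_eq_coe hS
  -- Otherwise S, with n elements, would span the n independent elements t over `H` and so be
  -- independent itself.
  obtain ⟨i, hi⟩ : ∃ i, algebraMap L Ω (g.t i) ∉ M.closure S := by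
    by_contra hcon
    push Not at hcon
    apply hSdep
    rw [Matroid.indep_iff_eRk_eq_encard_of_finite hSfin]
    refine le_antisymm (M.eRk_le_encard S) ?_
    have h1 : M.Indep (Set.range fun i => algebraMap L Ω (g.t i)) := by
      rw [AlgebraicIndependent.matroid_indep_iff]
      exact g.indep_t.coe_range
    rw [hS, ← M.eRk_closure_eq S]
    calc (n : ℕ∞) = (Set.range fun i => algebraMap L Ω (g.t i)).encard := by
          rw [← Set.image_univ, g.indep_t.injective.encard_image]
          simp
      _ = M.eRk (Set.range fun i => algebraMap L Ω (g.t i)) := h1.eRk_eq_encard.symm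
      _ ≤ M.eRk (M.closure S) := M.eRk_mono (by rintro _ ⟨i, rfl⟩; exact hcon i)
  have htr : Transcendental (IntermediateField.adjoin H S) (algebraMap L Ω (g.t i)) := by
    rw [AlgebraicIndependent.matroid_closure_eq] at hi
    rw [IntermediateField.transcendental_adjoin_iff]
    exact hi
  obtain ⟨D, hD⟩ := exists_derivation htr
  let DH : Derivation H Ω Ω := D.restrictScalars H
  let DK : Derivation K Ω Ω := DH.restrictScalars K
  obtain ⟨d, hd1, hd2⟩ := exists_derivation_of_isTranscendenceBasis hB ⟨x, hxB⟩
  have hDS : ∀ s ∈ S, D s = 0 := fun s hs =>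
    D.map_algebraMap ⟨s, IntermediateField.subset_adjoin H S hs⟩
  have key : ∀ y : L, D (algebraMap L Ω y) = D (algebraMap L Ω x) * algebraMap L Ω (d y) := by
    refine derivation_algebraMap_eq hB DK d _ fun j => ?_
    by_cases hj : j = ⟨x, hxB⟩
    · subst hj
      rw [hd1, map_one, mul_one]
      rfl
    · rw [hd2 j hj, map_zero, mul_zero]
      exact hDS _ ⟨j, ⟨j.2, fun h => hj (Subtype.ext h)⟩, rfl⟩
  have hDx : D (algebraMap L Ω x) ≠ 0 := by
    intro h
    have := key (g.t i)
    rw [hD, h, zero_mul] at this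
    exact one_ne_zero this
  have hrel : algebraMap L Ω (d g.b) = ∑ i, algebraMap H Ω (g.α i) * algebraMap L Ω (d (g.t i)) := by
    apply mul_left_cancel₀ hDx
    rw [← key, g.eq_b]
    change DH _ = _
    simp only [map_add, map_sum, DH.leibniz, DH.map_algebraMap, zero_add,
      Finset.mul_sum, smul_eq_mul]
    refine Finset.sum_congr rfl fun j _ => ?_
    have h1 : DH (algebraMap L Ω (g.t j)) = _ := key (g.t j)
    rw [h1]
    ring
  have h0 := g.eq_zero_of_relation (fun i => d (g.t i)) (d g.b) hrel i
  have h1 := key (g.t i)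
  rw [hD, h0, map_zero, mul_zero] at h1
  exact one_ne_zero h1

/-- Elements algebraic over `K(c)` for an `n`-tuple `c` which are linearly independent over `K`
are linearly independent over `H`. -/
theorem linearIndependent [IsAlgClosed K] [CharZero H] [CharZero L] [CharZero Ω] {m : ℕ}
    (hm : m ≤ n) (c : Fin m → L) {κ : Type} {f : κ → L}
    (hf : ∀ j, IsAlgebraic (Algebra.adjoin K (Set.range c)) (f j))
    (hK : LinearIndependent K f) : LinearIndependent H fun j => algebraMap L Ω (f j) := by
  let M := AlgebraicIndependent.matroid K L
  obtain ⟨I, hI⟩ := M.exists_isBasis (Set.range c)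
  have hI1 : AlgebraicIndepOn K id I := AlgebraicIndependent.matroid_indep_iff.1 hI.indep
  have hI2 : I.encard ≤ n := by
    refine (Set.encard_le_encard hI.subset).trans ?_
    rw [← Set.image_univ]
    refine (Set.encard_image_le _ _).trans ?_
    simpa using hm
  have h1 := g.algebraicIndependent_of_encard_le hI1 hI2
  refine linearIndependent_of_algebraicIndependent (K := K) h1 (fun j => ?_) ?_
  · have h2 : IsAlgebraic (Algebra.adjoin K I) (f j) :=
      (AlgebraicIndependent.isAlgebraic_adjoin_iff_of_matroid_isBasis hI).2 (hf j)
    obtain ⟨ψ, hψ⟩ := exists_adjoin_ringHom (K := K) (Ω := Ω) I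
    have hI' : Set.range (fun i : I => algebraMap L Ω i) = algebraMap L Ω '' I := by
      rw [Set.image_eq_range]
    rw [IntermediateField.isAlgebraic_adjoin_iff, hI']
    refine h2.ringHom_of_comp_eq ψ (algebraMap L Ω) (fun a b hab => ?_) (RingHom.ext hψ)
    exact Subtype.ext ((algebraMap L Ω).injective (by rw [← hψ, ← hψ, hab]))
  · exact hK.map' (IsScalarTower.toAlgHom K L Ω).toLinearMap
      (LinearMap.ker_eq_bot.2 (algebraMap L Ω).injective)

end GenericLine

end GenericLine

/-! ### Spherically complete valued fields -/

section SphericallyComplete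

variable {H X Γ Γ' : Type} [Field H] [Field X] [Algebra H X] [LinearOrderedCommGroupWithZero Γ]
  [LinearOrderedCommGroupWithZero Γ']

/-- Every family of pairwise intersecting balls has a common point. -/
def IsSphericallyComplete (v : Valuation H Γ) : Prop :=
  ∀ (ι : Type) (a h : ι → H), (∀ i j, v (a i - a j) ≤ max (v (h i)) (v (h j))) →
    ∃ x, ∀ i, v (x - a i) ≤ v (h i)

/-- The valuation `w` extends the valuation `v`, up to equivalence. -/
def Extends (v : Valuation H Γ) (w : Valuation X Γ') : Prop :=
  ∀ a b, w (algebraMap H X a) ≤ w (algebraMap H X b) ↔ v a ≤ v b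

theorem Extends.lt_iff {v : Valuation H Γ} {w : Valuation X Γ'} (h : Extends v w) (a b : H) :
    w (algebraMap H X a) < w (algebraMap H X b) ↔ v a < v b := by
  rw [← not_le, ← not_le, h]

theorem Extends.eq_iff {v : Valuation H Γ} {w : Valuation X Γ'} (h : Extends v w) (a b : H) :
    w (algebraMap H X a) = w (algebraMap H X b) ↔ v a = v b := by
  rw [le_antisymm_iff, le_antisymm_iff, h, h]

/-- The image of the valuation ring in `X` is a local ring, dominated by some valuation ring of `X`;
domination prevents an element of `H` outside the old ring from entering the new one. -/
theorem exists_extends (v : Valuation H Γ) :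
    ∃ V : ValuationSubring X, Extends v V.valuation := by
  let A : LocalSubring H := v.valuationSubring.toLocalSubring
  obtain ⟨V, hV⟩ := (A.map (algebraMap H X)).exists_le_valuationSubring
  have h1 : ∀ a, v a ≤ 1 → V.valuation (algebraMap H X a) ≤ 1 := fun a ha => by
    rw [V.valuation_le_one_iff]
    exact hV.1 ⟨a, ha, rfl⟩
  have h2 : ∀ a, V.valuation (algebraMap H X a) ≤ 1 → v a ≤ 1 := by
    intro a ha
    by_contra hcon
    have ha0 : a ≠ 0 := by
      rintro rfl
      simp at hcon
    have hinv : v a⁻¹ ≤ 1 := by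
      rw [map_inv₀]
      exact inv_le_one_of_one_le₀ (not_le.1 hcon).le
    obtain ⟨hle, hloc⟩ := hV
    let y : (A.map (algebraMap H X)).toSubring := ⟨algebraMap H X a⁻¹, a⁻¹, hinv, rfl⟩
    have hy : IsUnit (Subring.inclusion hle y) := by
      refine isUnit_iff_exists_inv.2 ⟨⟨algebraMap H X a, (V.valuation_le_one_iff _).1 ha⟩, ?_⟩
      apply Subtype.ext
      change algebraMap H X a⁻¹ * algebraMap H X a = 1
      rw [← map_mul, inv_mul_cancel₀ ha0, map_one]
    obtain ⟨z, hz⟩ := isUnit_iff_exists_inv.1 (hloc.map_nonunit y hy)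
    obtain ⟨z, b, hb, rfl⟩ := z
    have hz' := congrArg Subtype.val hz
    change algebraMap H X a⁻¹ * algebraMap H X b = 1 at hz'
    rw [← map_mul, ← map_one (algebraMap H X)] at hz'
    have hab : a⁻¹ * b = 1 := (algebraMap H X).injective hz'
    have : b = a := by
      rw [inv_mul_eq_one₀ ha0] at hab
      exact hab.symm
    subst this
    exact hcon hb
  refine ⟨V, fun a b => ?_⟩
  exact (le_iff_of_le_one_iff v (V.valuation.comap (algebraMap H X))
    (fun x => ⟨h1 x, h2 x⟩) a b).symm

/-- A finite family is orthonormal if linear combinations have the maximal possible value. -/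
def IsOrthonormalFor (H : Type) {X Γ' ι : Type} [Field H] [Field X] [Algebra H X] [Fintype ι]
    [LinearOrderedCommGroupWithZero Γ'] (w : Valuation X Γ') (e : ι → X) : Prop :=
  ∀ (a : ι → H) (h : H), w (∑ i, a i • e i) ≤ w (algebraMap H X h) ↔
    ∀ i, w (algebraMap H X (a i)) ≤ w (algebraMap H X h)

/-- Each approximation a, with error of value v(h a), gives in each coordinate the ball of radius
v(h a) around aᵢ. By orthonormality these balls meet pairwise as a varies, and common points of the
coordinate families form an approximation at least as good as every a. -/
theorem IsSphericallyComplete.exists_best {v : Valuation H Γ} (hv : IsSphericallyComplete v)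
    {w : Valuation X Γ'} (hw : Extends v w) {ι : Type} [Fintype ι] {e : ι → X}
    (he : IsOrthonormalFor H w e) (x : X)
    (hx : ∀ a : ι → H, ∃ h, w (x - ∑ i, a i • e i) = w (algebraMap H X h)) :
    ∃ y : ι → H, ∀ a : ι → H, w (x - ∑ i, y i • e i) ≤ w (x - ∑ i, a i • e i) := by
  choose h hh using hx
  have hsub : ∀ a b : ι → H, ∑ i, (a i - b i) • e i = (x - ∑ i, b i • e i) - (x - ∑ i, a i • e i) := by
    intro a b
    simp only [sub_smul, Finset.sum_sub_distrib]
    ring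
  have hmax : ∀ a b : H, max (w (algebraMap H X a)) (w (algebraMap H X b)) =
      w (algebraMap H X (if v a ≤ v b then b else a)) := by
    intro a b
    split_ifs with hab
    · exact max_eq_right ((hw a b).2 hab)
    · exact max_eq_left ((hw b a).2 (not_le.1 hab).le)
  have hmax' : ∀ a b : H, v (if v a ≤ v b then b else a) = max (v a) (v b) := by
    intro a b
    split_ifs with hab
    · exact (max_eq_right hab).symm
    · exact (max_eq_left (not_le.1 hab).le).symm
  have hcoord : ∀ (i : ι) (a b : ι → H), v (a i - b i) ≤ max (v (h a)) (v (h b)) := by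
    intro i a b
    have h1 : w (∑ i, (a i - b i) • e i) ≤ max (w (algebraMap H X (h a)))
        (w (algebraMap H X (h b))) := by
      rw [hsub, ← hh, ← hh, max_comm]
      exact w.map_sub _ _
    rw [hmax] at h1
    rw [← hmax', ← hw]
    exact (he _ _).1 h1 i
  choose y hy using fun i => hv (ι → H) (fun a => a i) h (hcoord i)
  refine ⟨y, fun a => ?_⟩
  have h1 : x - ∑ i, y i • e i = (x - ∑ i, a i • e i) - ∑ i, (y i - a i) • e i := by
    rw [hsub]
    ring
  rw [h1]
  refine (w.map_sub _ _).trans (max_le le_rfl ?_)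
  rw [hh]
  exact (he _ _).2 fun i => (hw _ _).2 (hy i a)

theorem isOrthonormalFor_one (w : Valuation X Γ') : IsOrthonormalFor H w fun _ : Unit => (1 : X) := by
  intro a h
  simp only [Finset.univ_unique, Finset.sum_singleton, Algebra.smul_def, mul_one]
  exact ⟨fun h _ => h, fun h => h _⟩

/-- The values of an algebraic extension are torsion over the values of the base. -/
theorem exists_pow_eq_of_isAlgebraic (w : Valuation X Γ') {x : X} (hx : IsAlgebraic H x)
    (hx0 : x ≠ 0) : ∃ (n : ℕ) (h : H), n ≠ 0 ∧ h ≠ 0 ∧ w x ^ n = w (algebraMap H X h) := by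
  classical
  obtain ⟨p, hp, hpx⟩ := hx
  rw [Polynomial.aeval_def, Polynomial.eval₂_eq_sum, Polynomial.sum_def] at hpx
  have hwx : w x ≠ 0 := by simpa using hx0
  have hterm : ∀ i, i ∈ p.support → w (algebraMap H X (p.coeff i) * x ^ i) ≠ 0 := by
    intro i hi
    simpa [hx0] using Polynomial.mem_support_iff.1 hi
  obtain ⟨j, hj, hmax⟩ := p.support.exists_max_image
    (fun i => w (algebraMap H X (p.coeff i) * x ^ i)) (Polynomial.support_nonempty.2 hp)
  -- A sum with a unique term of largest value cannot be zero, so two different terms share the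
  -- largest value; their quotient expresses a power of w(x) by a value from `H`.
  obtain ⟨i, hi, hij, hle⟩ : ∃ i ∈ p.support, i ≠ j ∧
      w (algebraMap H X (p.coeff i) * x ^ i) = w (algebraMap H X (p.coeff j) * x ^ j) := by
    by_contra hcon
    push Not at hcon
    have := w.map_sum_eq_of_lt hj (fun i hi => by
      rw [Finset.mem_sdiff, Finset.mem_singleton] at hi
      exact lt_of_le_of_ne (hmax i hi.1) (hcon i hi.1 hi.2))
    rw [hpx, map_zero] at this
    exact hterm j hj this.symm
  have key : ∀ i j : ℕ, i ∈ p.support → j ∈ p.support → i < j →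
      w (algebraMap H X (p.coeff i) * x ^ i) = w (algebraMap H X (p.coeff j) * x ^ j) →
      ∃ (n : ℕ) (h : H), n ≠ 0 ∧ h ≠ 0 ∧ w x ^ n = w (algebraMap H X h) := by
    intro i j hi hj hij h
    have hi0 := Polynomial.mem_support_iff.1 hi
    have hj0 := Polynomial.mem_support_iff.1 hj
    refine ⟨j - i, p.coeff i / p.coeff j, by omega, div_ne_zero hi0 hj0, ?_⟩
    have hj1 : w (algebraMap H X (p.coeff j)) ≠ 0 := by simpa using hj0
    rw [map_div₀, map_div₀, eq_div_iff hj1]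
    apply mul_right_cancel₀ (pow_ne_zero i hwx)
    rw [map_mul, map_mul, map_pow, map_pow] at h
    rw [h, mul_right_comm, ← pow_add, Nat.sub_add_cancel hij.le, mul_comm]
  rcases lt_or_gt_of_ne hij with h | h
  · exact key i j hi hj h hle
  · exact key j i hj hi h hle.symm

/-- Reduce an equation of y, normalised to coefficients of value at most 1, to a nonzero polynomial
R over `k`; then w(R(y)) < 1. Since R splits over `k` and its leading coefficient has value 1, some
factor y - c has value below 1. -/
theorem exists_residue_of_isAlgebraic {k : Type} [Field k] [IsAlgClosed k] (i : k →+* H)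
    {v : Valuation H Γ} (hi : ∀ c, c ≠ 0 → v (i c) = 1)
    (hres : ∀ h, v h ≤ 1 → ∃ c, v (h - i c) < 1) {w : Valuation X Γ'} (hw : Extends v w) {y : X}
    (hy : IsAlgebraic H y) (hy1 : w y ≤ 1) : ∃ c, w (y - algebraMap H X (i c)) < 1 := by
  classical
  obtain ⟨p, hp, hpy⟩ := hy
  obtain ⟨j, hj, hmax⟩ := p.support.exists_max_image
    (fun i => v (p.coeff i)) (Polynomial.support_nonempty.2 hp)
  have hj0 := Polynomial.mem_support_iff.1 hj
  have hvj : 0 < v (p.coeff j) := by simpa [zero_lt_iff] using hj0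
  let a : ℕ → H := fun l => p.coeff l / p.coeff j
  have ha : ∀ l, v (a l) ≤ 1 := by
    intro l
    rw [map_div₀, div_le_one₀ hvj]
    by_cases hl : l ∈ p.support
    · exact hmax l hl
    · rw [Polynomial.notMem_support_iff.1 hl, map_zero]
      exact zero_le
  choose c hc using fun l => hres (a l) (ha l)
  let R : Polynomial k := ∑ l ∈ p.support, Polynomial.monomial l (c l)
  let ψ : k →+* X := (algebraMap H X).comp i
  have hR : R ≠ 0 := by
    intro h
    have h1 := congrArg (fun q => Polynomial.coeff q j) h
    simp only [R, Polynomial.finsetSum_coeff, Polynomial.coeff_monomial, Finset.sum_ite_eq', hj,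
      if_true, Polynomial.coeff_zero] at h1
    have h2 := hc j
    rw [h1, map_zero, sub_zero] at h2
    simp [a, div_self hj0] at h2
  have hRy : w (R.eval₂ ψ y) < 1 := by
    have h1 : ∑ l ∈ p.support, algebraMap H X (a l) * y ^ l = 0 := by
      rw [Polynomial.aeval_def, Polynomial.eval₂_eq_sum, Polynomial.sum_def] at hpy
      have : ∑ l ∈ p.support, algebraMap H X (a l) * y ^ l =
          (∑ l ∈ p.support, algebraMap H X (p.coeff l) * y ^ l) / algebraMap H X (p.coeff j) := by
        rw [Finset.sum_div]
        refine Finset.sum_congr rfl fun l _ => ?_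
        rw [map_div₀]
        ring
      rw [this, hpy, zero_div]
    have h2 : R.eval₂ ψ y = -∑ l ∈ p.support, algebraMap H X (a l - i (c l)) * y ^ l := by
      simp only [R, Polynomial.eval₂_finsetSum, Polynomial.eval₂_monomial, map_sub, sub_mul,
        Finset.sum_sub_distrib, h1, zero_sub, neg_neg]
      rfl
    rw [h2, Valuation.map_neg]
    refine w.map_sum_lt one_ne_zero fun l _ => ?_
    rw [map_mul, map_pow]
    have h3 : w (algebraMap H X (a l - i (c l))) < 1 := by
      have := (hw.lt_iff (a l - i (c l)) 1).2 (by simpa using hc l)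
      simpa using this
    exact mul_lt_one_of_lt_of_le h3 (pow_le_one' hy1 l)
  by_contra hcon
  push Not at hcon
  have hsplit := IsAlgClosed.splits R
  have h4 : R.eval₂ ψ y = ψ R.leadingCoeff * (R.roots.map fun c => y - ψ c).prod := by
    conv_lhs => rw [hsplit.eq_prod_roots]
    rw [Polynomial.eval₂_mul, Polynomial.eval₂_C, Polynomial.eval₂_multiset_prod, Multiset.map_map]
    simp
  rw [h4, map_mul, map_multiset_prod, Multiset.map_map] at hRy
  refine absurd hRy (not_lt.2 ?_)
  have h5 : w (ψ R.leadingCoeff) = 1 := by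
    have := (hw.eq_iff (i R.leadingCoeff) 1).2
      (by rw [hi _ (Polynomial.leadingCoeff_ne_zero.2 hR), map_one])
    rwa [map_one, map_one] at this
  rw [h5, one_mul]
  refine Multiset.one_le_prod_of_one_le ?_
  intro z hz
  obtain ⟨c, -, rfl⟩ := Multiset.mem_map.1 hz
  exact hcon c

/-- A spherically complete field with divisible value group and algebraically closed residue field
is algebraically closed. -/
theorem IsSphericallyComplete.isAlgClosed {v : Valuation H Γ} (hv : IsSphericallyComplete v)
    (hdiv : ∀ (h : H) (n : ℕ), n ≠ 0 → ∃ h', v h' ^ n = v h)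
    {k : Type} [Field k] [IsAlgClosed k] (i : k →+* H) (hi : ∀ c, c ≠ 0 → v (i c) = 1)
    (hres : ∀ h, v h ≤ 1 → ∃ c, v (h - i c) < 1) : IsAlgClosed H := by
  let X := AlgebraicClosure H
  obtain ⟨V, hw⟩ := exists_extends (X := X) v
  let w := V.valuation
  have hval : ∀ x : X, ∃ h, w x = w (algebraMap H X h) := by
    intro x
    by_cases hx0 : x = 0
    · exact ⟨0, by rw [hx0, map_zero, map_zero, map_zero]⟩
    obtain ⟨n, h, hn, -, hx⟩ := exists_pow_eq_of_isAlgebraic w (Algebra.IsAlgebraic.isAlgebraic (R := H) x) hx0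
    obtain ⟨h', hh'⟩ := hdiv h n hn
    refine ⟨h', ?_⟩
    have h1 : w (algebraMap H X (h' ^ n)) = w (algebraMap H X h) :=
      (hw.eq_iff _ _).2 (by rw [map_pow, hh'])
    rw [map_pow, map_pow, ← hx] at h1
    exact ((pow_left_inj₀ zero_le zero_le hn).1 h1).symm
  -- The algebraic closure is an immediate extension: values agree by divisibility and residues by
  -- algebraic closedness, so any nonzero x can be improved by an element of `H`. Applied to the
  -- error of a best approximation from `H`, this forces the error to be zero.
  have himm : ∀ x : X, x ≠ 0 → ∃ h, w (x - algebraMap H X h) < w x := by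
    intro x hx0
    obtain ⟨h, hh⟩ := hval x
    have hwx : w x ≠ 0 := by simpa using hx0
    have hh0 : algebraMap H X h ≠ 0 := by
      rw [hh] at hwx
      simpa using hwx
    obtain ⟨c, hc⟩ := exists_residue_of_isAlgebraic i hi hres hw
      (Algebra.IsAlgebraic.isAlgebraic (R := H) (x / algebraMap H X h))
      (by rw [map_div₀, hh, div_self (by rwa [← hh])])
    refine ⟨h * i c, ?_⟩
    have : x - algebraMap H X (h * i c) = (x / algebraMap H X h - algebraMap H X (i c)) *
        algebraMap H X h := by
      rw [map_mul, sub_mul, div_mul_cancel₀ _ hh0, mul_comm]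
    rw [this, map_mul, hh]
    exact mul_lt_of_lt_one_left (by rw [← hh]; exact zero_lt_iff.2 hwx) hc
  have hsurj : Function.Surjective (algebraMap H X) := by
    intro x
    obtain ⟨y, hy⟩ := hv.exists_best hw (isOrthonormalFor_one w) x fun a => hval _
    simp only [Finset.univ_unique, Finset.sum_singleton, Algebra.smul_def, mul_one] at hy
    refine ⟨y default, ?_⟩
    by_contra hne
    obtain ⟨h, hh⟩ := himm (x - algebraMap H X (y default)) (by
      rw [ne_eq, sub_eq_zero]
      exact fun h => hne h.symm)
    refine absurd (hy fun _ => y default + h) (not_le.2 ?_)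
    rw [map_add, ← sub_sub]
    exact hh
  exact IsAlgClosed.of_ringEquiv X H
    (RingEquiv.ofBijective (algebraMap H X) ⟨(algebraMap H X).injective, hsurj⟩).symm

end SphericallyComplete

/-! ### Hahn series with rational exponents -/

section Hahn

variable {k k' : Type} [Field k] [Field k']

/-- The value group of fields of Hahn series with rational exponents. -/
abbrev RatValue : Type := Multiplicative (WithTop ℚ)ᵒᵈ

/-- The valuation of the field of Hahn series. -/
noncomputable def hahnValuation (k : Type) [Field k] : Valuation (HahnSeries ℚ k) RatValue :=
  AddValuation.toValuation (HahnSeries.addVal ℚ k)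

/-- The value group `RatValue` does not depend on the coefficient field, so values from two fields
of Hahn series are compared directly. -/
theorem hahnValuation_le_iff (x : HahnSeries ℚ k) (y : HahnSeries ℚ k') :
    hahnValuation k x ≤ hahnValuation k' y ↔ y.orderTop ≤ x.orderTop := Iff.rfl

theorem hahnValuation_eq_iff (x : HahnSeries ℚ k) (y : HahnSeries ℚ k') :
    hahnValuation k x = hahnValuation k' y ↔ y.orderTop = x.orderTop := by
  rw [le_antisymm_iff, le_antisymm_iff, hahnValuation_le_iff, hahnValuation_le_iff]

theorem hahnValuation_le_iff_coeff (x : HahnSeries ℚ k) {y : HahnSeries ℚ k'} (hy : y ≠ 0) :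
    hahnValuation k x ≤ hahnValuation k' y ↔ ∀ q < y.order, x.coeff q = 0 := by
  rw [hahnValuation_le_iff, HahnSeries.le_orderTop_iff_forall]
  simp only [← HahnSeries.order_eq_orderTop_of_ne_zero hy, WithTop.coe_lt_coe]

theorem hahnValuation_lt_one_iff (x : HahnSeries ℚ k) :
    hahnValuation k x < 1 ↔ ∀ q ≤ 0, x.coeff q = 0 := by
  rw [← not_le, ← map_one (hahnValuation k), hahnValuation_le_iff, HahnSeries.orderTop_one,
    not_le]
  constructor
  · intro h q hq
    exact HahnSeries.coeff_eq_zero_of_lt_orderTop (lt_of_le_of_lt (by exact_mod_cast hq) h)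
  · intro h
    by_contra hcon
    have hx : x ≠ 0 := by
      rintro rfl
      simp at hcon
    rw [← HahnSeries.order_eq_orderTop_of_ne_zero hx] at hcon
    have h1 : x.order ≤ 0 := by
      have := not_lt.1 hcon
      exact_mod_cast this
    exact hx (HahnSeries.coeff_order_eq_zero.1 (h _ h1))

theorem hahnValuation_le_one_iff (x : HahnSeries ℚ k) :
    hahnValuation k x ≤ 1 ↔ ∀ q < 0, x.coeff q = 0 := by
  rw [← map_one (hahnValuation k), hahnValuation_le_iff_coeff x one_ne_zero, HahnSeries.order_one]

/-- A ball fixes the coefficients below the order of its radius, and balls meeting pairwise agree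
where both do so; the common point glues these coefficients and is 0 elsewhere. A ball of radius
zero is treated first, as then its centre is the answer. -/
theorem isSphericallyComplete_hahn : IsSphericallyComplete (hahnValuation k) := by
  classical
  intro ι a h hah
  by_cases h0 : ∃ i, h i = 0
  · obtain ⟨i, hi⟩ := h0
    refine ⟨a i, fun j => (hah i j).trans ?_⟩
    rw [hi, map_zero, max_eq_right zero_le]
  push Not at h0
  have hcoeff : ∀ i j q, q < (h i).order → q < (h j).order → (a i).coeff q = (a j).coeff q := by
    intro i j q hi hj
    rw [← sub_eq_zero, ← HahnSeries.coeff_sub]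
    rcases le_total (hahnValuation k (h i)) (hahnValuation k (h j)) with hle | hle
    · have := hah i j
      rw [max_eq_right hle, hahnValuation_le_iff_coeff _ (h0 j)] at this
      exact this q hj
    · have := hah i j
      rw [max_eq_left hle, hahnValuation_le_iff_coeff _ (h0 i)] at this
      exact this q hi
  let c : ℚ → k := fun q => if hq : ∃ i, q < (h i).order then (a hq.choose).coeff q else 0
  have hc : ∀ i q, q < (h i).order → c q = (a i).coeff q := by
    intro i q hi
    have hq : ∃ i, q < (h i).order := ⟨i, hi⟩
    simp only [c, dif_pos hq]
    exact hcoeff _ _ _ hq.choose_spec hi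
  have hpwo : (Function.support c).IsPWO := by
    -- A descending sequence in the glued support stays below the order of one radius, hence lies in
    -- the support of a single centre.
    rw [Set.isPWO_iff_isWF, Set.isWF_iff_no_descending_seq]
    intro f hf hmem
    have h1 : ∃ i, f 0 < (h i).order := by
      by_contra hcon
      have := hmem 0
      rw [Function.mem_support] at this
      simp only [c, dif_neg hcon] at this
      exact this rfl
    obtain ⟨i, hi⟩ := h1
    have hwf := (a i).isWF_support
    rw [Set.isWF_iff_no_descending_seq] at hwf
    refine hwf f hf fun n => ?_
    have h2 := hmem n
    rw [Function.mem_support, hc i (f n) ((hf.antitone (Nat.zero_le n)).trans_lt hi)] at h2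
    exact h2
  refine ⟨⟨c, hpwo⟩, fun i => ?_⟩
  rw [hahnValuation_le_iff_coeff _ (h0 i)]
  intro q hq
  rw [HahnSeries.coeff_sub, sub_eq_zero]
  exact hc i q hq

theorem exists_pow_hahnValuation (h : HahnSeries ℚ k) (n : ℕ) (hn : n ≠ 0) :
    ∃ h' : HahnSeries ℚ k, hahnValuation k h' ^ n = hahnValuation k h := by
  by_cases h0 : h = 0
  · exact ⟨0, by rw [h0, map_zero, zero_pow hn]⟩
  refine ⟨HahnSeries.single (h.order / n) 1, ?_⟩
  rw [← map_pow, HahnSeries.single_pow, hahnValuation_eq_iff, one_pow, nsmul_eq_mul,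
    mul_div_cancel₀ _ (by exact_mod_cast hn), HahnSeries.orderTop_single one_ne_zero,
    HahnSeries.order_eq_orderTop_of_ne_zero h0]

theorem hahnValuation_C {c : k} (hc : c ≠ 0) : hahnValuation k (HahnSeries.C c) = 1 := by
  rw [← map_one (hahnValuation k), hahnValuation_eq_iff, HahnSeries.C_apply,
    HahnSeries.orderTop_single hc, HahnSeries.orderTop_one]
  rfl

theorem exists_residue_hahn (h : HahnSeries ℚ k) (hh : hahnValuation k h ≤ 1) :
    ∃ c, hahnValuation k (h - HahnSeries.C c) < 1 := by
  refine ⟨h.coeff 0, (hahnValuation_lt_one_iff _).2 fun q hq => ?_⟩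
  rw [HahnSeries.coeff_sub, HahnSeries.C_apply]
  rcases hq.lt_or_eq with hq | rfl
  · rw [(hahnValuation_le_one_iff h).1 hh q hq, HahnSeries.coeff_single_of_ne hq.ne, sub_zero]
  · rw [HahnSeries.coeff_single_same, sub_self]

theorem isAlgClosed_hahn [IsAlgClosed k] : IsAlgClosed (HahnSeries ℚ k) :=
  isSphericallyComplete_hahn.isAlgClosed exists_pow_hahnValuation HahnSeries.C
    (fun _ => hahnValuation_C) exists_residue_hahn

theorem charZero_hahn [CharZero k] : CharZero (HahnSeries ℚ k) :=
  (HahnSeries.C (Γ := ℚ) (R := k)).charZero_iff HahnSeries.C_injective |>.1 inferInstance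

/-- Coefficientwise extension of a homomorphism to Hahn series. -/
noncomputable def hahnMap (f : k →+* k') : HahnSeries ℚ k →+* HahnSeries ℚ k' where
  toFun x := x.map (f : k →ₙ+* k')
  map_one' := by
    ext q
    rw [HahnSeries.map_coeff, HahnSeries.coeff_one, HahnSeries.coeff_one]
    split_ifs
    · exact f.map_one
    · exact f.map_zero
  map_mul' x y := HahnSeries.map_mul (f : k →ₙ+* k')
  map_zero' := by
    ext q
    simp
  map_add' x y := by
    ext q
    simp

theorem coeff_hahnMap (f : k →+* k') (x : HahnSeries ℚ k) (q : ℚ) :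
    (hahnMap f x).coeff q = f (x.coeff q) := rfl

theorem order_hahnMap (f : k →+* k') (x : HahnSeries ℚ k) :
    (hahnMap f x).orderTop = x.orderTop := by
  refine le_antisymm ?_ ?_ <;> rw [HahnSeries.le_orderTop_iff_forall] <;> intro q hq
  · have := HahnSeries.coeff_eq_zero_of_lt_orderTop hq
    rwa [coeff_hahnMap, map_eq_zero] at this
  · rw [coeff_hahnMap, HahnSeries.coeff_eq_zero_of_lt_orderTop hq, map_zero]

theorem hahnValuation_hahnMap (f : k →+* k') (x : HahnSeries ℚ k) :
    hahnValuation k' (hahnMap f x) = hahnValuation k x := by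
  rw [hahnValuation_eq_iff, order_hahnMap]

theorem coeff_sum_hahnMap_mul_C (f : k →+* k') {ι : Type} (s : Finset ι) (x : ι → k')
    (a : ι → HahnSeries ℚ k) (q : ℚ) :
    (∑ i ∈ s, hahnMap f (a i) * HahnSeries.C (x i)).coeff q = ∑ i ∈ s, f ((a i).coeff q) * x i := by
  rw [HahnSeries.coeff_sum]
  refine Finset.sum_congr rfl fun i _ => ?_
  rw [mul_comm, HahnSeries.C_mul_eq_smul, HahnSeries.coeff_smul, smul_eq_mul, coeff_hahnMap,
    mul_comm]

/-- Linearly independent constants are orthonormal. -/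
theorem hahnValuation_sum_le_iff [Algebra k k'] {ι : Type} [Fintype ι] {x : ι → k'}
    (hx : LinearIndependent k x) (a : ι → HahnSeries ℚ k) (h : HahnSeries ℚ k) :
    hahnValuation k' (∑ i, hahnMap (algebraMap k k') (a i) * HahnSeries.C (x i)) ≤
        hahnValuation k h ↔ ∀ i, hahnValuation k (a i) ≤ hahnValuation k h := by
  simp only [hahnValuation_le_iff, HahnSeries.le_orderTop_iff_forall, coeff_sum_hahnMap_mul_C]
  constructor
  · intro h1 i q hq
    refine Fintype.linearIndependent_iff.1 hx (fun i => (a i).coeff q) ?_ i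
    simpa only [Algebra.smul_def] using h1 q hq
  · intro h1 q hq
    refine Finset.sum_eq_zero fun i _ => ?_
    rw [h1 i q hq, map_zero, zero_mul]

/-- Algebraically independent constants remain algebraically independent over Hahn series. -/
theorem algebraicIndependent_C [Algebra k k'] {ι : Type} {τ : ι → k'}
    (hτ : AlgebraicIndependent k τ) :
    letI := (hahnMap (algebraMap k k')).toAlgebra
    AlgebraicIndependent (HahnSeries ℚ k) fun i => HahnSeries.C (Γ := ℚ) (τ i) := by
  classical
  let := (hahnMap (algebraMap k k')).toAlgebra
  rw [algebraicIndependent_iff]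
  intro p hp
  refine MvPolynomial.ext _ _ fun m => ?_
  rw [MvPolynomial.coeff_zero]
  by_contra hm
  have h1 : ∀ m : ι →₀ ℕ, MvPolynomial.aeval (fun i => HahnSeries.C (Γ := ℚ) (τ i))
      (MvPolynomial.monomial m (MvPolynomial.coeff m p)) =
      hahnMap (algebraMap k k') (MvPolynomial.coeff m p) *
        HahnSeries.C (MvPolynomial.aeval τ (MvPolynomial.monomial m (1 : k))) := by
    intro m
    rw [MvPolynomial.aeval_monomial, MvPolynomial.aeval_monomial, map_one, one_mul,
      map_finsuppProd]
    simp only [map_pow]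
    rfl
  rw [p.as_sum, map_sum] at hp
  simp only [h1] at hp
  obtain ⟨q, hq⟩ : ∃ q, (MvPolynomial.coeff m p).coeff q ≠ 0 := by
    by_contra hcon
    push Not at hcon
    exact hm (HahnSeries.ext (funext hcon))
  -- The coefficients at exponent q of the relation form a polynomial relation over `k` among the
  -- τᵢ, nontrivial by the choice of q.
  have h2 := congrArg (fun x => HahnSeries.coeff x q) hp
  simp only [coeff_sum_hahnMap_mul_C, HahnSeries.coeff_zero] at h2
  have h3 : MvPolynomial.aeval τ (∑ m ∈ p.support,
      MvPolynomial.monomial m ((MvPolynomial.coeff m p).coeff q)) = 0 := by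
    rw [map_sum, ← h2]
    refine Finset.sum_congr rfl fun m _ => ?_
    rw [MvPolynomial.aeval_monomial, MvPolynomial.aeval_monomial, map_one, one_mul]
  have h4 := (injective_iff_map_eq_zero _).1 hτ _ h3
  have h5 := congrArg (MvPolynomial.coeff m) h4
  have hmem : m ∈ p.support := MvPolynomial.mem_support_iff.2 hm
  simp only [MvPolynomial.coeff_sum, MvPolynomial.coeff_monomial, Finset.sum_ite_eq', hmem, if_true,
    MvPolynomial.coeff_zero] at h5
  exact hq h5

end Hahn

/-! ### Orthonormal bases -/

section Orthonormal

variable {H X Γ Γ' : Type} [Field H] [Field X] [Algebra H X] [LinearOrderedCommGroupWithZero Γ]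
  [LinearOrderedCommGroupWithZero Γ']

/-- When every value is attained on `H`, testing against all elements of `H` is the same as testing
a sum against its own value, so orthonormality becomes one upper bound on the members and one lower
bound on the sums. -/
theorem isOrthonormalFor_iff {w : Valuation X Γ'}
    (hval : ∀ x, ∃ h, w x = w (algebraMap H X h)) {ι : Type} [Fintype ι] {e : ι → X} :
    IsOrthonormalFor H w e ↔ (∀ i, w (e i) ≤ 1) ∧
      ∀ (a : ι → H) i, w (algebraMap H X (a i)) ≤ w (∑ i, a i • e i) := by
  classical
  constructor
  · intro he
    refine ⟨fun i => ?_, fun a i => ?_⟩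
    · have := (he (Pi.single i 1) 1).2 fun j => by
        by_cases hj : j = i
        · subst hj
          rw [Pi.single_eq_same]
        · rw [Pi.single_eq_of_ne hj, map_zero, map_zero]
          exact zero_le
      rw [Finset.sum_eq_single i (fun j _ hj => by rw [Pi.single_eq_of_ne hj, zero_smul])
        (fun h => absurd (Finset.mem_univ i) h), Pi.single_eq_same, one_smul, map_one,
        map_one] at this
      exact this
    · obtain ⟨h, hh⟩ := hval (∑ i, a i • e i)
      rw [hh]
      exact (he a h).1 hh.le i
  · rintro ⟨h1, h2⟩ a h
    refine ⟨fun h3 i => (h2 a i).trans h3, fun h3 => w.map_sum_le fun i _ => ?_⟩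
    rw [Algebra.smul_def, map_mul]
    exact (mul_le_of_le_one_right' (h1 i)).trans (h3 i)

theorem IsOrthonormalFor.linearIndependent {w : Valuation X Γ'} {ι : Type} [Fintype ι] {e : ι → X}
    (he : IsOrthonormalFor H w e) : LinearIndependent H e := by
  rw [Fintype.linearIndependent_iff]
  intro a ha i
  have := (he a 0).1 (by rw [ha, map_zero]; exact zero_le) i
  rw [map_zero, map_zero, le_zero_iff, map_eq_zero, map_eq_zero] at this
  exact this

/-- Gram–Schmidt with best approximation in place of orthogonal projection: subtract from the last
vector a best approximation by the earlier ones and scale the error to value 1. -/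
theorem IsSphericallyComplete.exists_orthonormal {v : Valuation H Γ} (hv : IsSphericallyComplete v)
    {w : Valuation X Γ'} (hw : Extends v w) (hval : ∀ x, ∃ h, w x = w (algebraMap H X h)) {m : ℕ}
    (u : Fin m → X) (hu : LinearIndependent H u) :
    ∃ e : Fin m → X, IsOrthonormalFor H w e ∧ ∀ j, e j ∈ Submodule.span H (Set.range u) := by
  induction m with
  | zero =>
    refine ⟨u, fun a h => ?_, fun j => j.elim0⟩
    simp
  | succ m ih =>
    rw [linearIndependent_finSucc'] at hu
    obtain ⟨e, he, hspan⟩ := ih _ hu.1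
    have hle : Submodule.span H (Set.range (Fin.init u)) ≤ Submodule.span H (Set.range u) :=
      Submodule.span_mono (by rintro _ ⟨i, rfl⟩; exact ⟨_, rfl⟩)
    obtain ⟨y, hy⟩ := hv.exists_best hw he (u (Fin.last m)) fun a => hval _
    let z := u (Fin.last m) - ∑ i, y i • e i
    have hmem : ∑ i, y i • e i ∈ Submodule.span H (Set.range (Fin.init u)) :=
      Submodule.sum_mem _ fun i _ => Submodule.smul_mem _ _ (hspan i)
    have hz : z ≠ 0 := by
      intro h0
      apply hu.2
      rw [sub_eq_zero.1 h0]
      exact hmem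
    have hzmem : z ∈ Submodule.span H (Set.range u) :=
      Submodule.sub_mem _ (Submodule.subset_span ⟨_, rfl⟩) (hle hmem)
    obtain ⟨h, hh⟩ := hval z
    have hwz : w z ≠ 0 := by simpa using hz
    have hh0 : algebraMap H X h ≠ 0 := by
      rw [hh] at hwz
      simpa using hwz
    have hz1 : w (h⁻¹ • z) = 1 := by
      rw [Algebra.smul_def, map_mul, map_inv₀, map_inv₀, hh, inv_mul_cancel₀ (by rwa [← hh])]
    obtain ⟨he1, he2⟩ := (isOrthonormalFor_iff hval).1 he
    refine ⟨Fin.snoc e (h⁻¹ • z), (isOrthonormalFor_iff hval).2 ⟨fun i => ?_, fun a => ?_⟩,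
      fun j => ?_⟩
    · refine Fin.lastCases ?_ (fun i => ?_) i
      · rw [Fin.snoc_last]
        exact hz1.le
      · rw [Fin.snoc_castSucc]
        exact he1 i
    · rw [Fin.sum_univ_castSucc]
      simp only [Fin.snoc_castSucc, Fin.snoc_last]
      have hlast : w (algebraMap H X (a (Fin.last m))) ≤
          w (∑ i : Fin m, a i.castSucc • e i + a (Fin.last m) • h⁻¹ • z) := by
        by_cases ha : a (Fin.last m) = 0
        · rw [ha, map_zero, map_zero]
          exact zero_le
        -- Minimality of the error z, tested against this competitor, says that adding to z any
        -- combination of the earlier vectors does not lower its value.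
        have h1 := hy fun i => y i - (h / a (Fin.last m)) * a i.castSucc
        have h2 : u (Fin.last m) - ∑ i, (y i - (h / a (Fin.last m)) * a i.castSucc) • e i =
            z + (h / a (Fin.last m)) • ∑ i : Fin m, a i.castSucc • e i := by
          simp only [sub_smul, Finset.sum_sub_distrib, mul_smul, ← Finset.smul_sum, z]
          ring
        have hh0' : h ≠ 0 := fun h0 => hh0 (by rw [h0, map_zero])
        have h3 : ∑ i : Fin m, a i.castSucc • e i + a (Fin.last m) • h⁻¹ • z =
            (a (Fin.last m) / h) • (z + (h / a (Fin.last m)) • ∑ i : Fin m, a i.castSucc • e i) := by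
          rw [smul_add, smul_smul, smul_smul, div_mul_div_cancel₀' ha, div_self hh0', one_smul,
            add_comm, div_eq_mul_inv]
        rw [h3, Algebra.smul_def, map_mul, map_div₀, map_div₀, ← hh]
        rw [h2] at h1
        calc w (algebraMap H X (a (Fin.last m))) =
            w (algebraMap H X (a (Fin.last m))) / w z * w z := by rw [div_mul_cancel₀ _ hwz]
          _ ≤ _ := mul_le_mul_right h1 _
      have hrest : w (∑ i : Fin m, a i.castSucc • e i) ≤
          w (∑ i : Fin m, a i.castSucc • e i + a (Fin.last m) • h⁻¹ • z) := by
        have h1 : ∑ i : Fin m, a i.castSucc • e i =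
            (∑ i : Fin m, a i.castSucc • e i + a (Fin.last m) • h⁻¹ • z) -
              a (Fin.last m) • h⁻¹ • z := (add_sub_cancel_right _ _).symm
        conv_lhs => rw [h1]
        refine (w.map_sub _ _).trans (max_le le_rfl ?_)
        rw [Algebra.smul_def (a (Fin.last m)), map_mul, hz1, mul_one, ← Algebra.smul_def]
        exact hlast
      refine fun i => Fin.lastCases hlast (fun i => ?_) i
      exact (he2 (fun i => a i.castSucc) i).trans hrest
    · refine Fin.lastCases ?_ (fun i => ?_) j
      · rw [Fin.snoc_last]
        exact Submodule.smul_mem _ _ hzmem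
      · rw [Fin.snoc_castSucc]
        exact hle (hspan i)

/-- A small perturbation of an orthonormal family is orthonormal. -/
theorem IsOrthonormalFor.perturb {w : Valuation X Γ'}
    (hval : ∀ x, ∃ h, w x = w (algebraMap H X h)) {ι : Type} [Fintype ι] {e e' : ι → X}
    (he : IsOrthonormalFor H w e) (h : ∀ i, w (e i - e' i) < 1) : IsOrthonormalFor H w e' := by
  classical
  obtain ⟨h1, h2⟩ := (isOrthonormalFor_iff hval).1 he
  refine (isOrthonormalFor_iff hval).2 ⟨fun i => ?_, fun a i => ?_⟩
  · have : e' i = e i - (e i - e' i) := by ring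
    rw [this]
    exact (w.map_sub _ _).trans (max_le (h1 i) (h i).le)
  · obtain ⟨j, -, hj⟩ := Finset.exists_max_image Finset.univ (fun i => w (algebraMap H X (a i)))
      ⟨i, Finset.mem_univ i⟩
    refine (hj i (Finset.mem_univ i)).trans ?_
    by_cases h0 : w (algebraMap H X (a j)) = 0
    · rw [h0]
      exact zero_le
    have h3 : w (∑ i, a i • (e i - e' i)) < w (algebraMap H X (a j)) := by
      refine w.map_sum_lt h0 fun l _ => ?_
      rw [Algebra.smul_def, map_mul]
      refine lt_of_le_of_lt (mul_le_mul_left (hj l (Finset.mem_univ l)) _) ?_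
      exact mul_lt_of_lt_one_right (zero_lt_iff.2 h0) (h l)
    have h4 : ∑ i, a i • e i = ∑ i, a i • e' i + ∑ i, a i • (e i - e' i) := by
      rw [← Finset.sum_add_distrib]
      refine Finset.sum_congr rfl fun i _ => ?_
      rw [← smul_add, add_sub_cancel]
    have h5 := h2 a j
    rw [h4] at h5
    exact (le_max_iff.1 (h5.trans (w.map_add _ _))).resolve_right (not_le.2 h3)

/-- The elements of `H` that are limits of elements of `K`. -/
def Approximable (K : Type) [Field K] [Algebra K H] (v : Valuation H Γ) (x : H) : Prop :=
  ∀ δ, δ ≠ 0 → ∃ a : K, v (x - algebraMap K H a) < v δ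

/-- Orthonormal bases defined over a dense subfield. -/
theorem IsSphericallyComplete.exists_orthonormal_of_dense {K : Type} [Field K] [Algebra K H]
    [Algebra K X] [IsScalarTower K H X] {v : Valuation H Γ} (hv : IsSphericallyComplete v)
    (hK : ∀ x, Approximable K v x)
    {w : Valuation X Γ'} (hw : Extends v w) (hval : ∀ x, ∃ h, w x = w (algebraMap H X h)) {m : ℕ}
    (u : Fin m → X) (hu : LinearIndependent H u) :
    ∃ e : Fin m → X, IsOrthonormalFor H w e ∧
      Submodule.span K (Set.range e) = Submodule.span K (Set.range u) := by
  obtain ⟨e, he, hspan⟩ := hv.exists_orthonormal hw hval u hu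
  have hspan' : ∀ j, ∃ c : Fin m → H, ∑ i, c i • u i = e j := fun j =>
    (Submodule.mem_span_range_iff_exists_fun H).1 (hspan j)
  choose c hc using hspan'
  -- The coordinates of e with respect to u are approximated in `K` closely enough that e moves by
  -- less than 1, which preserves orthonormality. The new family lies in the `K`-span of u and is
  -- independent, so it spans it by dimension.
  have happ : ∀ i j, ∃ a : K, w (algebraMap H X (c j i - algebraMap K H a)) * w (u i) < 1 := by
    intro i j
    obtain ⟨g, hg⟩ := hval (u i)
    have hu0 : w (u i) ≠ 0 := by simpa using hu.ne_zero i
    have hg0 : algebraMap H X g ≠ 0 := by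
      rw [hg] at hu0
      simpa using hu0
    have hg0' : g ≠ 0 := fun h0 => hg0 (by rw [h0, map_zero])
    obtain ⟨a, ha⟩ := hK (c j i) g⁻¹ (inv_ne_zero hg0')
    refine ⟨a, ?_⟩
    rw [← hw.lt_iff, map_inv₀, map_inv₀, ← hg] at ha
    rwa [← lt_div_iff₀ (zero_lt_iff.2 hu0), one_div]
  choose a ha using happ
  let e' : Fin m → X := fun j => ∑ i, a i j • u i
  have he' : IsOrthonormalFor H w e' := by
    refine he.perturb hval fun j => ?_
    rw [← hc j, ← Finset.sum_sub_distrib]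
    refine w.map_sum_lt one_ne_zero fun i _ => ?_
    rw [← algebraMap_smul H (a i j) (u i), ← sub_smul, Algebra.smul_def, map_mul]
    exact ha i j
  refine ⟨e', he', ?_⟩
  have hli : LinearIndependent K e' := he'.linearIndependent.restrict_scalars' K
  have hli' : LinearIndependent K u := hu.restrict_scalars' K
  have hle : Submodule.span K (Set.range e') ≤ Submodule.span K (Set.range u) := by
    rw [Submodule.span_le]
    rintro _ ⟨j, rfl⟩
    exact Submodule.sum_mem _ fun i _ => Submodule.smul_mem _ _ (Submodule.subset_span ⟨i, rfl⟩)
  have : FiniteDimensional K (Submodule.span K (Set.range u)) :=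
    FiniteDimensional.span_of_finite K (Set.finite_range u)
  refine Submodule.eq_of_le_of_finrank_eq hle ?_
  rw [finrank_span_eq_card hli, finrank_span_eq_card hli']

end Orthonormal

/-! ### Dense algebraically closed subfields -/

section Dense

variable {K H Γ : Type} [Field K] [Field H] [Algebra K H] [LinearOrderedCommGroupWithZero Γ]

variable (K) in
/-- The ring of limits of elements of `K`. -/
def approximableSubring (v : Valuation H Γ) : Subring H where
  carrier := {x | Approximable K v x}
  zero_mem' δ hδ := ⟨0, by
    rw [map_zero, sub_zero, map_zero, zero_lt_iff]
    simpa using hδ⟩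
  one_mem' δ hδ := ⟨1, by
    rw [map_one, sub_self, map_zero, zero_lt_iff]
    simpa using hδ⟩
  add_mem' {x y} hx hy δ hδ := by
    obtain ⟨a, ha⟩ := hx δ hδ
    obtain ⟨b, hb⟩ := hy δ hδ
    refine ⟨a + b, ?_⟩
    rw [map_add, add_sub_add_comm]
    exact v.map_add_lt ha hb
  neg_mem' {x} hx δ hδ := by
    obtain ⟨a, ha⟩ := hx δ hδ
    refine ⟨-a, ?_⟩
    rwa [map_neg, ← neg_sub', Valuation.map_neg]
  mul_mem' {x y} hx hy δ hδ := by
    have hδ' : 0 < v δ := by simpa [zero_lt_iff] using hδ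
    have key : ∀ (x y : H), Approximable K v x → y ≠ 0 →
        ∃ a : K, v (x - algebraMap K H a) * v y < v δ := by
      intro x y hx hy
      obtain ⟨a, ha⟩ := hx (δ / y) (div_ne_zero hδ hy)
      have hy' : 0 < v y := by simpa [zero_lt_iff] using hy
      exact ⟨a, by rwa [map_div₀, lt_div_iff₀ hy'] at ha⟩
    have key' : ∀ (x y : H), Approximable K v x → ∃ a : K, v (x - algebraMap K H a) * v y < v δ := by
      intro x y hx
      by_cases hy : y = 0
      · exact ⟨0, by rwa [hy, map_zero v, mul_zero]⟩
      · exact key x y hx hy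
    obtain ⟨a, ha⟩ := key' x y hx
    obtain ⟨b, hb⟩ := key' y (algebraMap K H a) hy
    refine ⟨a * b, ?_⟩
    have : x * y - algebraMap K H (a * b) = (x - algebraMap K H a) * y +
        (y - algebraMap K H b) * algebraMap K H a := by
      rw [map_mul]
      ring
    rw [this]
    exact v.map_add_lt (by rwa [map_mul]) (by rwa [map_mul])

theorem approximable_algebraMap (v : Valuation H Γ) (a : K) :
    Approximable K v (algebraMap K H a) := fun δ hδ => ⟨a, by
  rw [sub_self, map_zero, zero_lt_iff]
  simpa using hδ⟩

/-- The completion of an algebraically closed field is relatively algebraically closed. -/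
theorem approximable_of_root [IsAlgClosed K] (v : Valuation H Γ) {p : Polynomial H} (hp : p ≠ 0)
    (hcoeff : ∀ i, Approximable K v (p.coeff i)) {x : H} (hx : p.eval x = 0) :
    Approximable K v x := by
  classical
  intro δ hδ
  let d := p.natDegree
  have hlead : p.coeff d ≠ 0 := Polynomial.leadingCoeff_ne_zero.2 hp
  have hvlead : 0 < v (p.coeff d) := by simpa [zero_lt_iff] using hlead
  have hvδ : 0 < v δ := by simpa [zero_lt_iff] using hδ
  -- Approximate p by q over `K` with a leading coefficient of the same value and with v(q(x)) <
  -- v(lead) · v(δ)^d. As q splits over `K`, this is impossible if every root stays at distance at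
  -- least v(δ) from x.
  have happ : ∀ i, ∃ a : K, v (p.coeff i - algebraMap K H a) < v (p.coeff d) ∧
      v ((p.coeff i - algebraMap K H a) * x ^ i) < v (p.coeff d) * v δ ^ d := by
    intro i
    have h1 : ∃ a : K, v (p.coeff i - algebraMap K H a) < v (p.coeff d) := hcoeff i _ hlead
    by_cases hxi : x ^ i = 0
    · obtain ⟨a, ha⟩ := h1
      refine ⟨a, ha, ?_⟩
      rw [hxi, mul_zero, map_zero]
      exact mul_pos hvlead (pow_pos hvδ _)
    · have hxi' : 0 < v (x ^ i) := by
        rw [zero_lt_iff, ne_eq, map_eq_zero]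
        exact hxi
      let δ' := p.coeff d * δ ^ d / x ^ i
      have hδ' : δ' ≠ 0 := div_ne_zero (mul_ne_zero hlead (pow_ne_zero _ hδ)) hxi
      have hδ1 : v δ' * v (x ^ i) = v (p.coeff d) * v δ ^ d := by
        rw [map_div₀, div_mul_cancel₀ _ hxi'.ne', map_mul, map_pow]
      rcases le_total (v δ') (v (p.coeff d)) with hle | hle
      · obtain ⟨a, ha⟩ := hcoeff i δ' hδ'
        refine ⟨a, ha.trans_le hle, ?_⟩
        rw [map_mul, ← hδ1]
        exact mul_lt_mul_of_pos_right ha hxi'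
      · obtain ⟨a, ha⟩ := h1
        refine ⟨a, ha, ?_⟩
        rw [map_mul, ← hδ1]
        exact mul_lt_mul_of_pos_right (ha.trans_le hle) hxi'
  choose a ha1 ha2 using happ
  let q : Polynomial K := ∑ i ∈ Finset.range (d + 1), Polynomial.monomial i (a i)
  have hqcoeff : ∀ i, q.coeff i = if i < d + 1 then a i else 0 := by
    intro i
    simp only [q, Polynomial.finsetSum_coeff, Polynomial.coeff_monomial, Finset.sum_ite_eq',
      Finset.mem_range]
  have had : v (algebraMap K H (a d)) = v (p.coeff d) := by
    have : algebraMap K H (a d) = p.coeff d - (p.coeff d - algebraMap K H (a d)) := by ring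
    rw [this, v.map_sub_eq_of_lt_left (ha1 d)]
  have had0 : a d ≠ 0 := by
    intro h0
    rw [h0, map_zero, map_zero] at had
    exact hvlead.ne had
  have hqd : q.natDegree = d := by
    refine le_antisymm (Polynomial.natDegree_le_iff_coeff_eq_zero.2 fun i hi => ?_)
      (Polynomial.le_natDegree_of_ne_zero ?_)
    · rw [hqcoeff, if_neg (by omega)]
    · rwa [hqcoeff, if_pos (by omega)]
  have hqlead : q.leadingCoeff = a d := by
    rw [Polynomial.leadingCoeff, hqd, hqcoeff, if_pos (by omega)]
  have hqx : v (q.eval₂ (algebraMap K H) x) < v (p.coeff d) * v δ ^ d := by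
    have h1 : q.eval₂ (algebraMap K H) x =
        -∑ i ∈ Finset.range (d + 1), (p.coeff i - algebraMap K H (a i)) * x ^ i := by
      rw [Polynomial.eval_eq_sum_range] at hx
      simp only [q, Polynomial.eval₂_finsetSum, Polynomial.eval₂_monomial, sub_mul,
        Finset.sum_sub_distrib, d, hx, zero_sub, neg_neg]
    rw [h1, Valuation.map_neg]
    exact v.map_sum_lt (mul_pos hvlead (pow_pos hvδ _)).ne' fun i _ => ha2 i
  by_contra hcon
  push Not at hcon
  have hsplit := IsAlgClosed.splits q
  have h4 : q.eval₂ (algebraMap K H) x =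
      algebraMap K H q.leadingCoeff * (q.roots.map fun c => x - algebraMap K H c).prod := by
    conv_lhs => rw [hsplit.eq_prod_roots]
    rw [Polynomial.eval₂_mul, Polynomial.eval₂_C, Polynomial.eval₂_multiset_prod, Multiset.map_map]
    simp
  rw [h4, map_mul, hqlead, had, map_multiset_prod, Multiset.map_map] at hqx
  have hcard : q.roots.card = d := by rw [← hqd, hsplit.natDegree_eq_card_roots]
  refine absurd hqx (not_lt.2 (mul_le_mul_right ?_ _))
  rw [← hcard]
  induction q.roots using Multiset.induction_on with
  | empty => simp
  | cons c s ih =>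
    rw [Multiset.card_cons, pow_succ', Multiset.map_cons, Multiset.prod_cons]
    exact mul_le_mul' (hcon c) ih

end Dense

/-! ### The base field -/

section BaseField

variable {H Γ : Type} [Field H] [LinearOrderedCommGroupWithZero Γ]

theorem Approximable.mono {v : Valuation H Γ} {F K : Subfield H} (hFK : F ≤ K) {x : H}
    (h : Approximable F v x) : Approximable K v x := by
  intro δ hδ
  obtain ⟨a, ha⟩ := h δ hδ
  exact ⟨⟨a, hFK a.2⟩, ha⟩

open scoped IntermediateField.algebraAdjoinAdjoin in
/-- A set that is dense in the sense of limits over a subfield stays so after removing a family of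
members of a transcendence basis. -/
theorem exists_dense_subfield [CharZero H] [IsAlgClosed H] (v : Valuation H Γ) (F : Subfield H)
    [Countable F] {P : Set H} (hP : ¬ P.Countable) (happ : ∀ x ∈ P, Approximable F v x)
    (ι : Type) [Countable ι] :
    ∃ K : Subfield H, F ≤ K ∧ IsAlgClosed K ∧ (∀ x, Approximable K v x) ∧
      ∃ α : ι → H, AlgebraicIndependent K α := by
  classical
  obtain ⟨B, hB⟩ := (AlgebraicIndependent.matroid F H).exists_isBasis P
  have hBind : AlgebraicIndepOn F id B :=
    AlgebraicIndependent.matroid_indep_iff.1 hB.indep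
  -- A finite `B` would put the uncountable set `P` inside the algebraic elements over a countable
  -- ring.
  have hBinf : Infinite B := by
    rw [← not_finite_iff_infinite]
    intro hfin
    have hBc : Countable (Algebra.adjoin F B) := by
      rw [← Cardinal.mk_le_aleph0_iff]
      refine (Algebra.cardinalMk_adjoin_le F B).trans ?_
      simp only [sup_le_iff, le_refl, and_true]
      exact ⟨Cardinal.mk_le_aleph0, Cardinal.mk_le_aleph0⟩
    refine hP ((Algebraic.countable (Algebra.adjoin F B) H).mono fun p hp => ?_)
    exact (AlgebraicIndependent.isAlgebraic_adjoin_iff_of_matroid_isBasis hB).2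
      (isAlgebraic_algebraMap (⟨p, Algebra.subset_adjoin hp⟩ : Algebra.adjoin F P))
  obtain ⟨e, he⟩ := exists_injective_nat ι
  let α : ι → H := fun i => (Infinite.natEmbedding B (e i) : B)
  have hα : Function.Injective α := fun i j hij =>
    he ((Infinite.natEmbedding B).injective (Subtype.ext hij))
  have hαB : ∀ i, α i ∈ B := fun i => (Infinite.natEmbedding B (e i)).2
  obtain ⟨T, hBT, hT⟩ := exists_isTranscendenceBasis_superset hBind
  let S : Set H := T \ Set.range α
  let F₀ := IntermediateField.adjoin F S
  let K := _root_.algebraicClosure F₀ H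
  have hSK : ∀ x ∈ S, x ∈ K := fun x hx => by
    have : x ∈ F₀ := IntermediateField.subset_adjoin F S hx
    exact K.algebraMap_mem (⟨x, this⟩ : F₀)
  have hFK : F ≤ K.toSubfield := fun x hx => by
    have : x ∈ F₀ := F₀.algebraMap_mem (⟨x, hx⟩ : F)
    exact K.algebraMap_mem (⟨x, this⟩ : F₀)
  have hKc : IsAlgClosed K := (algebraicClosure.isAlgClosure F₀ H).isAlgClosed
  -- `K` is the algebraic closure of `F` with all of `T` except the members of α. Those members are
  -- limits of `F`, so all of `T`, and then by `approximable_of_root` all of `H`, consists of limits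
  -- of `K`.
  have hKc' : IsAlgClosed K.toSubfield := hKc
  have hdense : ∀ x ∈ T, x ∈ approximableSubring K.toSubfield v := by
    intro x hx
    by_cases hxα : x ∈ Set.range α
    · obtain ⟨i, rfl⟩ := hxα
      exact (happ _ (hB.subset (hαB i))).mono hFK
    · exact approximable_algebraMap v (⟨x, hSK x ⟨hx, hxα⟩⟩ : K.toSubfield)
  refine ⟨K.toSubfield, hFK, hKc', fun x => ?_, α, ?_⟩
  · have halg := hT.isAlgebraic
    rw [Subtype.range_coe] at halg
    obtain ⟨p, hp, hpx⟩ := halg.isAlgebraic x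
    refine approximable_of_root v (p := p.map (algebraMap (Algebra.adjoin F T) H)) ?_ ?_ (x := x) ?_
    · rwa [Polynomial.map_ne_zero_iff Subtype.val_injective]
    · intro i
      rw [Polynomial.coeff_map]
      change _ ∈ approximableSubring K.toSubfield v
      have hle : ∀ y ∈ Algebra.adjoin F T, y ∈ approximableSubring K.toSubfield v := by
        intro y hy
        induction hy using Algebra.adjoin_induction with
        | mem y hy => exact hdense y hy
        | algebraMap r => exact approximable_algebraMap v (⟨r, hFK r.2⟩ : K.toSubfield)
        | add _ _ _ _ h1 h2 => exact add_mem h1 h2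
        | mul _ _ _ _ h1 h2 => exact mul_mem h1 h2
      exact hle _ (p.coeff i).2
    · rwa [Polynomial.eval_map_algebraMap]
  · have h1 := hT.1.adjoin_of_disjoint (s := {x : T | (x : H) ∉ Set.range α})
      (t := {x : T | (x : H) ∈ Set.range α}) (by
        rw [Set.disjoint_left]
        exact fun x hx hx' => hx hx')
    have himg : (Subtype.val '' {x : T | (x : H) ∉ Set.range α} : Set H) = S := by
      ext x
      simp [S, and_comm]
    rw [himg] at h1
    have h2 : AlgebraicIndependent (Algebra.adjoin F S) α :=
      h1.comp (fun i : ι => ⟨⟨α i, hBT (hαB i)⟩, i, rfl⟩) fun i j hij => hα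
        (congrArg (fun y => ((y : {x : T | (x : H) ∈ Set.range α}) : T).1) hij)
    have h3 : AlgebraicIndependent F₀ α := h2.extendScalars F₀
    exact h3.algebraicClosure

end BaseField

/-! ### A dense subfield of the field of Hahn series -/

section HahnBase

variable (k : Type) [Field k]

/-- The field generated by the uniformizer. -/
noncomputable def uniformizerField : Subfield (HahnSeries ℚ k) :=
  Subfield.closure {HahnSeries.single 1 1}

theorem countable_uniformizerField : Countable (uniformizerField k) := by
  rw [← Cardinal.mk_le_aleph0_iff]
  refine (Subfield.cardinalMk_closure_le_max _).trans ?_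
  simp

variable {k}

theorem hahnValuation_ofPowerSeries_le_one (f : PowerSeries k) :
    hahnValuation k (HahnSeries.ofPowerSeries ℚ k f) ≤ 1 := by
  rw [hahnValuation_le_one_iff]
  intro q hq
  rw [HahnSeries.ofPowerSeries_apply, HahnSeries.embDomain_of_notMem_range]
  rintro ⟨m, rfl⟩
  exact absurd hq (not_lt.2 (Nat.cast_nonneg (α := ℚ) m))

theorem hahnValuation_single_one_lt {N : ℕ} {δ : HahnSeries ℚ k} (hδ : δ ≠ 0)
    (hN : δ.order < N) : hahnValuation k (HahnSeries.single (N : ℚ) 1) < hahnValuation k δ := by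
  rw [← not_le, hahnValuation_le_iff, not_le, HahnSeries.orderTop_single one_ne_zero,
    ← HahnSeries.order_eq_orderTop_of_ne_zero hδ]
  exact_mod_cast hN

/-- The power series with coefficients `0` and `1`. -/
noncomputable def indicatorSeries (S : Set ℕ) : PowerSeries k :=
  open Classical in PowerSeries.mk fun i => if i ∈ S then 1 else 0

theorem indicatorSeries_injective : Function.Injective (indicatorSeries (k := k)) := by
  classical
  intro S S' h
  ext i
  have := congrArg (PowerSeries.coeff i) h
  rw [indicatorSeries, indicatorSeries, PowerSeries.coeff_mk, PowerSeries.coeff_mk] at this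
  by_cases h1 : i ∈ S <;> by_cases h2 : i ∈ S' <;> simp_all

theorem ofPowerSeries_mem_uniformizerField {p : Polynomial k}
    (hp : ∀ i, p.coeff i = 0 ∨ p.coeff i = 1) :
    HahnSeries.ofPowerSeries ℚ k p ∈ uniformizerField k := by
  have h1 : HahnSeries.ofPowerSeries ℚ k p =
      ((HahnSeries.ofPowerSeries ℚ k).comp Polynomial.coeToPowerSeries.ringHom) p := rfl
  rw [h1, p.as_sum_range_C_mul_X_pow, map_sum]
  refine sum_mem fun i _ => ?_
  rw [map_mul, map_pow]
  refine mul_mem ?_ (pow_mem ?_ _)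
  · rcases hp i with h | h <;> rw [h]
    · simp
    · simp
  · refine Subfield.subset_closure ?_
    simp

theorem hahnValuation_sub_trunc_lt (f : PowerSeries k) {N : ℕ} {δ : HahnSeries ℚ k} (hδ : δ ≠ 0)
    (hN : δ.order < N) :
    hahnValuation k (HahnSeries.ofPowerSeries ℚ k f - HahnSeries.ofPowerSeries ℚ k (f.trunc N)) <
      hahnValuation k δ := by
  have h := f.eq_X_pow_mul_shift_add_trunc N
  generalize (PowerSeries.mk fun i => PowerSeries.coeff (i + N) f) = g at h
  have h1 : f - (f.trunc N : PowerSeries k) = PowerSeries.X ^ N * g := sub_eq_of_eq_add h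
  rw [← map_sub, h1, map_mul, HahnSeries.ofPowerSeries_X_pow, map_mul]
  exact (mul_le_of_le_one_right' (hahnValuation_ofPowerSeries_le_one _)).trans_lt
    (hahnValuation_single_one_lt hδ hN)

/-- Truncations have coefficients 0 and 1, so they lie in the countable field generated by the
uniformizer whatever `k` is. They converge because integers are cofinal in the exponents. Subsets of
ℕ thus give uncountably many limits. -/
theorem approximable_indicatorSeries (S : Set ℕ) :
    Approximable (uniformizerField k) (hahnValuation k)
      (HahnSeries.ofPowerSeries ℚ k (indicatorSeries S)) := by
  classical
  intro δ hδ
  obtain ⟨N, hN⟩ := exists_nat_gt δ.order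
  have hmem := ofPowerSeries_mem_uniformizerField (p := (indicatorSeries (k := k) S).trunc N)
    fun i => by
      rw [PowerSeries.coeff_trunc, indicatorSeries, PowerSeries.coeff_mk]
      split_ifs <;> simp
  exact ⟨⟨_, hmem⟩, hahnValuation_sub_trunc_lt _ hδ hN⟩

variable (k) in
/-- The field of Hahn series has a dense algebraically closed subfield over which it has infinite
transcendence degree. -/
theorem exists_dense_subfield_hahn [IsAlgClosed k] [CharZero k] (ι : Type) [Countable ι] :
    ∃ K : Subfield (HahnSeries ℚ k), HahnSeries.single 1 1 ∈ K ∧ IsAlgClosed K ∧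
      (∀ x, Approximable K (hahnValuation k) x) ∧
      ∃ α : ι → HahnSeries ℚ k, AlgebraicIndependent K α := by
  have := countable_uniformizerField k
  have : IsAlgClosed (HahnSeries ℚ k) := isAlgClosed_hahn
  have : CharZero (HahnSeries ℚ k) := charZero_hahn
  have hP : ¬ (Set.range fun S => HahnSeries.ofPowerSeries ℚ k (indicatorSeries S)).Countable := by
    intro hc
    have hinj := (HahnSeries.ofPowerSeries_injective (Γ := ℚ)).comp
      (indicatorSeries_injective (k := k))
    have : Countable (Set ℕ) := Set.countable_univ_iff.1
      (Set.countable_of_injective_of_countable_image hinj.injOn (by rwa [Set.image_univ]))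
    obtain ⟨f, hf⟩ := exists_surjective_nat (Set ℕ)
    exact Function.cantor_surjective f hf
  obtain ⟨K, hFK, hK⟩ := exists_dense_subfield (hahnValuation k) (uniformizerField k) hP
    (by rintro _ ⟨S, rfl⟩; exact approximable_indicatorSeries S) ι
  exact ⟨K, hFK (Subfield.subset_closure rfl), hK⟩

end HahnBase

/-! ### Definability of the types of short tuples -/

section Definability

variable {M H Ω Γ Γ' : Type} [Field M] [Field H] [Field Ω] [LinearOrderedCommGroupWithZero Γ]
  [LinearOrderedCommGroupWithZero Γ'] (K : Subfield M) [Algebra K H] [Algebra M Ω]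
  [Algebra H Ω] [IsScalarTower K H Ω]

/-- Expansion of a polynomial in two groups of variables. -/
theorem aeval_sumElim_eq {n m : ℕ} (c : Fin n → M) (a : Fin m → K)
    (f : MvPolynomial (Fin n ⊕ Fin m) ℤ) :
    MvPolynomial.aeval (Sum.elim c fun i => (a i : M)) f =
      ∑ d ∈ f.support, (∏ i, c i ^ d (Sum.inl i)) *
        ((MvPolynomial.eval a (MvPolynomial.C ((f.coeff d : ℤ) : K) *
          ∏ i, MvPolynomial.X i ^ d (Sum.inr i)) : K) : M) := by
  rw [MvPolynomial.aeval_def, MvPolynomial.eval₂_eq']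
  refine Finset.sum_congr rfl fun d _ => ?_
  rw [Fintype.prod_sum_type, map_mul, MvPolynomial.eval_C, map_prod]
  simp only [map_pow, MvPolynomial.eval_X, Sum.elim_inl, Sum.elim_inr, algebraMap_int_eq,
    eq_intCast]
  push_cast
  ring

/-- Polynomials whose values are, at all points, the coefficients of the value of `f` with respect
to an orthonormal system. -/
theorem exists_orthonormal_expansion [IsAlgClosed K] [CharZero H] [CharZero M] [CharZero Ω] {n : ℕ}
    (g : GenericLine K H M Ω n) {v : Valuation H Γ} (hsc : IsSphericallyComplete v)
    {w : Valuation Ω Γ'} (hw : Extends v w) (hval : ∀ x, ∃ h, w x = w (algebraMap H Ω h))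
    (happ : ∀ x, Approximable K v x) (c : Fin n → M) {m : ℕ}
    (f : MvPolynomial (Fin n ⊕ Fin m) ℤ) :
    ∃ (r : ℕ) (e : Fin r → Ω) (P : Fin r → MvPolynomial (Fin m) K), IsOrthonormalFor H w e ∧
      ∀ a : Fin m → K, algebraMap M Ω (MvPolynomial.aeval (Sum.elim c fun i => (a i : M)) f) =
        ∑ j, algebraMap K H ((P j).eval a) • e j := by
  classical
  let x : ((Fin n ⊕ Fin m) →₀ ℕ) → M := fun d => ∏ i, c i ^ d (Sum.inl i)
  have hx : ∀ d, x d ∈ Algebra.adjoin K (Set.range c) := fun d =>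
    prod_mem fun i _ => pow_mem (Algebra.subset_adjoin (Set.mem_range_self i)) _
  -- The space spanned by the c-parts of the monomials of f; it does not depend on the parameters a,
  -- so one orthonormal basis serves for all of them.
  let V := Submodule.span K (x '' f.support)
  have hV : V ≤ Subalgebra.toSubmodule (Algebra.adjoin K (Set.range c)) := by
    rw [Submodule.span_le]
    rintro _ ⟨d, -, rfl⟩
    exact hx d
  have : Module.Finite K V := Module.Finite.span_of_finite K (f.support.finite_toSet.image x)
  let u := Module.finBasis K V
  let u' : Fin (Module.finrank K V) → M := fun j => u j
  have hu'K : LinearIndependent K u' := u.linearIndependent.map' V.subtype (Submodule.ker_subtype V)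
  have hu' : LinearIndependent H fun j => algebraMap M Ω (u' j) :=
    g.linearIndependent le_rfl c (fun j => isAlgebraic_algebraMap
      (⟨u' j, hV (u j).2⟩ : Algebra.adjoin K (Set.range c))) hu'K
  obtain ⟨e, he, hspan⟩ := hsc.exists_orthonormal_of_dense happ hw hval _ hu'
  have hmem : ∀ d, ∃ κ : Fin (Module.finrank K V) → K, d ∈ f.support →
      ∑ j, κ j • e j = algebraMap M Ω (x d) := by
    intro d
    by_cases hd : d ∈ f.support
    · have h1 : x d ∈ V := Submodule.subset_span ⟨d, hd, rfl⟩
      have h2 : algebraMap M Ω (x d) ∈ Submodule.span K (Set.range e) := by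
        have h3 : x d = ∑ j, u.repr ⟨x d, h1⟩ j • u' j := by
          have := congrArg Subtype.val (u.sum_repr ⟨x d, h1⟩)
          rw [Submodule.coe_sum] at this
          exact this.symm
        rw [hspan, h3, map_sum]
        refine sum_mem fun j _ => ?_
        rw [Algebra.smul_def, map_mul, ← IsScalarTower.algebraMap_apply,
          ← Algebra.smul_def]
        exact Submodule.smul_mem _ _ (Submodule.subset_span ⟨j, rfl⟩)
      obtain ⟨κ, hκ⟩ := (Submodule.mem_span_range_iff_exists_fun K).1 h2
      exact ⟨κ, fun _ => hκ⟩
    · exact ⟨0, fun h => absurd h hd⟩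
  choose κ hκ using hmem
  refine ⟨_, e, fun j => ∑ d ∈ f.support, MvPolynomial.C (κ d j) *
    (MvPolynomial.C ((f.coeff d : ℤ) : K) * ∏ i, MvPolynomial.X i ^ d (Sum.inr i)), he, fun a => ?_⟩
  rw [aeval_sumElim_eq, map_sum]
  have h1 : ∀ j, algebraMap K H (MvPolynomial.eval a (∑ d ∈ f.support, MvPolynomial.C (κ d j) *
      (MvPolynomial.C ((f.coeff d : ℤ) : K) * ∏ i, MvPolynomial.X i ^ d (Sum.inr i)))) • e j =
      ∑ d ∈ f.support, algebraMap K Ω (MvPolynomial.eval a (MvPolynomial.C ((f.coeff d : ℤ) : K) *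
        ∏ i, MvPolynomial.X i ^ d (Sum.inr i))) * (κ d j • e j) := by
    intro j
    rw [Algebra.smul_def, ← IsScalarTower.algebraMap_apply, map_sum, map_sum, Finset.sum_mul]
    refine Finset.sum_congr rfl fun d _ => ?_
    rw [map_mul, map_mul, MvPolynomial.eval_C, Algebra.smul_def]
    ring
  rw [Finset.sum_congr rfl fun j _ => h1 j, Finset.sum_comm]
  refine Finset.sum_congr rfl fun d hd => ?_
  rw [← Finset.mul_sum, hκ d hd, map_mul, mul_comm]
  rfl

/-- In an orthonormal basis the coordinates of f(c, a) are polynomials in a over `K`, and the value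
of f(c, a) is the largest of their values. -/
theorem typeIsDefinable_of_genericLine [IsAlgClosed M] [IsAlgClosed K] [CharZero H] [CharZero M]
    [CharZero Ω] {n : ℕ} (g : GenericLine K H M Ω n) {v : Valuation H Γ}
    (hsc : IsSphericallyComplete v) {w : Valuation Ω Γ'} (hw : Extends v w)
    (hval : ∀ x, ∃ h, w x = w (algebraMap H Ω h)) (happ : ∀ x, Approximable K v x)
    (hK : ((w.comap (algebraMap M Ω)).comap K.subtype).IsNontrivial)
    (hM : (w.comap (algebraMap M Ω)).IsNontrivial) (c : Fin n → M) :
    letI := valuedFieldStructure (w.comap (algebraMap M Ω))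
    TypeIsDefinable (elementarySubfield (w.comap (algebraMap M Ω)) K hK hM) c := by
  classical
  refine typeIsDefinable_of_max _ K hK hM c fun m f => ?_
  obtain ⟨r, e, P, he, hP⟩ := exists_orthonormal_expansion K g hsc hw hval happ c f
  -- The zero polynomial keeps the set nonempty when there are no basis vectors, without changing
  -- the maximum.
  refine ⟨insert 0 (Finset.univ.image P), fun a => ?_⟩
  have hKΩ : ∀ y : K, algebraMap M Ω y = algebraMap H Ω (algebraMap K H y) := fun y => by
    rw [← IsScalarTower.algebraMap_apply, IsScalarTower.algebraMap_apply K M Ω]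
    rfl
  simp only [Valuation.comap_apply, hKΩ, hP]
  constructor
  · obtain ⟨Q, hQ, hmax⟩ := Finset.exists_max_image (insert 0 (Finset.univ.image P))
      (fun Q => w (algebraMap H Ω (algebraMap K H (Q.eval a)))) ⟨0, Finset.mem_insert_self _ _⟩
    exact ⟨Q, hQ, (he _ _).2 fun j => hmax _
      (Finset.mem_insert_of_mem (Finset.mem_image_of_mem P (Finset.mem_univ j)))⟩
  · intro Q hQ
    rcases Finset.mem_insert.1 hQ with rfl | hQ
    · rw [map_zero, map_zero, map_zero, map_zero]
      exact zero_le
    · obtain ⟨j, -, rfl⟩ := Finset.mem_image.1 hQ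
      obtain ⟨h, hh⟩ := hval (∑ j, algebraMap K H ((P j).eval a) • e j)
      rw [hh]
      exact (he _ _).1 hh.le j

end Definability

/-! ### Values of polynomials near a generic point -/

section NearGeneric

variable {K H Γ : Type} [Field K] [Field H] [Algebra K H] [LinearOrderedCommGroupWithZero Γ]
  {v : Valuation H Γ} {σ : Type}

/-- The tuple `y` lies in the polydisc of radius `v δ` around `A`. -/
def IsNear (v : Valuation H Γ) (A : σ → H) (δ : H) (y : σ → K) : Prop :=
  ∀ i, v (A i - algebraMap K H (y i)) ≤ v δ

theorem IsNear.mono {A : σ → H} {δ δ' : H} {y : σ → K} (h : IsNear v A δ y) (hδ : v δ ≤ v δ') :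
    IsNear v A δ' y := fun i => (h i).trans hδ

theorem exists_le_both {δ δ' : H} (hδ : δ ≠ 0) (hδ' : δ' ≠ 0) :
    ∃ γ : H, γ ≠ 0 ∧ v γ ≤ v δ ∧ v γ ≤ v δ' := by
  rcases le_total (v δ) (v δ') with h | h
  · exact ⟨δ, hδ, le_rfl, h⟩
  · exact ⟨δ', hδ', h, le_rfl⟩

theorem exists_le_forall {κ : Type} (s : Finset κ) {p : κ → H → Prop}
    (hp : ∀ j ∈ s, ∃ δ, δ ≠ 0 ∧ p j δ)
    (hmono : ∀ j δ δ', v δ' ≤ v δ → p j δ → p j δ') :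
    ∃ δ, δ ≠ 0 ∧ ∀ j ∈ s, p j δ := by
  classical
  induction s using Finset.induction_on with
  | empty => exact ⟨1, one_ne_zero, fun j hj => absurd hj (Finset.notMem_empty j)⟩
  | insert i s his ih =>
    obtain ⟨δ₁, h1, h1'⟩ := ih fun j hj => hp j (Finset.mem_insert_of_mem hj)
    obtain ⟨δ₂, h2, h2'⟩ := hp i (Finset.mem_insert_self i s)
    obtain ⟨δ, hδ, hle1, hle2⟩ := exists_le_both (v := v) h1 h2
    refine ⟨δ, hδ, fun j hj => ?_⟩
    rcases Finset.mem_insert.1 hj with rfl | hj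
    · exact hmono _ _ _ hle2 h2'
    · exact hmono _ _ _ hle1 (h1' j hj)

variable {π : H} (hπ0 : π ≠ 0) (hπ1 : v π < 1)
include hπ0 hπ1

theorem exists_mul_lt (ε B : H) (hε : ε ≠ 0) : ∃ δ, δ ≠ 0 ∧ v B * v δ < v ε := by
  have hvε : 0 < v ε := by simpa [zero_lt_iff] using hε
  by_cases hB : B = 0
  · exact ⟨1, one_ne_zero, by rwa [hB, map_zero, zero_mul]⟩
  · refine ⟨π * ε / B, div_ne_zero (mul_ne_zero hπ0 hε) hB, ?_⟩
    rw [← map_mul, mul_div_cancel₀ _ hB, map_mul]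
    exact mul_lt_of_lt_one_left hvε hπ1

/-- Polynomials are continuous. -/
theorem exists_near_sub_lt (A : σ → H) (q : MvPolynomial σ K) :
    ∀ ε : H, ε ≠ 0 → ∃ δ : H, δ ≠ 0 ∧ ∀ y : σ → K, IsNear v A δ y →
      v (MvPolynomial.aeval A q - algebraMap K H (q.eval y)) < v ε := by
  induction q using MvPolynomial.induction_on with
  | C a =>
    intro ε hε
    refine ⟨1, one_ne_zero, fun y _ => ?_⟩
    rw [MvPolynomial.aeval_C, MvPolynomial.eval_C, sub_self, map_zero]
    simpa [zero_lt_iff] using hε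
  | add p q hp hq =>
    intro ε hε
    obtain ⟨δ₁, h1, h1'⟩ := hp ε hε
    obtain ⟨δ₂, h2, h2'⟩ := hq ε hε
    obtain ⟨δ, hδ, hle1, hle2⟩ := exists_le_both (v := v) h1 h2
    refine ⟨δ, hδ, fun y hy => ?_⟩
    rw [map_add, map_add, map_add, add_sub_add_comm]
    exact v.map_add_lt (h1' y (hy.mono hle1)) (h2' y (hy.mono hle2))
  | mul_X p i hp =>
    intro ε hε
    obtain ⟨ε₁, he1, he1'⟩ := exists_mul_lt hπ0 hπ1 ε (A i) hε
    obtain ⟨δ₁, h1, h1'⟩ := hp ε₁ he1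
    obtain ⟨δ₂, h2, h2'⟩ := exists_mul_lt hπ0 hπ1 ε (MvPolynomial.aeval A p) hε
    obtain ⟨δ₃, h3, h3'⟩ := exists_mul_lt hπ0 hπ1 ε ε₁ hε
    obtain ⟨δ₄, h4, hle1, hle4⟩ := exists_le_both (v := v) h1 h2
    obtain ⟨δ, hδ, hle4', hle3⟩ := exists_le_both (v := v) h4 h3
    refine ⟨δ, hδ, fun y hy => ?_⟩
    have hp' := h1' y (hy.mono (hle4'.trans hle1))
    have hyi := hy i
    have key : MvPolynomial.aeval A (p * MvPolynomial.X i) -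
        algebraMap K H ((p * MvPolynomial.X i).eval y) =
        (MvPolynomial.aeval A p - algebraMap K H (p.eval y)) * A i +
        (MvPolynomial.aeval A p * (A i - algebraMap K H (y i)) -
        (MvPolynomial.aeval A p - algebraMap K H (p.eval y)) * (A i - algebraMap K H (y i))) := by
      rw [map_mul, map_mul, MvPolynomial.aeval_X, MvPolynomial.eval_X, map_mul]
      ring
    rw [key]
    refine v.map_add_lt ?_ (v.map_sub_lt ?_ ?_)
    · rw [map_mul, mul_comm]
      exact (mul_le_mul' le_rfl hp'.le).trans_lt he1'
    · rw [map_mul]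
      exact (mul_le_mul' le_rfl (hyi.trans (hle4'.trans hle4))).trans_lt h2'
    · rw [map_mul]
      exact (mul_le_mul' hp'.le (hyi.trans hle3)).trans_lt h3'

theorem exists_near_val_eq {A : σ → H} {q : MvPolynomial σ K} (hq : MvPolynomial.aeval A q ≠ 0) :
    ∃ δ : H, δ ≠ 0 ∧ ∀ y : σ → K, IsNear v A δ y →
      v (algebraMap K H (q.eval y)) = v (MvPolynomial.aeval A q) := by
  obtain ⟨δ, hδ, h⟩ := exists_near_sub_lt hπ0 hπ1 A q _ hq
  refine ⟨δ, hδ, fun y hy => ?_⟩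
  rw [← v.map_sub_eq_of_lt_left (h y hy), sub_sub_cancel]

theorem exists_near_val_le (A : σ → H) (q : MvPolynomial σ K) :
    ∃ B δ : H, δ ≠ 0 ∧ ∀ y : σ → K, IsNear v A δ y → v (algebraMap K H (q.eval y)) ≤ v B := by
  by_cases hq : MvPolynomial.aeval A q = 0
  · obtain ⟨δ, hδ, h⟩ := exists_near_sub_lt hπ0 hπ1 A q 1 one_ne_zero
    refine ⟨1, δ, hδ, fun y hy => ?_⟩
    have := (h y hy).le
    rwa [hq, zero_sub, Valuation.map_neg] at this
  · obtain ⟨δ, hδ, h⟩ := exists_near_val_eq hπ0 hπ1 hq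
    exact ⟨_, δ, hδ, fun y hy => (h y hy).le⟩

/-- The value of a polynomial in `(z, y)` depends only on the value of `z` for `z` close to `0` and
`y` close to an algebraically independent tuple. -/
theorem exists_near_val_const {n : ℕ} {A : Fin n → H} (hA : AlgebraicIndependent K A)
    (P : MvPolynomial (Fin (n + 1)) K) :
    ∃ δ : H, δ ≠ 0 ∧ ∃ F : K → Γ, ∀ (z : K) (y : Fin n → K), z ≠ 0 → v (algebraMap K H z) ≤ v δ →
      IsNear v A δ y → v (algebraMap K H (P.eval (Fin.cons z y))) = F z := by
  classical
  let p := MvPolynomial.finSuccEquiv K n P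
  by_cases hP : P = 0
  · exact ⟨1, one_ne_zero, fun _ => 0, fun z y _ _ _ => by rw [hP, map_zero, map_zero, map_zero]⟩
  have hp : p ≠ 0 := (map_ne_zero_iff _ (MvPolynomial.finSuccEquiv K n).injective).2 hP
  -- In the expansion of P in powers of z, the lowest nonzero coefficient does not vanish at A by
  -- independence, so its value is constant near A. For small z its term dominates all others, and
  -- v(P) is that constant times v(z)^j₀.
  let j₀ := p.natTrailingDegree
  have hc : p.coeff j₀ ≠ 0 := Polynomial.trailingCoeff_nonzero_iff_nonzero.2 hp
  have hcA : MvPolynomial.aeval A (p.coeff j₀) ≠ 0 := by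
    rw [ne_eq, map_eq_zero_iff _ hA]
    exact hc
  obtain ⟨δ₁, h1, h1'⟩ := exists_near_val_eq (v := v) hπ0 hπ1 hcA
  have hj : ∀ j ∈ (Finset.range (p.natDegree + 1)).erase j₀, ∃ δ, δ ≠ 0 ∧
      ∀ (z : K) (y : Fin n → K), z ≠ 0 → v (algebraMap K H z) ≤ v δ → IsNear v A δ y →
        v (algebraMap K H ((p.coeff j).eval y * z ^ j)) <
          v (MvPolynomial.aeval A (p.coeff j₀)) * v (algebraMap K H z) ^ j₀ := by
    intro j hj
    have hvA : 0 < v (MvPolynomial.aeval A (p.coeff j₀)) := by simpa [zero_lt_iff] using hcA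
    have hz0 : ∀ z : K, z ≠ 0 → 0 < v (algebraMap K H z) := fun z hz => by
      simpa [zero_lt_iff] using hz
    rcases lt_or_ge j j₀ with hlt | hge
    · refine ⟨1, one_ne_zero, fun z y hz _ _ => ?_⟩
      rw [Polynomial.coeff_eq_zero_of_lt_natTrailingDegree hlt, map_zero, zero_mul, map_zero,
        map_zero]
      exact mul_pos hvA (pow_pos (hz0 z hz) _)
    · obtain ⟨B, δ₂, h2, h2'⟩ := exists_near_val_le (v := v) hπ0 hπ1 A (p.coeff j)
      obtain ⟨δ₃, h3, h3'⟩ := exists_mul_lt (v := v) hπ0 hπ1 _ B hcA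
      obtain ⟨δ₄, h4, hle2, hle3⟩ := exists_le_both (v := v) h2 h3
      obtain ⟨δ, hδ, hle4, hle1⟩ := exists_le_both (v := v) h4 one_ne_zero
      refine ⟨δ, hδ, fun z y hz hzδ hy => ?_⟩
      have hgt : j₀ + 1 ≤ j := lt_of_le_of_ne hge fun h => (Finset.mem_erase.1 hj).1 h.symm
      have hz1 : v (algebraMap K H z) ≤ 1 := by simpa using hzδ.trans hle1
      rw [map_mul, map_mul, map_pow, map_pow]
      calc v (algebraMap K H ((p.coeff j).eval y)) * v (algebraMap K H z) ^ j
          ≤ v B * v (algebraMap K H z) ^ (j₀ + 1) :=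
            mul_le_mul' (h2' y (hy.mono (hle4.trans hle2))) (pow_le_pow_right_of_le_one' hz1 hgt)
        _ = (v B * v (algebraMap K H z)) * v (algebraMap K H z) ^ j₀ := by
            rw [pow_succ', mul_assoc]
        _ < _ := mul_lt_mul_of_pos_right ((mul_le_mul' le_rfl
            (hzδ.trans (hle4.trans hle3))).trans_lt h3') (pow_pos (hz0 z hz) _)
  obtain ⟨δ₂, h2, h2'⟩ := exists_le_forall (v := v) _ hj fun j δ δ' hle h z y hz hzδ hy =>
    h z y hz (hzδ.trans hle) (hy.mono hle)
  obtain ⟨δ, hδ, hle1, hle2⟩ := exists_le_both (v := v) h1 h2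
  refine ⟨δ, hδ, fun z => v (MvPolynomial.aeval A (p.coeff j₀)) * v (algebraMap K H z) ^ j₀,
    fun z y hz hzδ hy => ?_⟩
  have hlead : v (algebraMap K H ((p.coeff j₀).eval y * z ^ j₀)) =
      v (MvPolynomial.aeval A (p.coeff j₀)) * v (algebraMap K H z) ^ j₀ := by
    rw [map_mul, map_mul, h1' y (hy.mono hle1), map_pow, map_pow]
  have hmem : j₀ ∈ Finset.range (p.natDegree + 1) :=
    Finset.mem_range.2 (Nat.lt_succ_of_le (Polynomial.natTrailingDegree_le_natDegree p))
  have hexp : P.eval (Fin.cons z y) =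
      ∑ j ∈ Finset.range (p.natDegree + 1), (p.coeff j).eval y * z ^ j := by
    rw [MvPolynomial.eval_eq_eval_mv_eval', Polynomial.eval_map, Polynomial.eval₂_eq_sum_range]
  rw [hexp, ← Finset.add_sum_erase _ _ hmem, map_add, map_sum, v.map_add_eq_of_lt_left, hlead]
  rw [hlead]
  refine v.map_sum_lt ?_ fun j hj => h2' j hj z y hz (hzδ.trans hle2) (hy.mono hle2)
  refine mul_ne_zero ?_ (pow_ne_zero _ ?_)
  · simpa using hcA
  · simpa using hz

end NearGeneric

/-! ### A type of a long tuple that is not definable -/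

section NotDefinable

variable {M H Ω Γ Γ' : Type} [Field M] [Field H] [Field Ω] [LinearOrderedCommGroupWithZero Γ]
  [LinearOrderedCommGroupWithZero Γ'] (K : Subfield M) [Algebra K H] [Algebra M Ω]
  [Algebra H Ω] [IsScalarTower K H Ω]

theorem Approximable.exists_val_eq {K : Type} [Field K] [Algebra K H] {v : Valuation H Γ} {δ : H}
    (hδ : δ ≠ 0) (h : Approximable K v δ) : ∃ a : K, v (algebraMap K H a) = v δ := by
  obtain ⟨a, ha⟩ := h δ hδ
  exact ⟨a, by rw [← v.map_sub_eq_of_lt_left ha, sub_sub_cancel]⟩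

/-- The polynomial `x₀ - y₁ - ∑ yᵢ₊₂ xᵢ₊₁`. -/
noncomputable def linePolynomial (n : ℕ) : MvPolynomial (Fin (n + 1) ⊕ Fin (n + 2)) ℤ :=
  MvPolynomial.X (Sum.inl 0) - MvPolynomial.X (Sum.inr (Fin.succ 0)) -
    ∑ i : Fin n, MvPolynomial.X (Sum.inr i.succ.succ) * MvPolynomial.X (Sum.inl i.succ)

/-- Substituting the equation of b turns b - y₀ - ∑ yᵢtᵢ into a combination of 1 and t whose
coefficients are the differences between α and y. The parameter z does not occur; it is kept to
serve as a radius. -/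
theorem GenericLine.algebraMap_aeval_linePolynomial {n : ℕ} (g : GenericLine K H M Ω n) (z : K)
    (y : Fin (n + 1) → K) :
    algebraMap M Ω (MvPolynomial.aeval (Sum.elim (Fin.cons g.b g.t : Fin (n + 1) → M)
      fun i => ((Fin.cons z y : Fin (n + 2) → K) i : M)) (linePolynomial n)) =
    ∑ o : Option (Fin n), (o.elim (g.α₀ - algebraMap K H (y 0))
      fun i => g.α i - algebraMap K H (y i.succ)) • o.elim (1 : Ω) fun i => algebraMap M Ω (g.t i) := by
  have hKΩ : ∀ y : K, algebraMap M Ω y = algebraMap H Ω (algebraMap K H y) := fun y => by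
    rw [← IsScalarTower.algebraMap_apply, IsScalarTower.algebraMap_apply K M Ω]
    rfl
  simp only [linePolynomial, map_sub, map_sum, map_mul, MvPolynomial.aeval_X, Sum.elim_inl,
    Sum.elim_inr, Fin.cons_zero, Fin.cons_succ, Fintype.sum_option, Option.elim_none,
    Option.elim_some, g.eq_b, Algebra.smul_def, hKΩ, sub_mul, Finset.sum_sub_distrib, mul_one]
  ring

/-- The type of the point `(b, t)` on the generic hyperplane is not definable. -/
theorem not_typeIsDefinable_of_genericLine [IsAlgClosed M] [IsAlgClosed K] [CharZero M] {n : ℕ}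
    (g : GenericLine K H M Ω n) {v : Valuation H Γ} {w : Valuation Ω Γ'} (hw : Extends v w)
    (happ : ∀ x, Approximable K v x)
    (he : IsOrthonormalFor H w fun o : Option (Fin n) => o.elim 1 fun i => algebraMap M Ω (g.t i))
    {π : K} (hπ0 : π ≠ 0) (hπ1 : v (algebraMap K H π) < 1)
    (hK : ((w.comap (algebraMap M Ω)).comap K.subtype).IsNontrivial)
    (hM : (w.comap (algebraMap M Ω)).IsNontrivial) :
    letI := valuedFieldStructure (w.comap (algebraMap M Ω))
    ¬ TypeIsDefinable (elementarySubfield (w.comap (algebraMap M Ω)) K hK hM)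
      (Fin.cons g.b g.t : Fin (n + 1) → M) := by
  classical
  intro hdef
  have hKΩ : ∀ y : K, algebraMap M Ω y = algebraMap H Ω (algebraMap K H y) := fun y => by
    rw [← IsScalarTower.algebraMap_apply, IsScalarTower.algebraMap_apply K M Ω]
    rfl
  obtain ⟨Q, hQ⟩ := exists_determining_of_typeIsDefinable _ K hK hM _ hdef (linePolynomial n)
    (MvPolynomial.X (Sum.inr 0))
  let A : Fin (n + 1) → H := Fin.cons g.α₀ g.α
  have hA : AlgebraicIndependent K A := by
    have h := g.indep_α.comp _ (finSuccEquiv n).injective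
    convert h using 1
    funext i
    cases i using Fin.cases <;> simp [A]
  have hmem : ∀ (z : K) (y : Fin (n + 1) → K),
      (w.comap (algebraMap M Ω)) (MvPolynomial.aeval (Sum.elim (Fin.cons g.b g.t : Fin (n + 1) → M)
        fun i => ((Fin.cons z y : Fin (n + 2) → K) i : M)) (linePolynomial n)) ≤
      (w.comap (algebraMap M Ω)) (MvPolynomial.aeval (Sum.elim (Fin.cons g.b g.t : Fin (n + 1) → M)
        fun i => ((Fin.cons z y : Fin (n + 2) → K) i : M))
          (MvPolynomial.X (Sum.inr 0) : MvPolynomial (Fin (n + 1) ⊕ Fin (n + 2)) ℤ)) ↔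
      IsNear v A (algebraMap K H z) y := by
    intro z y
    rw [Valuation.comap_apply, Valuation.comap_apply, g.algebraMap_aeval_linePolynomial,
      MvPolynomial.aeval_X, Sum.elim_inr, Fin.cons_zero, hKΩ, he, Option.forall]
    simp only [Option.elim_none, Option.elim_some, hw _ _]
    rw [IsNear, Fin.forall_fin_succ]
    rfl
  have hπ0' : algebraMap K H π ≠ 0 := by simpa using hπ0
  obtain ⟨δ, hδ, hδQ⟩ := exists_le_forall (v := v) Q
    (p := fun P δ => ∃ F : K → Γ, ∀ (z : K) (y : Fin (n + 1) → K), z ≠ 0 →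
      v (algebraMap K H z) ≤ v δ → IsNear v A δ y →
        v (algebraMap K H (P.eval (Fin.cons z y))) = F z)
    (fun P _ => exists_near_val_const hπ0' hπ1 hA P)
    (fun P δ δ' hle ⟨F, hF⟩ => ⟨F, fun z y hz hzδ hy => hF z y hz (hzδ.trans hle) (hy.mono hle)⟩)
  -- Two scales inside the region where all values depend on z only: the outer radius v(δ), attained
  -- by ζ in `K`, and the smaller radius of z = πζ.
  obtain ⟨ζ, hζ⟩ := (happ δ).exists_val_eq hδ
  have hvδ : 0 < v δ := by simpa [zero_lt_iff] using hδ
  have hζ0 : ζ ≠ 0 := by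
    rintro rfl
    rw [map_zero, map_zero] at hζ
    exact hvδ.ne hζ
  have hz0 : π * ζ ≠ 0 := mul_ne_zero hπ0 hζ0
  have hz : v (algebraMap K H (π * ζ)) < v δ := by
    rw [map_mul, map_mul, hζ]
    exact mul_lt_of_lt_one_left hvδ hπ1
  have happ' : ∀ i, ∃ a : K, v (A i - algebraMap K H a) < v (algebraMap K H (π * ζ)) := fun i =>
    happ (A i) _ (by simpa using hz0)
  choose y hy using happ'
  -- The tuple y lies within v(z) of A, while y' has distance exactly v(δ) > v(z) in coordinate 0.
  -- Both are near A, so every polynomial in `Q` has the same value at (z, y) and (z, y'), although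
  -- only y is in the polydisc.
  let y' : Fin (n + 1) → K := Function.update y 0 (y 0 + ζ)
  have hy0 : v (A 0 - algebraMap K H (y' 0)) = v δ := by
    have h1 : A 0 - algebraMap K H (y' 0) = (A 0 - algebraMap K H (y 0)) - algebraMap K H ζ := by
      rw [show y' 0 = y 0 + ζ from Function.update_self _ _ _, map_add]
      ring
    rw [h1, v.map_sub_eq_of_lt_right, hζ]
    rw [hζ]
    exact (hy 0).trans hz
  have hnear : IsNear v A δ y := fun i => ((hy i).trans hz).le
  have hnear' : IsNear v A δ y' := by
    intro i
    by_cases hi : i = 0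
    · rw [hi, hy0]
    · rw [show y' i = y i from Function.update_of_ne hi _ _]
      exact hnear i
  have hval : ∀ P ∈ Q, v (algebraMap K H (P.eval (Fin.cons (π * ζ) y'))) =
      v (algebraMap K H (P.eval (Fin.cons (π * ζ) y))) := fun P hP => by
    obtain ⟨F, hF⟩ := hδQ P hP
    rw [hF _ y hz0 hz.le hnear, hF _ y' hz0 hz.le hnear']
  have hcon := hQ (Fin.cons (π * ζ) y) (Fin.cons (π * ζ) y') (fun P hP P' hP' => by
    rw [Valuation.comap_apply, Valuation.comap_apply, Valuation.comap_apply, Valuation.comap_apply,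
      hKΩ, hKΩ, hKΩ, hKΩ, hw, hw, hval P hP, hval P' hP'])
    ((hmem _ _).2 fun i => (hy i).le)
  exact absurd ((hmem _ _).1 hcon 0) (not_le.2 (by rwa [hy0]))

end NotDefinable

/-! ### The pair of fields -/

section Pair

variable {H Ω : Type} [Field H] [Field Ω] [Algebra H Ω]

/-! ### Identifying a subfield of `H` with a subfield of `M ⊆ Ω` -/

section BaseSubfield

variable (k : Subfield H) (M : Subfield Ω)

/-- The copy, inside the subfield `M` of `Ω`, of the subfield `k` of `H`. -/
def baseSubfield : Subfield M := (k.map (algebraMap H Ω)).comap M.subtype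

/-- The subfield `k` is isomorphic to its copy in `M`. -/
noncomputable def baseEquiv (hM : k.map (algebraMap H Ω) ≤ M) : k ≃+* baseSubfield k M :=
  RingEquiv.ofBijective
    ((((algebraMap H Ω).comp k.subtype).codRestrict M fun x => hM ⟨x, x.2, rfl⟩).codRestrict
      (baseSubfield k M) fun x => ⟨x, x.2, rfl⟩)
    ⟨RingHom.injective _, by
      rintro ⟨y, x, hx, hxy⟩
      exact ⟨⟨x, hx⟩, Subtype.ext (Subtype.ext hxy)⟩⟩

/-- The copy of `k` in `M` acts on `H`. -/
@[reducible]
noncomputable def baseAlgebra (hM : k.map (algebraMap H Ω) ≤ M) : Algebra (baseSubfield k M) H :=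
  (k.subtype.comp (baseEquiv k M hM).symm.toRingHom).toAlgebra

variable (hM : k.map (algebraMap H Ω) ≤ M)

theorem algebraMap_baseEquiv (x : k) :
    letI := baseAlgebra k M hM
    algebraMap (baseSubfield k M) H (baseEquiv k M hM x) = x :=
  congrArg Subtype.val ((baseEquiv k M hM).symm_apply_apply x)

theorem isScalarTower_base :
    letI := baseAlgebra k M hM
    IsScalarTower (baseSubfield k M) H Ω := by
  let := baseAlgebra k M hM
  refine IsScalarTower.of_algebraMap_eq fun x => ?_
  obtain ⟨x, rfl⟩ := (baseEquiv k M hM).surjective x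
  rw [algebraMap_baseEquiv]
  rfl

theorem algebraicIndependent_base {ι : Type} {α : ι → H} (hα : AlgebraicIndependent k α) :
    letI := baseAlgebra k M hM
    AlgebraicIndependent (baseSubfield k M) α := by
  let := baseAlgebra k M hM
  exact hα.ringHom_of_comp_eq (baseEquiv k M hM) (RingHom.id H) (baseEquiv k M hM).surjective
    Function.injective_id (RingHom.ext fun x => algebraMap_baseEquiv k M hM x)

theorem approximable_base {Γ : Type} [LinearOrderedCommGroupWithZero Γ] {v : Valuation H Γ} {x : H}
    (hx : Approximable k v x) :
    letI := baseAlgebra k M hM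
    Approximable (baseSubfield k M) v x := by
  intro δ hδ
  obtain ⟨a, ha⟩ := hx δ hδ
  exact ⟨baseEquiv k M hM a, by rwa [algebraMap_baseEquiv]⟩

end BaseSubfield

/-! ### Relative algebraic closures in `Ω` -/

variable (k : Subfield H) (S : Set Ω)

/-- The relative algebraic closure in `Ω` of the field generated by `S` over a subfield of `H`. -/
noncomputable def closureField : Subfield Ω :=
  (_root_.algebraicClosure (IntermediateField.adjoin (k.map (algebraMap H Ω)) S) Ω).toSubfield

theorem isAlgClosed_closureField [IsAlgClosed Ω] : IsAlgClosed (closureField k S) :=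
  (algebraicClosure.isAlgClosure
    (IntermediateField.adjoin (k.map (algebraMap H Ω)) S) Ω).isAlgClosed

theorem adjoin_le_closureField {x : Ω}
    (hx : x ∈ IntermediateField.adjoin (k.map (algebraMap H Ω)) S) : x ∈ closureField k S :=
  (_root_.algebraicClosure (IntermediateField.adjoin (k.map (algebraMap H Ω)) S) Ω).algebraMap_mem
    ⟨x, hx⟩

theorem map_le_closureField : k.map (algebraMap H Ω) ≤ closureField k S := fun x hx =>
  adjoin_le_closureField k S ((IntermediateField.adjoin (k.map (algebraMap H Ω)) S).algebraMap_mem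
    ⟨x, hx⟩)

theorem subset_closureField : S ⊆ closureField k S := fun _ hx =>
  adjoin_le_closureField k S (IntermediateField.subset_adjoin _ S hx)

open scoped IntermediateField.algebraAdjoinAdjoin in
-- Algebraicity holds by construction inside `Ω`; the ring generated there is carried into the ring
-- generated inside the closure, and an algebraic equation is transported along.
theorem isAlgebraic_closureField {S' : Set (closureField k S)} (hS : S = Subtype.val '' S') :
    Algebra.IsAlgebraic (Algebra.adjoin (baseSubfield k (closureField k S)) S')
      (closureField k S) := by
  let R := Algebra.adjoin (baseSubfield k (closureField k S)) S'
  let R' := Algebra.adjoin (k.map (algebraMap H Ω)) S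
  have hmem : ∀ x ∈ R', ∃ hx : x ∈ closureField k S, (⟨x, hx⟩ : closureField k S) ∈ R := by
    intro x hx
    induction hx using Algebra.adjoin_induction with
    | mem x hx =>
      rw [hS] at hx
      obtain ⟨y, hy, rfl⟩ := hx
      exact ⟨y.2, Algebra.subset_adjoin hy⟩
    | algebraMap r =>
      exact ⟨map_le_closureField k S r.2, R.algebraMap_mem ⟨⟨r, map_le_closureField k S r.2⟩, r.2⟩⟩
    | add x y _ _ hx hy => exact ⟨add_mem hx.1 hy.1, add_mem hx.2 hy.2⟩
    | mul x y _ _ hx hy => exact ⟨mul_mem hx.1 hy.1, mul_mem hx.2 hy.2⟩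
  let φ : R' →+* R := ((R'.val.toRingHom).codRestrict (closureField k S)
    fun x => (hmem x x.2).1).codRestrict R fun x => (hmem x x.2).2
  have hφ : Function.Injective φ := fun x y hxy =>
    Subtype.ext (congrArg (fun z : R => ((z : closureField k S) : Ω)) hxy)
  refine ⟨fun x => ?_⟩
  have hx : IsAlgebraic (IntermediateField.adjoin (k.map (algebraMap H Ω)) S) (x : Ω) :=
    mem_algebraicClosure_iff.1 x.2
  obtain ⟨p, hp, hpx⟩ := (IsFractionRing.isAlgebraic_iff R'
    (IntermediateField.adjoin (k.map (algebraMap H Ω)) S) Ω).2 hx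
  refine ⟨p.map φ, (Polynomial.map_ne_zero_iff hφ).2 hp, Subtype.val_injective ?_⟩
  rw [Polynomial.aeval_def, Polynomial.eval₂_map]
  change (closureField k S).subtype _ = (closureField k S).subtype 0
  rw [Polynomial.hom_eval₂, map_zero]
  exact hpx

end Pair

section HahnPair

variable {k k' : Type} [Field k] [Field k']

theorem exists_hahnValuation_eq (f : k →+* k') (x : HahnSeries ℚ k') :
    ∃ h, hahnValuation k' x = hahnValuation k' (hahnMap f h) := by
  by_cases hx : x = 0
  · exact ⟨0, by rw [hx, map_zero (hahnMap f), map_zero]⟩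
  · refine ⟨HahnSeries.single x.order 1, ?_⟩
    rw [hahnValuation_hahnMap, hahnValuation_eq_iff, HahnSeries.orderTop_single one_ne_zero,
      HahnSeries.order_eq_orderTop_of_ne_zero hx]

/-- The elements 1 and τᵢ are the values at τ of distinct monomials. -/
theorem linearIndependent_option_elim_one [Algebra k k'] {ι : Type} {τ : ι → k'}
    (hτ : AlgebraicIndependent k τ) :
    LinearIndependent k fun o : Option ι => o.elim 1 τ := by
  have h1 := (MvPolynomial.basisMonomials ι k).linearIndependent
  have h2 := h1.comp (fun o : Option ι => o.elim 0 fun i => Finsupp.single i 1) (by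
    rintro (_ | i) (_ | j) h
    · rfl
    · simp [eq_comm] at h
    · simp at h
    · simpa [Finsupp.single_left_inj] using h)
  have h3 := h2.map' (MvPolynomial.aeval τ).toLinearMap (LinearMap.ker_eq_bot.2 hτ)
  have h4 : (fun o : Option ι => o.elim 1 τ) = (MvPolynomial.aeval τ).toLinearMap ∘
      (MvPolynomial.basisMonomials ι k) ∘ fun o => o.elim 0 fun i => Finsupp.single i 1 := by
    funext o
    cases o with
    | none => simp
    | some i =>
      exact (MvPolynomial.aeval_X τ i).symm.trans (congrArg (MvPolynomial.aeval τ)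
        (congrFun (MvPolynomial.coe_basisMonomials ι k) (Finsupp.single i 1)).symm)
  rw [h4]
  exact h3

theorem isOrthonormalFor_hahn [Algebra k k'] {n : ℕ} {τ : Fin n → k'}
    (hτ : AlgebraicIndependent k τ) :
    letI := (hahnMap (algebraMap k k')).toAlgebra
    IsOrthonormalFor (HahnSeries ℚ k) (hahnValuation k')
      fun o : Option (Fin n) => o.elim 1 fun i => HahnSeries.C (Γ := ℚ) (τ i) := by
  intro a h
  have h1 := hahnValuation_sum_le_iff (linearIndependent_option_elim_one hτ) a h
  have h2 : ∀ o : Option (Fin n), HahnSeries.C (Γ := ℚ) (o.elim 1 τ) =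
      o.elim 1 fun i => HahnSeries.C (Γ := ℚ) (τ i) := by
    rintro (_ | i)
    · exact map_one _
    · rfl
  simp only [h2] at h1
  simp only [Algebra.smul_def, RingHom.algebraMap_toAlgebra, hahnValuation_hahnMap]
  exact h1

theorem extends_hahn [Algebra k k'] :
    letI := (hahnMap (algebraMap k k')).toAlgebra
    Extends (hahnValuation k) (hahnValuation k') := by
  intro a b
  simp only [RingHom.algebraMap_toAlgebra, hahnValuation_hahnMap]

theorem hahnValuation_single_lt_one : hahnValuation k (HahnSeries.single 1 1) < 1 := by
  rw [hahnValuation_lt_one_iff]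
  intro q hq
  exact HahnSeries.coeff_single_of_ne (by rintro rfl; norm_num at hq)

/-- A pair of models of `ACVF` for which types of `n`-tuples are definable, but not all types of
`n + 1`-tuples. -/
theorem exists_pair [IsAlgClosed k] [CharZero k] [IsAlgClosed k'] [CharZero k'] [Algebra k k']
    {n : ℕ} {τ : Fin n → k'} (hτ : AlgebraicIndependent k τ) :
    ∃ (L : Type) (_ : langVF.Structure L) (K : langVF.ElementarySubstructure L),
      IsACVFZero K ∧ IsACVF L ∧ TypesDefinable n K ∧ ¬ TypesDefinable (n + 1) K := by
  let : Algebra (HahnSeries ℚ k) (HahnSeries ℚ k') := (hahnMap (algebraMap k k')).toAlgebra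
  have : IsAlgClosed (HahnSeries ℚ k') := isAlgClosed_hahn
  have : CharZero (HahnSeries ℚ k') := charZero_hahn
  have : CharZero (HahnSeries ℚ k) := charZero_hahn
  obtain ⟨K₀, hK₀, hK₀c, happ, α, hα⟩ := exists_dense_subfield_hahn k (Option (Fin n))
  let t : Fin n → HahnSeries ℚ k' := fun i => HahnSeries.C (τ i)
  -- The coefficients α come from the completion `H` of `K₀`, and the tᵢ have residues independent
  -- over `k`: the first makes the polydiscs around α undefinable over `K`, the second makes 1, t
  -- orthonormal.
  let b : HahnSeries ℚ k' := algebraMap (HahnSeries ℚ k) _ (α none) +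
    ∑ i, algebraMap (HahnSeries ℚ k) _ (α (some i)) * t i
  let S : Set (HahnSeries ℚ k') := Set.range fun o : Option (Fin n) => o.elim b t
  let M := closureField K₀ S
  have hM : K₀.map (algebraMap (HahnSeries ℚ k) _) ≤ M := map_le_closureField K₀ S
  have hSM : ∀ o : Option (Fin n), o.elim b t ∈ M := fun o => subset_closureField K₀ S ⟨o, rfl⟩
  have : IsAlgClosed M := isAlgClosed_closureField K₀ S
  have : CharZero M := M.subtype.charZero
  let K := baseSubfield K₀ M
  have : IsAlgClosed K := IsAlgClosed.of_ringEquiv K₀ K (baseEquiv K₀ M hM)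
  let : Algebra K (HahnSeries ℚ k) := baseAlgebra K₀ M hM
  have : IsScalarTower K (HahnSeries ℚ k) (HahnSeries ℚ k') := isScalarTower_base K₀ M hM
  let g : GenericLine K (HahnSeries ℚ k) M (HahnSeries ℚ k') n :=
    { t := fun i => ⟨t i, hSM (some i)⟩
      b := ⟨b, hSM none⟩
      α := fun i => α (some i)
      α₀ := α none
      indep_α := by
        have h := algebraicIndependent_base K₀ M hM hα
        convert h using 1
        funext o
        cases o <;> rfl
      indep_t := algebraicIndependent_C hτ
      eq_b := rfl
      isAlgebraic := isAlgebraic_closureField K₀ S (by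
        rw [← Set.range_comp]
        refine congrArg Set.range (funext fun o => ?_)
        cases o <;> rfl) }
  let w := (hahnValuation k').comap (algebraMap M (HahnSeries ℚ k'))
  let π : K := baseEquiv K₀ M hM ⟨_, hK₀⟩
  have hπ : algebraMap K (HahnSeries ℚ k) π = HahnSeries.single 1 1 :=
    algebraMap_baseEquiv K₀ M hM ⟨_, hK₀⟩
  have hπ0 : π ≠ 0 := by
    intro h
    rw [h, map_zero] at hπ
    exact HahnSeries.single_ne_zero one_ne_zero hπ.symm
  have hπ1 : hahnValuation k (algebraMap K (HahnSeries ℚ k) π) < 1 := by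
    rw [hπ]
    exact hahnValuation_single_lt_one
  have hwπ : (w.comap K.subtype) π = hahnValuation k (HahnSeries.single 1 1) :=
    hahnValuation_hahnMap _ _
  have hK : (w.comap K.subtype).IsNontrivial := ⟨π, by
    rw [ne_eq, map_eq_zero]
    exact hπ0, by
    rw [hwπ]
    exact hahnValuation_single_lt_one.ne⟩
  have hw : w.IsNontrivial := ⟨π, by
    obtain ⟨h1, h2⟩ : (w.comap K.subtype) π ≠ 0 ∧ (w.comap K.subtype) π ≠ 1 := ⟨by
      rw [ne_eq, map_eq_zero]
      exact hπ0, by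
      rw [hwπ]
      exact hahnValuation_single_lt_one.ne⟩
    exact ⟨h1, h2⟩⟩
  have happ' : ∀ x, Approximable K (hahnValuation k) x := fun x =>
    approximable_base K₀ M hM (happ x)
  refine ⟨M, valuedFieldStructure w, elementarySubfield w K hK hw,
    isACVFZero_elementarySubfield w K hK hw,
    ⟨inferInstance, _, inferInstance, w, inferInstance, hw, rfl⟩,
    fun c => typeIsDefinable_of_genericLine K g isSphericallyComplete_hahn extends_hahn
      (exists_hahnValuation_eq _) happ' hK hw c, fun hT => ?_⟩
  exact not_typeIsDefinable_of_genericLine K g extends_hahn happ' (isOrthonormalFor_hahn hτ) hπ0 hπ1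
    hK hw (hT _)

end HahnPair

end ModelPairs

theorem proposition1p8 (n : ℕ) (hn : 1 ≤ n) :
    ∃ (L : Type) (_ : ModelPairs.langVF.Structure L)
      (K : ModelPairs.langVF.ElementarySubstructure L),
      ModelPairs.IsACVF K ∧ ModelPairs.IsACVF L ∧
      ModelPairs.IsCMinimalTheory ModelPairs.cFormula (ModelPairs.langVF.completeTheory K) ∧
      ModelPairs.TypesDefinable n K ∧ ¬ ModelPairs.TypesDefinable (n + 1) K := by
  -- Any algebraically closed `k` of characteristic zero would do; `k'` is the algebraic closure of
  -- the field of rational functions in n variables, which serve as the independent residues.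
  let k := AlgebraicClosure ℚ
  let F := FractionRing (MvPolynomial (Fin n) k)
  let k' := AlgebraicClosure F
  have : CharZero k' := charZero_of_injective_algebraMap (algebraMap k k').injective
  have hτ : AlgebraicIndependent k fun i : Fin n =>
      algebraMap (MvPolynomial (Fin n) k) k' (MvPolynomial.X i) :=
    (MvPolynomial.algebraicIndependent_X (Fin n) k).map'
      (f := IsScalarTower.toAlgHom k (MvPolynomial (Fin n) k) k')
      ((algebraMap F k').injective.comp (IsFractionRing.injective (MvPolynomial (Fin n) k) F))
  obtain ⟨L, hL, K, hK, hL', h1, h2⟩ := ModelPairs.exists_pair hτ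
  exact ⟨L, hL, K, hK.isACVF, hL', ModelPairs.isCMinimalTheory_completeTheory hK, h1, h2⟩
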